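/- **Theorem 4.2.** The bisimilarity problem for probabilistic visibly pushdown automata (pvPDA) is in EXPTIME. In particular, so is the bisimilarity problem for standard visibly pushdown automata (vPDA). Here a *probabilistic pushdown automaton* is a tuple $\Delta=(Q,\Gamma,\Sigma,\hookrightarrow)$ with finite sets $Q$ of control states, $\Gamma$ of stack symbols and $\Sigma$ of actions, and a finite set $\hookrightarrow\ \subseteq Q\times\Gamma\times\Sigma\times\mathcal D(Q\times\Gamma^{\le 2})$ of rules, where $\mathcal D(A)$ is the set of probability distributions on $A$ with rational values and $\Gamma^{\le 2}$ is the set of words over $\Gamma$ of length at most $2$. It is a *pvPDA* if it comes with a partition $\Sigma=\Sigma_r\cup\Sigma_{int}\cup\Sigma_c$ (parts may be empty) such that for every rule $(q,X,a,d)$ the support of $d$ is contained in $Q\times\{\varepsilon\}$, $Q\times\Gamma$ or $Q\times\Gamma\Gamma$ according to whether $a$ is in $\Sigma_r$, $\Sigma_{int}$ or $\Sigma_c$; it is a (standard) *vPDA* if moreover every such $d$ is Dirac. $\Delta$ generates a transition system on the configurations $Q\times\Gamma^*$: each rule $(q,X,a,d)$ and each $\beta\in\Gamma^*$ give a transition $qX\beta\xrightarrow{a}d'$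 with $d'(p\alpha\beta)=d(p\alpha)$ for all $p\alpha$ in the support of $d$. An equivalence relation $R$ on configurations is a *bisimulation* if whenever $s\mathrel R t$ and $s\xrightarrow{a}d$, there is $t\xrightarrow{a}d'$ with $d(E)=d'(E)$ for every $R$-class $E$; two configurations are *bisimilar* if some bisimulation relates them. The *bisimilarity problem* for pvPDA (respectively vPDA) is: given a pvPDA (respectively vPDA) $\Delta$, presented explicitly with the probabilities written as quotients of integers in binary, and two configurations $q_1\alpha_1$, $q_2\alpha_2$ of $\Delta$, decide whether $q_1\alpha_1$ and $q_2\alpha_2$ are bisimilar. EXPTIME is the class of languages decided by a deterministic Turing machine in time $2^{p(n)}$ for some polynomial $p$ in the length $n$ of the input. -/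

import Mathlib

open scoped ENNReal NNReal

noncomputable section

namespace PVPDA

/-! ### Probabilistic labelled transition systems and bisimilarity -/

/-- A probabilistic labelled transition system with states `S` and actions `A`;
`(s, a, d) ∈ tran` is a transition from `s` with label `a` to the distribution `d`. -/
structure PLTS (S A : Type) where
  tran : Set (S × A × PMF S)

/-- Two distributions are `R`-equivalent if they give the same probability to each
equivalence class of `R`. -/
def DistEquiv {S : Type} (R : Setoid S) (d d' : PMF S) : Prop :=
  ∀ E ∈ R.classes, d.toOuterMeasure E = d'.toOuterMeasure E

/-- An equivalence relation that is a (probabilistic) bisimulation relation. -/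
def PLTS.IsBisimulation {S A : Type} (L : PLTS S A) (R : Setoid S) : Prop :=
  ∀ s t, R s t → ∀ a d, (s, a, d) ∈ L.tran → ∃ d', (t, a, d') ∈ L.tran ∧ DistEquiv R d d'

/-- Bisimilarity: the union of all bisimulation relations. -/
def PLTS.Bisimilar {S A : Type} (L : PLTS S A) (s t : S) : Prop :=
  ∃ R : Setoid S, L.IsBisimulation R ∧ R s t

/-! ### Probabilistic (visibly) pushdown automata -/

/-- Words of length at most two over `Γ`. -/
abbrev ShortWord (Γ : Type) : Type := {α : List Γ // α.length ≤ 2}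

/-- A probabilistic pushdown automaton with control states `Q`, stack alphabet `Γ` and action
alphabet `A`: a finite set of rules `(q, X, a, d)`, where `d` is a distribution with rational
probabilities on `Q × Γ^{≤ 2}`. -/
structure PPDA (Q Γ A : Type) [Finite Q] [Finite Γ] [Finite A] where
  rules : Set (Q × Γ × A × PMF (Q × ShortWord Γ))
  finite_rules : rules.Finite
  rational : ∀ q X a d, (q, X, a, d) ∈ rules → ∀ x, ∃ r : ℚ≥0, d x = ((r : ℝ≥0) : ℝ≥0∞)

/-- Configurations: a control state and a stack content, with the top of the stack first. -/
abbrev Config (Q Γ : Type) : Type := Q × List Γ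

section

variable {Q Γ A : Type} [Finite Q] [Finite Γ] [Finite A]

/-- The generated transition system: a rule `(q, X, a, d)` induces, for each stack content `β`, the
transition from `q X β` with label `a` to the distribution that gives `p α β` the probability
`d (p, α)`. -/
def PPDA.toPLTS (D : PPDA Q Γ A) : PLTS (Config Q Γ) A where
  tran := {t | ∃ q X a d, (q, X, a, d) ∈ D.rules ∧ ∃ β : List Γ,
    t = ((q, X :: β), a, d.map fun x => (x.1, x.2.1 ++ β))}

/-- A standard (non-probabilistic) pushdown automaton: all distributions in the rules are Dirac. -/
def PPDA.IsStandard (D : PPDA Q Γ A) : Prop :=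
  ∀ q X a d, (q, X, a, d) ∈ D.rules → ∃ x, d = PMF.pure x

end

/-- The three parts of the action alphabet of a visibly pushdown automaton. -/
inductive StackKind
  | ret
  | int
  | call

/-- The length of the word that replaces the top stack symbol. -/
def StackKind.width : StackKind → ℕ
  | ret => 0
  | int => 1
  | call => 2

/-- A probabilistic visibly pushdown automaton: a probabilistic pushdown automaton with a partition
of its actions (the fibres of `kind`) into return, internal and call actions. -/
structure PvPDA (Q Γ A : Type) [Finite Q] [Finite Γ] [Finite A] extends PPDA Q Γ A where
  kind : A → StackKind
  visibly : ∀ q X a d, (q, X, a, d) ∈ rules → ∀ x ∈ d.support, x.2.1.length = (kind a).width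

/-! ### Instances of the bisimilarity problem as finite words -/

/-- An entry `(num / den) · (p, α)` of a written-out distribution. -/
structure Entry (nQ nΓ : ℕ) where
  num : ℕ
  den : ℕ+
  target : Fin nQ × ShortWord (Fin nΓ)

/-- The probability of an entry. -/
def Entry.weight {nQ nΓ : ℕ} (e : Entry nQ nΓ) : ℝ≥0∞ := (e.num : ℝ≥0∞) / ((e.den : ℕ) : ℝ≥0∞)

/-- The list of entries `l` is a presentation of `d`, as a formal sum. -/
def PresentsDist {nQ nΓ : ℕ} (l : List (Entry nQ nΓ))
    (d : PMF (Fin nQ × ShortWord (Fin nΓ))) : Prop :=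
  ∀ x, d x = (l.map fun e => if e.target = x then e.weight else 0).sum

/-- A written-out rule. -/
structure RawRule (nQ nΓ nA : ℕ) where
  state : Fin nQ
  top : Fin nΓ
  action : Fin nA
  dist : List (Entry nQ nΓ)

/-- A written-out instance of the bisimilarity problem: the numbers of control states and of stack
symbols, the kinds of the actions, a list of rules, and two configurations. -/
structure Instance where
  numStates : ℕ
  numSymbols : ℕ
  kinds : List StackKind
  rules : List (RawRule numStates numSymbols kinds.length)
  left : Config (Fin numStates) (Fin numSymbols)
  right : Config (Fin numStates) (Fin numSymbols)

/-- The written-out instance describes the automaton `D`: same partition of the actions, and same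
set of rules (in particular each written-out distribution is a probability distribution). -/
def Instance.Presents (I : Instance)
    (D : PvPDA (Fin I.numStates) (Fin I.numSymbols) (Fin I.kinds.length)) : Prop :=
  (∀ a, D.kind a = I.kinds.get a) ∧
  (∀ r ∈ I.rules, ∃ d, (r.state, r.top, r.action, d) ∈ D.rules ∧ PresentsDist r.dist d) ∧
  (∀ q X a d, (q, X, a, d) ∈ D.rules →
    ∃ r ∈ I.rules, r.state = q ∧ r.top = X ∧ r.action = a ∧ PresentsDist r.dist d)

/-- The alphabet in which instances are written. -/
inductive Letter
  | bit (b : Bool)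
  | mark
  | close
  deriving DecidableEq, Fintype

/-- A number in binary, least significant bit first. -/
def encNat (n : ℕ) : List Letter := n.bits.map Letter.bit ++ [Letter.close]

/-- A number in unary. -/
def encUnary (n : ℕ) : List Letter := List.replicate n Letter.mark ++ [Letter.close]

/-- A list, with a mark in front of each item. -/
def encList {β : Type} (f : β → List Letter) (l : List β) : List Letter :=
  (l.flatMap fun x => Letter.mark :: f x) ++ [Letter.close]

/-- A word of names of stack symbols. -/
def encWord {n : ℕ} (w : List (Fin n)) : List Letter := encList (fun X => encNat X.val) w

/-- An entry; the probability is a quotient of integers in binary. -/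
def encEntry {nQ nΓ : ℕ} (e : Entry nQ nΓ) : List Letter :=
  encNat e.num ++ encNat e.den ++ encNat e.target.1.val ++ encWord e.target.2.1

/-- A rule. -/
def encRule {nQ nΓ nA : ℕ} (r : RawRule nQ nΓ nA) : List Letter :=
  encNat r.state.val ++ encNat r.top.val ++ encNat r.action.val ++ encList encEntry r.dist

/-- A configuration. -/
def encConfig {nQ nΓ : ℕ} (c : Config (Fin nQ) (Fin nΓ)) : List Letter :=
  encNat c.1.val ++ encWord c.2

/-- The word that encodes an instance. Every state, symbol and action contributes to its length, so
that it is polynomially related to the usual size of an explicitly given automaton. -/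
def Instance.encode (I : Instance) : List Letter :=
  encUnary I.numStates ++ encUnary I.numSymbols ++ encList (fun k => encNat k.width) I.kinds ++
    encList encRule I.rules ++ encConfig I.left ++ encConfig I.right

/-- The bisimilarity problem for probabilistic visibly pushdown automata: the words that encode an
automaton with two bisimilar configurations. -/
def pvPDABisimilarity : Language Letter :=
  {w | ∃ I : Instance, I.encode = w ∧
    ∃ D : PvPDA (Fin I.numStates) (Fin I.numSymbols) (Fin I.kinds.length),
      I.Presents D ∧ D.toPLTS.Bisimilar I.left I.right}

/-- The bisimilarity problem for standard visibly pushdown automata. -/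
def vPDABisimilarity : Language Letter :=
  {w | ∃ I : Instance, I.encode = w ∧
    ∃ D : PvPDA (Fin I.numStates) (Fin I.numSymbols) (Fin I.kinds.length),
      I.Presents D ∧ D.IsStandard ∧ D.toPLTS.Bisimilar I.left I.right}

/-! ### Deterministic exponential time -/

open Classical in
/-- `L` is in EXPTIME: some deterministic multi-stack Turing machine, with finite stack alphabets,
decides on every input word `w` whether `w ∈ L`, within `2 ^ p (|w|)` steps for a polynomial `p`. -/
def InEXPTIME {α : Type} [Fintype α] (L : Language α) : Prop :=
  ∃ (p : Polynomial ℕ) (M : Turing.TM2ComputableInTime (fun w : List α => w)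
      Computability.encodeBool (fun w => decide (w ∈ L))),
    (∀ k, Finite (M.tm.Γ k)) ∧ ∀ n, M.time n ≤ 2 ^ p.eval n

end PVPDA

end

/-! ### A structured language for stack machines -/

namespace StackProg

open PVPDA (Letter)

/-! The kind of an action fixes the length of the word that replaces the top of the stack, so
bisimilar configurations match moves with the same change of height. Hence, whether `pXβ` and `qYβ'`
are bisimilar depends on `β` and `β'` only through the relation `B` of the pairs `(p', q')` such
that `p'β` and `q'β'` are bisimilar. This dependence is a finite object: a table of tuples `(X, Y,
B, p, q)`, of size exponential in the automaton. A call that pushes `X X'` against `Y Y'` is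
evaluated by the nested lookup `T X Y (T X' Y' B)`.

The right table is the greatest fixed point of a monotone operator, `PPDA.refine`, and is reached by
deleting tuples from the full table until nothing changes (`PPDA.approx_stable`). Soundness is
`PPDA.isTransfer_configRel`: a stable table, evaluated along two stacks from the bottom up, gives a
relation between configurations that satisfies the transfer conditions. Completeness is
`PvPDA.approx_of_transfer`: bisimilar configurations survive every round of deletions. Together they
give `PvPDA.bisimilar_iff`.

The relations read off a table need not be equivalences. Therefore equality of masses on classes is
replaced by the lifting `d U ≤ d' (R U)`, which makes sense for every relation, is closed under
converse and composition, and leads to the same bisimilarity (`PLTS.bisimilar_iff_transfer`). It is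
decided by running through the sublists of the written-out entries (`lift_iff_sublist`).

For the time bound, let `n` be the length of the input and `N = 2 ^ (n * n + n)`. The relations
between states, the sublists of a distribution and the values of the unreduced numerators and
denominators are all bounded by `N`. So it suffices to have a procedure that is polynomial in the
input and `N` in unary, and that uses `N` to truncate everything that could grow
(`inEXPTIME_of_polyTime`). Such procedures are built from a small structured language for stack
machines, which is compiled into Turing machines step for step (`Run.steps`). Its programs act on
binary trees, and the functions they compute in polynomial time are closed under composition, case
distinction and size-bounded iteration, so that most running times follow from the shape of the
definitions. -/

/-- The binary work stacks. -/
inductive Stk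
  | val
  | tmp₁
  | tmp₂
  | tmp₃
  | cnt
  deriving DecidableEq

instance : Fintype Stk :=
  ⟨{.val, .tmp₁, .tmp₂, .tmp₃, .cnt}, fun x => by cases x <;> simp⟩

/-- The memory of a stack program: a register, the input stack and the work stacks. -/
@[ext]
structure St where
  reg : Option Letter
  inp : List Letter
  val : List Bool
  tmp₁ : List Bool
  tmp₂ : List Bool
  tmp₃ : List Bool
  cnt : List Bool

/-- The contents of a work stack. -/
def St.get (s : St) : Stk → List Bool
  | .val => s.val
  | .tmp₁ => s.tmp₁
  | .tmp₂ => s.tmp₂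
  | .tmp₃ => s.tmp₃
  | .cnt => s.cnt

/-- Overwrite a work stack. -/
def St.set (s : St) : Stk → List Bool → St
  | .val, l => { s with val := l }
  | .tmp₁, l => { s with tmp₁ := l }
  | .tmp₂, l => { s with tmp₂ := l }
  | .tmp₃, l => { s with tmp₃ := l }
  | .cnt, l => { s with cnt := l }

/-- Primitive instructions. -/
inductive Prim
  | push (k : Stk) (f : Option Letter → Bool)
  | pop (k : Stk)
  | read
  | clear
  | skip

/-- The effect of a primitive instruction. -/
def Prim.exec : Prim → St → St
  | push k f, s => s.set k (f s.reg :: s.get k)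
  | pop k, s => { s.set k (s.get k).tail with reg := (s.get k).head?.map Letter.bit }
  | read, s => { s with reg := s.inp.head?, inp := s.inp.tail }
  | clear, s => { s with reg := none }
  | skip, s => s

/-- Structured programs. -/
inductive Cmd
  | prim (p : Prim)
  | seq (a b : Cmd)
  | ite (t : Option Letter → Bool) (a b : Cmd)
  | loop (t : Option Letter → Bool) (c : Cmd)

/-- `Run c s s' n`: the program `c` leads from `s` to `s'` in exactly `n` steps. -/
inductive Run : Cmd → St → St → ℕ → Prop
  | prim (p : Prim) (s : St) : Run (.prim p) s (p.exec s) 1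
  | seq {a b : Cmd} {s s' s'' : St} {m n : ℕ} :
      Run a s s' m → Run b s' s'' n → Run (.seq a b) s s'' (m + n)
  | iteTrue {t : Option Letter → Bool} {a b : Cmd} {s s' : St} {m : ℕ} :
      t s.reg = true → Run a s s' m → Run (.ite t a b) s s' (m + 1)
  | iteFalse {t : Option Letter → Bool} {a b : Cmd} {s s' : St} {m : ℕ} :
      t s.reg = false → Run b s s' m → Run (.ite t a b) s s' (m + 1)
  | loopDone {t : Option Letter → Bool} {c : Cmd} {s : St} :
      t s.reg = false → Run (.loop t c) s s 1
  | loopStep {t : Option Letter → Bool} {c : Cmd} {s s' s'' : St} {m n : ℕ} :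
      t s.reg = true → Run c s s' m → Run (.loop t c) s' s'' n →
        Run (.loop t c) s s'' (m + n + 1)

/-! ### Compilation into Mathlib's multi-stack Turing machines -/

/-- The stack alphabets of the compiled machine; `none` is the input stack. -/
abbrev Alph : Option Stk → Type
  | none => Letter
  | some _ => Bool

/-- The stacks of the compiled machine. -/
def St.stacks (s : St) : ∀ k, List (Alph k)
  | none => s.inp
  | some k => s.get k

theorem St.stacks_set (s : St) (k : Stk) (l : List Bool) :
    (s.set k l).stacks = Function.update s.stacks (some k) l := by
  funext j
  cases j with
  | none => cases k <;> rfl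
  | some j => cases k <;> cases j <;> rfl

theorem St.reg_set (s : St) (k : Stk) (l : List Bool) : (s.set k l).reg = s.reg := by
  cases k <;> rfl

theorem St.stacks_reg (s : St) (r : Option Letter) : St.stacks { s with reg := r } = s.stacks := by
  funext j
  cases j with
  | none => rfl
  | some j => cases j <;> rfl

/-- The labels of the compiled program. -/
def Cmd.Lab : Cmd → Type
  | .prim _ => Unit
  | .seq a b => a.Lab ⊕ b.Lab
  | .ite _ a b => Option (a.Lab ⊕ b.Lab)
  | .loop _ c => Option c.Lab

noncomputable instance Cmd.labFintype : (c : Cmd) → Fintype c.Lab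
  | .prim _ => inferInstanceAs (Fintype Unit)
  | .seq a b =>
    have := Cmd.labFintype a
    have := Cmd.labFintype b
    inferInstanceAs (Fintype (a.Lab ⊕ b.Lab))
  | .ite _ a b =>
    have := Cmd.labFintype a
    have := Cmd.labFintype b
    inferInstanceAs (Fintype (Option (a.Lab ⊕ b.Lab)))
  | .loop _ c =>
    have := Cmd.labFintype c
    inferInstanceAs (Fintype (Option c.Lab))

/-- The label at which the compiled program starts. -/
def Cmd.entry : (c : Cmd) → c.Lab
  | .prim _ => ()
  | .seq a _ => Sum.inl a.entry
  | .ite _ _ _ => none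
  | .loop _ _ => none

open Turing (TM2.Stmt)

/-- The statement of a primitive instruction, followed by a jump. -/
def Prim.stmt {Λ : Type} (e : Λ) : Prim → TM2.Stmt Alph Λ (Option Letter)
  | push k f => .push (some k) f (.goto fun _ => e)
  | pop k => .pop (some k) (fun _ x => x.map Letter.bit) (.goto fun _ => e)
  | read => .pop none (fun _ x => x) (.goto fun _ => e)
  | clear => .load (fun _ => none) (.goto fun _ => e)
  | skip => .goto fun _ => e

/-- The compiled program, whose labels are embedded by `emb` into those of a larger machine, where
`e` is the label to continue with. -/
def Cmd.compile {Λ : Type} : (c : Cmd) → (c.Lab → Λ) → Λ → c.Lab → TM2.Stmt Alph Λ (Option Letter)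
  | .prim p, _, e, _ => p.stmt e
  | .seq a b, emb, _, .inl l => a.compile (fun x => emb (.inl x)) (emb (.inr b.entry)) l
  | .seq _ b, emb, e, .inr l => b.compile (fun x => emb (.inr x)) e l
  | .ite t a b, emb, _, none =>
    .branch t (.goto fun _ => emb (some (.inl a.entry))) (.goto fun _ => emb (some (.inr b.entry)))
  | .ite _ a _, emb, e, some (.inl l) => a.compile (fun x => emb (some (.inl x))) e l
  | .ite _ _ b, emb, e, some (.inr l) => b.compile (fun x => emb (some (.inr x))) e l
  | .loop t c, emb, e, none =>
    .branch t (.goto fun _ => emb (some c.entry)) (.goto fun _ => e)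
  | .loop _ c, emb, _, some l => c.compile (fun x => emb (some x)) (emb none) l

/-- The configuration of the compiled machine. -/
def St.cfg {Λ : Type} (s : St) (l : Option Λ) : Turing.TM2.Cfg Alph Λ (Option Letter) :=
  ⟨l, s.reg, s.stacks⟩

/-- `n` steps of a machine. -/
def Steps {Λ : Type} (M : Λ → TM2.Stmt Alph Λ (Option Letter)) (n : ℕ)
    (a b : Turing.TM2.Cfg Alph Λ (Option Letter)) : Prop :=
  (flip bind (Turing.TM2.step M))^[n] (some a) = some b

theorem Steps.trans {Λ : Type} {M : Λ → TM2.Stmt Alph Λ (Option Letter)} {m n : ℕ}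
    {a b c : Turing.TM2.Cfg Alph Λ (Option Letter)} (h : Steps M m a b) (h' : Steps M n b c) :
    Steps M (m + n) a c := by
  unfold Steps at *
  rw [Nat.add_comm, Function.iterate_add_apply, h, h']

theorem Steps.single {Λ : Type} {M : Λ → TM2.Stmt Alph Λ (Option Letter)} {l : Λ} {s : St}
    {b : Turing.TM2.Cfg Alph Λ (Option Letter)}
    (h : Turing.TM2.stepAux (M l) s.reg s.stacks = b) : Steps M 1 (s.cfg (some l)) b := by
  subst h; rfl

theorem Prim.stepAux_stmt {Λ : Type} (p : Prim) (e : Λ) (s : St) :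
    Turing.TM2.stepAux (p.stmt e) s.reg s.stacks = (p.exec s).cfg (some e) := by
  cases p with
  | push k f => simp [Prim.stmt, Prim.exec, St.cfg, St.stacks_set, St.reg_set, St.stacks]
  | pop k => simp [Prim.stmt, Prim.exec, St.cfg, St.stacks_set, St.stacks_reg, St.stacks]
  | read =>
    simp only [Prim.stmt, Prim.exec, St.cfg, Turing.TM2.stepAux]
    congr 1
    funext j
    cases j with
    | none => simp [St.stacks]
    | some j => cases j <;> rfl
  | clear => simp [Prim.stmt, Prim.exec, St.cfg, St.stacks_reg]
  | skip => simp [Prim.stmt, Prim.exec, St.cfg]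

/-- The embedding `emb` and the exit label `e` are arbitrary, because the induction passes to
subprograms compiled inside the label set of the whole machine. Sequencing costs nothing: the last
jump of the first program goes to the entry of the second. -/
theorem Run.steps {Λ : Type} {M : Λ → TM2.Stmt Alph Λ (Option Letter)} {c : Cmd} {s s' : St} {n : ℕ}
    (h : Run c s s' n) : ∀ (emb : c.Lab → Λ) (e : Λ), (∀ l, M (emb l) = c.compile emb e l) →
      Steps M n (s.cfg (some (emb c.entry))) (s'.cfg (some e)) := by
  induction h with
  | prim p s =>
    intro emb e hM
    apply Steps.single
    rw [hM]
    exact p.stepAux_stmt e s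
  | @seq a b s s' s'' m n _ _ iha ihb =>
    intro emb e hM
    exact (iha (fun x => emb (.inl x)) _ fun l => hM (.inl l)).trans
      (ihb (fun x => emb (.inr x)) _ fun l => hM (.inr l))
  | @iteTrue t a b s s' m ht _ ih =>
    intro emb e hM
    rw [Nat.add_comm]
    refine Steps.trans (Steps.single ?_)
      (ih (fun x => emb (some (.inl x))) _ fun l => hM (some (.inl l)))
    rw [hM]
    simp [Cmd.compile, Cmd.entry, ht, St.cfg]
  | @iteFalse t a b s s' m ht _ ih =>
    intro emb e hM
    rw [Nat.add_comm]
    refine Steps.trans (Steps.single ?_)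
      (ih (fun x => emb (some (.inr x))) _ fun l => hM (some (.inr l)))
    rw [hM]
    simp [Cmd.compile, Cmd.entry, ht, St.cfg]
  | @loopDone t c s ht =>
    intro emb e hM
    apply Steps.single
    rw [hM]
    simp [Cmd.compile, Cmd.entry, ht, St.cfg]
  | @loopStep t c s s' s'' m n ht _ _ ih ih' =>
    intro emb e hM
    rw [Nat.add_comm]
    refine Steps.trans (Steps.single ?_) ((ih (fun x => emb (some x)) _ fun l => hM (some l)).trans
      (ih' emb e hM))
    rw [hM]
    simp [Cmd.compile, Cmd.entry, ht, St.cfg]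

/-- The memory with a given input word. -/
def St.input (w : List Letter) : St := ⟨none, w, [], [], [], [], []⟩

/-- The memory with a given output word. -/
def St.output (l : List Bool) : St := ⟨none, [], l, [], [], [], []⟩

/-- The machine that runs a program and halts. -/
noncomputable def Cmd.machine (c : Cmd) : Turing.FinTM2 where
  K := Option Stk
  k₀ := none
  k₁ := some .val
  Γ := Alph
  Λ := Option c.Lab
  main := some c.entry
  σ := Option Letter
  initialState := none
  Γk₀Fin := inferInstanceAs (Fintype Letter)
  m
    | none => .halt
    | some l => c.compile some none l

/-- A program that decides a language within a time bound yields a machine. -/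
noncomputable def Cmd.computable (c : Cmd) (f : List Letter → Bool) (time : ℕ → ℕ)
    (h : ∀ w, ∃ n ≤ time w.length, Run c (St.input w) (St.output [f w]) n) :
    Turing.TM2ComputableInTime (fun w : List Letter => w) Computability.encodeBool f where
  tm := c.machine
  inputAlphabet := Equiv.refl Letter
  outputAlphabet := Equiv.refl Bool
  -- The additional step executes the halting statement at the label `none`.
  time n := time n + 1
  outputsFun w :=
    { steps := (h w).choose + 1
      steps_le_m := Nat.succ_le_succ (h w).choose_spec.1
      evals_in_steps := by
        have h₁ := (h w).choose_spec.2.steps (M := c.machine.m) some none fun _ => rfl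
        have h₂ : Steps c.machine.m 1 ((St.output [f w]).cfg (some none))
            ((St.output [f w]).cfg none) := Steps.single rfl
        have h₃ := h₁.trans h₂
        unfold Steps at h₃
        have e₁ : Turing.initList c.machine (List.map (Equiv.refl Letter).invFun w)
            = (St.input w).cfg (some (some c.entry)) := by
          unfold Turing.initList St.cfg
          congr 1
          funext k
          rcases k with _ | k
          · simp only [St.stacks, St.input, Cmd.machine]
            exact List.map_id w
          · cases k <;> simp [St.stacks, St.input, Cmd.machine, St.get]
        have e₂ : Turing.haltList c.machine
            (List.map (Equiv.refl Bool).invFun (Computability.encodeBool (f w)))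
            = (St.output [f w]).cfg none := by
          unfold Turing.haltList St.cfg
          congr 1
          funext k
          rcases k with _ | k
          · simp [St.stacks, St.output, Cmd.machine]
          · cases k <;> simp [St.stacks, St.output, Cmd.machine, St.get, Computability.encodeBool]
            rfl
        erw [e₁, Option.map_some, e₂]
        exact h₃ }

end StackProg

/-! ### Running times as upper bounds, and trees as data on the stacks. -/

namespace StackProg

open PVPDA (Letter)

/-! ### Running times up to an upper bound -/

/-- `Runs c s s' n`: the program `c` leads from `s` to `s'` in at most `n` steps. -/
def Runs (c : Cmd) (s s' : St) (n : ℕ) : Prop := ∃ m ≤ n, Run c s s' m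

theorem Runs.mono {c : Cmd} {s s' : St} {m n : ℕ} (h : Runs c s s' m) (hmn : m ≤ n) :
    Runs c s s' n :=
  let ⟨k, hk, hr⟩ := h
  ⟨k, hk.trans hmn, hr⟩

theorem Runs.of_eq {c : Cmd} {s s' t t' : St} {m n : ℕ} (h : Runs c s s' m) (hs : s = t)
    (hs' : s' = t') (hmn : m ≤ n) : Runs c t t' n :=
  hs ▸ hs' ▸ h.mono hmn

theorem Runs.prim {p : Prim} {s s' : St} (h : p.exec s = s') : Runs (.prim p) s s' 1 :=
  ⟨1, le_rfl, h ▸ Run.prim p s⟩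

theorem Runs.seq {a b : Cmd} {s s' s'' : St} {m n : ℕ} (h : Runs a s s' m) (h' : Runs b s' s'' n) :
    Runs (.seq a b) s s'' (m + n) :=
  let ⟨_, hk, hr⟩ := h
  let ⟨_, hk', hr'⟩ := h'
  ⟨_, Nat.add_le_add hk hk', hr.seq hr'⟩

theorem Runs.iteTrue {t : Option Letter → Bool} {a b : Cmd} {s s' : St} {m : ℕ}
    (ht : t s.reg = true) (h : Runs a s s' m) : Runs (.ite t a b) s s' (m + 1) :=
  let ⟨_, hk, hr⟩ := h
  ⟨_, Nat.succ_le_succ hk, Run.iteTrue ht hr⟩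

theorem Runs.iteFalse {t : Option Letter → Bool} {a b : Cmd} {s s' : St} {m : ℕ}
    (ht : t s.reg = false) (h : Runs b s s' m) : Runs (.ite t a b) s s' (m + 1) :=
  let ⟨_, hk, hr⟩ := h
  ⟨_, Nat.succ_le_succ hk, Run.iteFalse ht hr⟩

theorem Runs.loopDone {t : Option Letter → Bool} {c : Cmd} {s : St} (ht : t s.reg = false) :
    Runs (.loop t c) s s 1 :=
  ⟨1, le_rfl, Run.loopDone ht⟩

theorem Runs.loopStep {t : Option Letter → Bool} {c : Cmd} {s s' s'' : St} {m n : ℕ}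
    (ht : t s.reg = true) (h : Runs c s s' m) (h' : Runs (.loop t c) s' s'' n) :
    Runs (.loop t c) s s'' (m + n + 1) :=
  let ⟨_, hk, hr⟩ := h
  let ⟨_, hk', hr'⟩ := h'
  ⟨_, Nat.succ_le_succ (Nat.add_le_add hk hk'), Run.loopStep ht hr hr'⟩

/-- The total number of symbols on the stacks. -/
def St.total (s : St) : ℕ :=
  s.inp.length + s.val.length + s.tmp₁.length + s.tmp₂.length + s.tmp₃.length + s.cnt.length

/-- A step pushes at most one symbol, so time bounds space. Bounds on the size of results are
derived from running times in this way. -/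
theorem Run.total_le {c : Cmd} {s s' : St} {n : ℕ} (h : Run c s s' n) :
    s'.total ≤ s.total + n := by
  induction h with
  | prim p s =>
    cases p with
    | push k f => cases k <;> simp [Prim.exec, St.set, St.get, St.total] <;> lia
    | pop k => cases k <;> simp [Prim.exec, St.set, St.get, St.total] <;> lia
    | read => simp [Prim.exec, St.total]; lia
    | clear => simp [Prim.exec, St.total]
    | skip => simp [Prim.exec]
  | seq _ _ h h' => lia
  | iteTrue _ _ h => lia
  | iteFalse _ _ h => lia
  | loopDone _ => lia
  | loopStep _ _ _ h h' => lia

/-! ### Binary trees as data -/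

/-- Binary trees. -/
inductive Tree
  | nil
  | cons (a b : Tree)

/-- The representation of a tree on a stack, in Polish notation. -/
def Tree.word : Tree → List Bool
  | nil => [false]
  | cons a b => true :: (a.word ++ b.word)

/-- The number of nodes of a tree. -/
def Tree.size (t : Tree) : ℕ := t.word.length

@[simp] theorem Tree.size_nil : Tree.nil.size = 1 := rfl

@[simp] theorem Tree.size_cons (a b : Tree) : (Tree.cons a b).size = a.size + b.size + 1 := by
  simp [Tree.size, Tree.word]

theorem Tree.size_pos (t : Tree) : 0 < t.size := by
  cases t <;> simp

/-- Polish notation is prefix-free; the arbitrary suffixes `u` and `v` make this provable by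
recursion on the tree. -/
theorem Tree.word_append_injective :
    ∀ {a b : Tree} {u v : List Bool}, a.word ++ u = b.word ++ v → a = b ∧ u = v
  | nil, nil, _, _, h => by simpa [Tree.word] using h
  | nil, cons _ _, _, _, h => by simp [Tree.word] at h
  | cons _ _, nil, _, _, h => by simp [Tree.word] at h
  | cons a b, cons c d, _, _, h => by
    simp only [Tree.word, List.cons_append, List.append_assoc, List.cons.injEq, true_and] at h
    obtain ⟨e, h⟩ := Tree.word_append_injective h
    obtain ⟨e', h⟩ := Tree.word_append_injective h
    exact ⟨by rw [e, e'], h⟩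

theorem Tree.word_injective : Function.Injective Tree.word := fun a b h =>
  (Tree.word_append_injective (u := []) (v := []) (by simpa using h)).1

/-! ### Programs that manipulate trees on the value stack -/

infixr:60 " ;; " => Cmd.seq

/-- The bit in the register. -/
def regBit : Option Letter → Bool
  | some (.bit b) => b
  | _ => false

/-- Push a fixed bit. -/
def push (k : Stk) (b : Bool) : Cmd := .prim (.push k fun _ => b)

/-- Push the bit in the register. -/
def pushReg (k : Stk) : Cmd := .prim (.push k regBit)

/-- Pop a bit into the register. -/
def pop (k : Stk) : Cmd := .prim (.pop k)

/-- Clear the register. -/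
def clear : Cmd := .prim .clear

/-- Do nothing. -/
def skip : Cmd := .prim .skip

/-- Push the bit in the register if a flag is set. -/
def pushIf (k : Stk) : Bool → Cmd
  | true => pushReg k
  | false => skip

/-- The body of the loop of `scan`. -/
def scanBody (f₁ f₂ f₃ : Bool) : Cmd :=
  -- `cnt` counts in unary the subtrees still expected after the current one: an inner node adds
  -- one, a leaf removes one. At the end of the tree the pop from `cnt` fails and leaves an empty
  -- register, which stops the loop.
  pop .val ;; (pushIf .tmp₁ f₁ ;; pushIf .tmp₂ f₂ ;; pushIf .tmp₃ f₃) ;;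
    .ite regBit (push .cnt true ;; push .cnt true) skip ;; pop .cnt

/-- Move the topmost tree of the value stack to each of the flagged stacks, in reverse. -/
def scan (f₁ f₂ f₃ : Bool) : Cmd :=
  -- This only makes the register nonempty, so that the loop is entered with an empty counter.
  push .cnt true ;; pop .cnt ;;
    .loop Option.isSome (scanBody f₁ f₂ f₃)

/-- Prepend the reverse of a list if a flag is set. -/
def prependIf (f : Bool) (l x : List Bool) : List Bool := if f then l.reverse ++ x else x

theorem prependIf_append (f : Bool) (l l' x : List Bool) :
    prependIf f (l ++ l') x = prependIf f l' (prependIf f l x) := by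
  cases f <;> simp [prependIf]

theorem prependIf_cons (f : Bool) (b : Bool) (l x : List Bool) :
    prependIf f (b :: l) x = prependIf f l (prependIf f [b] x) := by
  cases f <;> simp [prependIf]

theorem runs_pushIfs (f₁ f₂ f₃ b : Bool) (i : List Letter) (v x₁ x₂ x₃ c : List Bool) :
    Runs (pushIf .tmp₁ f₁ ;; pushIf .tmp₂ f₂ ;; pushIf .tmp₃ f₃)
      ⟨some (.bit b), i, v, x₁, x₂, x₃, c⟩
      ⟨some (.bit b), i, v, prependIf f₁ [b] x₁, prependIf f₂ [b] x₂, prependIf f₃ [b] x₃, c⟩ 3 :=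
          by
  refine Runs.seq (m := 1) (n := 2)
    (s' := ⟨some (.bit b), i, v, prependIf f₁ [b] x₁, x₂, x₃, c⟩) ?_
    (Runs.seq (m := 1) (n := 1)
      (s' := ⟨some (.bit b), i, v, prependIf f₁ [b] x₁, prependIf f₂ [b] x₂, x₃, c⟩) ?_ ?_)
  · cases f₁ <;> exact Runs.prim rfl
  · cases f₂ <;> exact Runs.prim rfl
  · cases f₃ <;> exact Runs.prim rfl

theorem runs_scanBody (f₁ f₂ f₃ : Bool) (i : List Letter) (r : Option Letter) (b : Bool)
    (v x₁ x₂ x₃ c : List Bool) :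
    Runs (scanBody f₁ f₂ f₃) ⟨r, i, b :: v, x₁, x₂, x₃, c⟩
      ⟨if b then some (.bit true) else c.head?.map .bit, i, v, prependIf f₁ [b] x₁,
        prependIf f₂ [b] x₂, prependIf f₃ [b] x₃, if b then true :: c else c.tail⟩ 8 := by
  have h : Runs (pop .val) ⟨r, i, b :: v, x₁, x₂, x₃, c⟩ ⟨some (.bit b), i, v, x₁, x₂, x₃, c⟩ 1 :=
    Runs.prim rfl
  have h' := runs_pushIfs f₁ f₂ f₃ b i v x₁ x₂ x₃ c
  cases b
  · exact (h.seq (h'.seq ((Runs.iteFalse rfl (Runs.prim rfl)).seq (Runs.prim rfl)))).mono (by simp)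
  · exact h.seq (h'.seq ((Runs.iteTrue rfl ((Runs.prim rfl).seq (Runs.prim rfl))).seq
      (Runs.prim rfl)))

/-- Stated in continuation form, so that the induction hypotheses for the two subtrees can be
chained. A node costs eight steps of the body and one loop test. -/
theorem runs_scan_loop (f₁ f₂ f₃ : Bool) (i : List Letter) (t : Tree) :
    ∀ (b : Bool) (rest x₁ x₂ x₃ c : List Bool) (s' : St) (n : ℕ),
      Runs (.loop Option.isSome (scanBody f₁ f₂ f₃))
        ⟨c.head?.map .bit, i, rest, prependIf f₁ t.word x₁, prependIf f₂ t.word x₂,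
          prependIf f₃ t.word x₃, c.tail⟩ s' n →
      Runs (.loop Option.isSome (scanBody f₁ f₂ f₃))
        ⟨some (.bit b), i, t.word ++ rest, x₁, x₂, x₃, c⟩ s' (n + 9 * t.size) := by
  induction t with
  | nil =>
    intro b rest x₁ x₂ x₃ c s' n h
    refine (Runs.loopStep rfl (runs_scanBody f₁ f₂ f₃ i _ false rest x₁ x₂ x₃ c) h).mono ?_
    simp; lia
  | cons a d iha ihd =>
    intro b rest x₁ x₂ x₃ c s' n h
    simp only [Tree.word, prependIf_cons (l := a.word ++ d.word), prependIf_append] at h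
    have h₂ := iha true _ _ _ _ (true :: c) _ _ (ihd true _ _ _ _ _ _ _ h)
    have h₁ := runs_scanBody f₁ f₂ f₃ i (some (.bit b)) true (a.word ++ (d.word ++ rest)) x₁ x₂ x₃ c
    refine (Runs.loopStep rfl h₁ h₂).of_eq ?_ rfl ?_
    · simp [Tree.word]
    · simp; lia

theorem runs_scan (f₁ f₂ f₃ : Bool) (i : List Letter) (t : Tree) (r : Option Letter)
    (rest x₁ x₂ x₃ : List Bool) :
    Runs (scan f₁ f₂ f₃) ⟨r, i, t.word ++ rest, x₁, x₂, x₃, []⟩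
      ⟨none, i, rest, prependIf f₁ t.word x₁, prependIf f₂ t.word x₂, prependIf f₃ t.word x₃, []⟩
      (9 * t.size + 3) := by
  refine (Runs.seq (Runs.prim rfl) (Runs.seq (Runs.prim rfl)
    (runs_scan_loop f₁ f₂ f₃ i t true rest x₁ x₂ x₃ [] _ 1 (Runs.loopDone rfl)))).mono ?_
  lia

/-- Move a stack back to the value stack. -/
def back (k : Stk) : Cmd := pop k ;; .loop Option.isSome (pushReg .val ;; pop k)

theorem runs_back (k : Stk) (hk : k ≠ .val) (l : List Bool) :
    ∀ s : St, s.get k = l → Runs (back k) s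
      { (s.set .val (l.reverse ++ s.val)).set k [] with reg := none } (3 * l.length + 2) := by
  have key : ∀ (l : List Bool) (s : St), s.get k = l →
      Runs (.loop Option.isSome (pushReg .val ;; pop k))
        { s.set k l.tail with reg := l.head?.map .bit }
        { (s.set .val (l.reverse ++ s.val)).set k [] with reg := none } (3 * l.length + 1) := by
    intro l
    induction l with
    | nil =>
      intro s _
      refine (Runs.loopDone ?_).of_eq (s := { s.set k [] with reg := none }) ?_ ?_ ?_
      · rfl
      · rfl
      · cases k <;> simp_all [St.set]
      · simp
    | cons b l ih =>
      intro s hs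
      have h := ih ((s.set .val (b :: s.val)).set k l) (by cases k <;> simp_all [St.set, St.get])
      refine (Runs.loopStep (t := Option.isSome) (c := pushReg .val ;; pop k)
        (s := { s.set k (b :: l).tail with reg := some (.bit b) }) (m := 2) rfl
        (Runs.seq (m := 1) (n := 1) (Runs.prim rfl) (Runs.prim ?_)) h).of_eq rfl ?_ ?_
      · cases k <;> simp_all [St.set, St.get, Prim.exec, regBit]
      · cases k <;> simp_all [St.set]
      · simp; lia
  intro s hs
  refine (Runs.seq (m := 1) (s' := { s.set k l.tail with reg := l.head?.map .bit })
    (Runs.prim ?_) (key l s hs)).mono ?_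
  · simp [Prim.exec, hs]
  · lia

/-- The memory between two tree operations. -/
def base (v x₁ x₂ x₃ : List Bool) : St := ⟨none, [], v, x₁, x₂, x₃, []⟩

theorem runs_back₁ (v x₁ x₂ x₃ : List Bool) :
    Runs (back .tmp₁) (base v x₁ x₂ x₃) (base (x₁.reverse ++ v) [] x₂ x₃) (3 * x₁.length + 2) :=
  runs_back .tmp₁ (by simp) x₁ (base v x₁ x₂ x₃) rfl

theorem runs_back₂ (v x₁ x₂ x₃ : List Bool) :
    Runs (back .tmp₂) (base v x₁ x₂ x₃) (base (x₂.reverse ++ v) x₁ [] x₃) (3 * x₂.length + 2) :=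
  runs_back .tmp₂ (by simp) x₂ (base v x₁ x₂ x₃) rfl

theorem runs_back₃ (v x₁ x₂ x₃ : List Bool) :
    Runs (back .tmp₃) (base v x₁ x₂ x₃) (base (x₃.reverse ++ v) x₁ x₂ []) (3 * x₃.length + 2) :=
  runs_back .tmp₃ (by simp) x₃ (base v x₁ x₂ x₃) rfl

theorem runs_scan_base (f₁ f₂ f₃ : Bool) (t : Tree) (rest x₁ x₂ x₃ : List Bool) :
    Runs (scan f₁ f₂ f₃) (base (t.word ++ rest) x₁ x₂ x₃)
      (base rest (prependIf f₁ t.word x₁) (prependIf f₂ t.word x₂) (prependIf f₃ t.word x₃))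
      (9 * t.size + 3) :=
  runs_scan f₁ f₂ f₃ [] t none rest x₁ x₂ x₃

/-- Drop the topmost tree. -/
def drop : Cmd := scan false false false

theorem runs_drop (t : Tree) (rest x₁ x₂ x₃ : List Bool) :
    Runs drop (base (t.word ++ rest) x₁ x₂ x₃) (base rest x₁ x₂ x₃) (9 * t.size + 3) :=
  runs_scan_base false false false t rest x₁ x₂ x₃

/-- Duplicate the topmost tree. -/
def dup : Cmd := scan true true false ;; back .tmp₁ ;; back .tmp₂

theorem runs_dup (t : Tree) (rest : List Bool) :
    Runs dup (base (t.word ++ rest) [] [] []) (base (t.word ++ (t.word ++ rest)) [] [] [])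
      (15 * t.size + 7) := by
  refine ((runs_scan_base true true false t rest [] [] []).seq
    ((runs_back₁ _ _ _ _).seq (runs_back₂ _ _ _ _))).of_eq rfl ?_ ?_
  · simp [prependIf]
  · simp [prependIf, Tree.size]; lia

/-- Exchange the two topmost trees. -/
def swap : Cmd := scan true false false ;; scan false true false ;; back .tmp₁ ;; back .tmp₂

/-- `x₃` is arbitrary because a fold parks the current item on `tmp₃` while it exchanges the
remaining list and the state. -/
theorem runs_swap (a b : Tree) (rest x₃ : List Bool) :
    Runs swap (base (a.word ++ (b.word ++ rest)) [] [] x₃) (base (b.word ++ (a.word ++ rest)) []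
        [] x₃)
      (12 * (a.size + b.size) + 10) := by
  refine ((runs_scan_base true false false a _ [] [] x₃).seq
    ((runs_scan_base false true false b _ _ _ _).seq
    ((runs_back₁ _ _ _ _).seq (runs_back₂ _ _ _ _)))).of_eq rfl ?_ ?_
  · simp [prependIf]
  · simp [prependIf, Tree.size]; lia

/-- `Computes c t u n`: on a memory with `t` on top of the value stack, the program `c` replaces
`t` by `u` within `n` steps. -/
def Computes (c : Cmd) (t u : Tree) (n : ℕ) : Prop :=
  ∀ rest, Runs c (base (t.word ++ rest) [] [] []) (base (u.word ++ rest) [] [] []) n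

theorem Computes.mono {c : Cmd} {t u : Tree} {m n : ℕ} (h : Computes c t u m) (hmn : m ≤ n) :
    Computes c t u n :=
  fun rest => (h rest).mono hmn

theorem Computes.size_le {c : Cmd} {t u : Tree} {n : ℕ} (h : Computes c t u n) :
    u.size ≤ t.size + n := by
  obtain ⟨m, hm, hr⟩ := h []
  have := hr.total_le
  simp [base, St.total] at this
  simp only [Tree.size]
  lia

theorem Computes.seq {c d : Cmd} {t u v : Tree} {m n : ℕ} (h : Computes c t u m)
    (h' : Computes d u v n) : Computes (c ;; d) t v (m + n) :=
  fun rest => (h rest).seq (h' rest)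

theorem computes_skip (t : Tree) : Computes skip t t 1 := fun _ => Runs.prim rfl

/-- Pop a symbol and forget it. -/
def popVal : Cmd := pop .val ;; clear

theorem runs_popVal (b : Bool) (v : List Bool) :
    Runs popVal (base (b :: v) [] [] []) (base v [] [] []) 2 :=
  (Runs.prim rfl).seq (Runs.prim rfl)

/-- Replace the topmost tree by its first subtree. -/
def takeFst : Cmd := popVal ;; scan true false false ;; drop ;; back .tmp₁

theorem computes_takeFst (a b : Tree) :
    Computes takeFst (.cons a b) a (12 * (Tree.cons a b).size) := by
  intro rest
  refine (runs_popVal true (a.word ++ (b.word ++ rest))).seq ((runs_scan_base true false false a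
    (b.word ++ rest) [] [] []).seq ((runs_drop b _ _ _ _).seq (runs_back₁ _ _ _ _))) |>.of_eq
    ?_ ?_ ?_
  · simp [Tree.word]
  · simp [prependIf]
  · simp [prependIf, Tree.size, Tree.word]; lia

/-- Replace the topmost tree by its second subtree. -/
def takeSnd : Cmd := popVal ;; drop

theorem computes_takeSnd (a b : Tree) :
    Computes takeSnd (.cons a b) b (12 * (Tree.cons a b).size) := by
  intro rest
  refine (runs_popVal true ((a.word ++ b.word) ++ rest)).seq
    ((runs_drop a (b.word ++ rest) [] [] []).of_eq ?_ rfl le_rfl) |>.mono ?_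
  · simp
  · simp; lia

/-- Pair the results of two programs. -/
def pairUp (c d : Cmd) : Cmd := dup ;; d ;; swap ;; c ;; push .val true

theorem Computes.pairUp {c d : Cmd} {t u v : Tree} {m n : ℕ} (h : Computes c t u m)
    (h' : Computes d t v n) :
    Computes (pairUp c d) t (.cons u v) (m + n + (27 * t.size + 12 * v.size + 18)) := by
  intro rest
  refine (Runs.seq (runs_dup t rest) (Runs.seq (h' _) (Runs.seq (runs_swap v t rest [])
    (Runs.seq (h _) (Runs.prim ?_))))).mono
      (m := 15 * t.size + 7 + (n + ((12 * (v.size + t.size) + 10) + (m + 1)))) ?_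
  · simp [base, Prim.exec, St.set, St.get, Tree.word]
  · lia

/-- Push the word of a constant tree. -/
def pushWord : List Bool → Cmd
  | [] => skip
  | b :: l => pushWord l ;; push .val b

theorem runs_pushWord (l : List Bool) (v : List Bool) :
    Runs (pushWord l) (base v [] [] []) (base (l ++ v) [] [] []) (l.length + 1) := by
  induction l with
  | nil => exact Runs.prim rfl
  | cons b l ih => exact Runs.seq ih (Runs.prim rfl)

/-- Replace the topmost tree by a constant. -/
def constant (t : Tree) : Cmd := drop ;; pushWord t.word

theorem computes_constant (t u : Tree) :
    Computes (constant u) t u (9 * t.size + u.size + 4) := by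
  intro rest
  refine (Runs.seq (runs_drop t rest [] [] []) (runs_pushWord _ _)).mono ?_
  simp only [Tree.size]
  lia

/-- Branch on whether the first component is empty; it is kept if it is not. -/
def branch (c d : Cmd) : Cmd :=
  -- The two symbols are the root of the pair and the root of its first component. If the latter is
  -- a leaf, it is thereby used up and the second component remains; otherwise both symbols are put
  -- back.
  pop .val ;; pop .val ;; .ite regBit (push .val true ;; push .val true ;; clear ;; d) (clear ;; c)

theorem Computes.branch_nil {c d : Cmd} {t u : Tree} {n : ℕ} (h : Computes c t u n) :
    Computes (branch c d) (.cons .nil t) u (n + 10) := by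
  intro rest
  refine (Runs.seq (Runs.prim rfl) (Runs.seq (Runs.prim rfl)
    (Runs.iteFalse ?_ (Runs.seq (Runs.prim rfl) (cast ?_ (h rest)))))).mono
      (m := 1 + (1 + ((1 + n) + 1))) ?_
  · simp [base, Prim.exec, St.set, St.get, Tree.word, regBit]
  · simp [base, Prim.exec, St.set, St.get, Tree.word]
  · lia

theorem Computes.branch_cons {c d : Cmd} {a b t u : Tree} {n : ℕ}
    (h : Computes d (.cons (.cons a b) t) u n) :
    Computes (branch c d) (.cons (.cons a b) t) u (n + 10) := by
  intro rest
  refine (Runs.seq (Runs.prim rfl) (Runs.seq (Runs.prim rfl)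
    (Runs.iteTrue ?_ (Runs.seq (Runs.prim rfl) (Runs.seq (Runs.prim rfl) (Runs.seq (Runs.prim rfl)
      (cast ?_ (h rest)))))))).mono
      (m := 1 + (1 + ((1 + (1 + (1 + n))) + 1))) ?_
  · simp [base, Prim.exec, St.set, St.get, Tree.word, regBit]
  · simp [base, Prim.exec, St.set, St.get, Tree.word]
  · lia

/-- A list of trees as a tree. -/
def Tree.ofList : List Tree → Tree
  | [] => .nil
  | t :: l => .cons t (Tree.ofList l)

/-- Fold a program over a list of trees; the program gets the pair of an item and the state. -/
def foldCmd (c : Cmd) : Cmd :=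
  pop .val ;; pop .val ;;
    -- Loop invariant: the register holds the popped root of the remaining list, `true` for a cons
    -- cell, and the state lies below the list.
    .loop regBit (clear ;; scan false false true ;; swap ;; back .tmp₃ ;; push .val true ;; c ;;
      swap ;; pop .val) ;; clear

/-- The bounds `T` and `B` are required only along the splittings of `l`, that is, for the states
that the fold actually reaches. -/
theorem runs_foldCmd_loop {β σ : Type} (code : β → Tree) (code' : σ → Tree) (c : Cmd)
    (step : σ → β → σ) (T B : ℕ) (rest : List Bool) :
    ∀ (l : List β) (s : σ),
      (∀ l₁ h l₂, l = l₁ ++ h :: l₂ →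
        Computes c (.cons (code h) (code' (l₁.foldl step s)))
          (code' (step (l₁.foldl step s) h)) T) →
      (∀ l₁ l₂, l = l₁ ++ l₂ → (code' (l₁.foldl step s)).size ≤ B) →
      Runs (.loop regBit (clear ;; scan false false true ;; swap ;; back .tmp₃ ;; push .val true ;;
          c ;; swap ;; pop .val))
        ⟨some (.bit (Tree.ofList (l.map code)).word.head!), [], (Tree.ofList
            (l.map code)).word.tail ++ ((code' s).word ++ rest),
          [], [], [], []⟩
        ⟨some (.bit false), [], (code' (l.foldl step s)).word ++ rest, [], [], [], []⟩
        (l.length * (T + 24 * (Tree.ofList (l.map code)).size + 24 * B + 40) + 1) := by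
  intro l
  induction l with
  | nil =>
    intro s _ _
    refine (Runs.loopDone rfl).mono ?_
    simp
  | cons h l ih =>
    intro s hc hB
    have ih' := ih (step s h) (fun l₁ h' l₂ e => hc (h :: l₁) h' l₂ (by rw [e]; rfl))
      (fun l₁ l₂ e => hB (h :: l₁) l₂ (by rw [e]; rfl))
    have hs : (code' s).size ≤ B := hB [] (h :: l) rfl
    have hs' : (code' (step s h)).size ≤ B := hB [h] l rfl
    have hc' : Computes c (.cons (code h) (code' s)) (code' (step s h)) T := hc [] h l rfl
    have e₁ : (Prim.exec .clear ⟨some (.bit (Tree.ofList ((h :: l).map code)).word.head!), [],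
        (Tree.ofList ((h :: l).map code)).word.tail ++ ((code' s).word ++ rest), [], [], [], []⟩)
        = base ((code h).word ++ ((Tree.ofList (l.map code)).word ++ ((code' s).word ++ rest))) []
            [] [] := by
      simp [Prim.exec, Tree.ofList, Tree.word, base]
    have hw : (Tree.ofList (l.map code)).word = (Tree.ofList (l.map code)).word.head! ::
        (Tree.ofList (l.map code)).word.tail := by
      cases l <;> simp [Tree.ofList, Tree.word]
    have h₂ : Runs (push .val true) (base ((code h).word ++ ((code' s).word ++ ((Tree.ofList
        (l.map code)).word ++ rest)))
        [] [] []) (base ((Tree.cons (code h) (code' s)).word ++ ((Tree.ofList (l.map code)).word ++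
            rest)) [] [] []) 1 :=
      Runs.prim (by simp [base, Prim.exec, St.set, St.get, Tree.word])
    have h₃ : Runs (back .tmp₃) (base ((code' s).word ++ ((Tree.ofList (l.map code)).word ++ rest))
        [] []
        (prependIf true (code h).word [])) (base ((code h).word ++ ((code' s).word ++ ((Tree.ofList
            (l.map code)).word ++ rest)))
        [] [] []) (3 * (code h).size + 2) :=
      (runs_back₃ _ _ _ _).of_eq rfl (by simp [prependIf]) (by simp [prependIf, Tree.size])
    have h₄ : Runs (pop .val) (base ((Tree.ofList (l.map code)).word ++ ((code' (step s h)).word ++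
        rest)) [] [] [])
        ⟨some (.bit (Tree.ofList (l.map code)).word.head!), [],
          (Tree.ofList (l.map code)).word.tail ++ ((code' (step s h)).word ++ rest), [], [], [],
              []⟩ 1 := by
      refine Runs.prim ?_
      simp only [Prim.exec, base, St.set, St.get]
      rw [hw]
      simp
    refine (Runs.loopStep (by simp [Tree.ofList, Tree.word, regBit])
      ((Runs.prim e₁).seq ((runs_scan_base false false true (code h) _ _ _ _).seq
        ((runs_swap _ _ _ _).seq (h₃.seq (h₂.seq ((hc' ((Tree.ofList (l.map code)).word ++
            rest)).seq
          ((runs_swap _ _ _ _).seq h₄))))))) ih').mono ?_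
    simp only [List.map_cons, Tree.ofList, Tree.size_cons, List.length_cons]
    have := (Tree.ofList (l.map code)).size_pos
    nlinarith [Nat.zero_le (l.length * (code h).size), Nat.zero_le l.length]

theorem computes_foldCmd {β σ : Type} (code : β → Tree) (code' : σ → Tree) (c : Cmd)
    (step : σ → β → σ) (T B : ℕ) (l : List β) (s : σ)
    (hc : ∀ l₁ h l₂, l = l₁ ++ h :: l₂ →
      Computes c (.cons (code h) (code' (l₁.foldl step s)))
        (code' (step (l₁.foldl step s) h)) T)
    (hB : ∀ l₁ l₂, l = l₁ ++ l₂ → (code' (l₁.foldl step s)).size ≤ B) :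
    Computes (foldCmd c) (.cons (Tree.ofList (l.map code)) (code' s)) (code' (l.foldl step s))
      (l.length * (T + 24 * (Tree.ofList (l.map code)).size + 24 * B + 40) + 5) := by
  intro rest
  have hw : (Tree.ofList (l.map code)).word = (Tree.ofList (l.map code)).word.head! :: (Tree.ofList
      (l.map code)).word.tail := by
    cases l <;> simp [Tree.ofList, Tree.word]
  refine (Runs.seq (Runs.prim rfl) (Runs.seq (Runs.prim ?_) (Runs.seq
    (runs_foldCmd_loop code code' c step T B rest l s hc hB) (Runs.prim rfl)))).mono
      (m := 1 + (1 + ((l.length * (T + 24 * (Tree.ofList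
          (l.map code)).size + 24 * B + 40) + 1) + 1))) ?_
  · simp only [Prim.exec, base, St.set, St.get, Tree.word]
    rw [hw]
    simp
  · lia

/-! ### Comparison of trees -/

/-- The tree that represents a truth value. -/
def Tree.ofBool : Bool → Tree
  | false => .nil
  | true => .cons .nil .nil

/-- Empty a stack. -/
def discard (k : Stk) : Cmd := pop k ;; .loop Option.isSome (pop k)

theorem runs_discard (k : Stk) : ∀ s : St,
    Runs (discard k) s { s.set k [] with reg := none } (2 * (s.get k).length + 2) := by
  have key : ∀ (l : List Bool) (s : St), s.get k = l →
      Runs (.loop Option.isSome (pop k)) { s.set k l.tail with reg := l.head?.map .bit }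
        { s.set k [] with reg := none } (2 * l.length + 1) := by
    intro l
    induction l with
    | nil => intro s _; exact (Runs.loopDone rfl).mono (by simp)
    | cons b l ih =>
      intro s hs
      refine (Runs.loopStep (t := Option.isSome) (c := pop k) (m := 1)
        (s := { s.set k (b :: l).tail with reg := some (.bit b) }) rfl
        (Runs.prim ?_) (ih (s.set k l) ?_)).of_eq rfl ?_ ?_
      · cases k <;> simp [St.set, St.get, Prim.exec]
      · cases k <;> simp [St.set, St.get]
      · cases k <;> simp [St.set]
      · simp; lia
  intro s
  exact (Runs.seq (Runs.prim rfl) (key (s.get k) s rfl)).mono (by lia)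

/-- Compare the popped symbol with the next symbol of the second word, and record a mismatch. -/
def compareBody : Cmd :=
  .ite regBit
      (pop .tmp₂ ;; .ite (fun r => decide (r = some (.bit true))) skip (push .tmp₃ true))
      (pop .tmp₂ ;; .ite (fun r => decide (r = some (.bit false))) skip (push .tmp₃ true)) ;;
    pop .tmp₁

/-- Compare two reversed words, and record each mismatch. -/
def compareLoop : Cmd := .loop Option.isSome compareBody

open Classical in
theorem runs_compareBody (b : Bool) (v x₁ x₂ x₃ : List Bool) :
    Runs compareBody ⟨some (.bit b), [], v, x₁, x₂, x₃, []⟩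
      ⟨x₁.head?.map .bit, [], v, x₁.tail, x₂.tail,
        if x₂.head? = some b then x₃ else true :: x₃, []⟩ 5 := by
  refine Runs.seq (m := 4) (n := 1) (s' := ⟨x₂.head?.map .bit, [], v, x₁, x₂.tail,
        if x₂.head? = some b then x₃ else true :: x₃, []⟩) ?_ (Runs.prim rfl)
  have h : Runs (pop .tmp₂ ;; .ite (fun r => decide (r = some (.bit b))) skip (push .tmp₃ true))
      ⟨some (.bit b), [], v, x₁, x₂, x₃, []⟩ ⟨x₂.head?.map .bit, [], v, x₁, x₂.tail,
        if x₂.head? = some b then x₃ else true :: x₃, []⟩ 3 := by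
    refine Runs.seq (m := 1) (n := 2) (s' := ⟨x₂.head?.map .bit, [], v, x₁, x₂.tail, x₃, []⟩)
      (Runs.prim rfl) ?_
    by_cases hb : x₂.head? = some b
    · rw [if_pos hb]
      exact Runs.iteTrue (by simp [hb]) (Runs.prim rfl)
    · rw [if_neg hb]
      refine Runs.iteFalse ?_ (Runs.prim rfl)
      rcases x₂ with _ | ⟨_ | _, _⟩ <;> simp_all
  cases b
  · exact Runs.iteFalse rfl h
  · exact Runs.iteTrue rfl h

/-- The loop is driven by the first word and never stops early: mismatches pile up in `z`. An empty
`z` therefore certifies only a prefix, and what is left of the second word has to be examined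
afterwards. -/
theorem runs_compareLoop (v : List Bool) : ∀ (x₁ x₂ x₃ : List Bool), ∃ z,
    (z = [] ↔ x₃ = [] ∧ x₁ <+: x₂) ∧ z.length ≤ x₃.length + x₁.length ∧
    Runs compareLoop ⟨x₁.head?.map .bit, [], v, x₁.tail, x₂, x₃, []⟩
      ⟨none, [], v, [], x₂.drop x₁.length, z, []⟩ (6 * x₁.length + 1)
  | [], x₂, x₃ => ⟨x₃, by simp, by simp, Runs.loopDone rfl⟩
  | b :: x₁, x₂, x₃ => by
    by_cases hb : x₂.head? = some b
    · obtain ⟨z, hz, hzl, hr⟩ := runs_compareLoop v x₁ x₂.tail x₃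
      obtain ⟨x₂, rfl⟩ : ∃ y, x₂ = b :: y := by
        cases x₂ with
        | nil => simp at hb
        | cons c y => simp at hb; exact ⟨y, by rw [hb]⟩
      refine ⟨z, by simpa using hz, by simp; lia, ?_⟩
      have h := runs_compareBody b v x₁ (b :: x₂) x₃
      rw [if_pos hb] at h
      exact (Runs.loopStep rfl h hr).mono (by simp; lia)
    · obtain ⟨z, hz, hzl, hr⟩ := runs_compareLoop v x₁ x₂.tail (true :: x₃)
      refine ⟨z, ?_, by simp at hzl ⊢; lia, ?_⟩
      · have : ¬ (b :: x₁) <+: x₂ := by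
          rintro ⟨y, rfl⟩
          simp at hb
        simp only [hz, this]
        simp
      · have e : x₂.drop (b :: x₁).length = x₂.tail.drop x₁.length := by simp
        rw [e]
        have h := runs_compareBody b v x₁ x₂ x₃
        rw [if_neg hb] at h
        exact (Runs.loopStep rfl h hr).mono (by simp; lia)

/-- Replace a pair of trees by the truth value of their equality. -/
def compare : Cmd :=
  popVal ;; scan true false false ;; scan false true false ;; pop .tmp₁ ;; compareLoop ;;
    -- A nonempty rest of the second word counts as a mismatch too.
    pop .tmp₂ ;; .ite Option.isSome (push .tmp₃ true) skip ;; discard .tmp₂ ;; pop .tmp₃ ;;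
    .ite Option.isSome (discard .tmp₃ ;; pushWord (Tree.ofBool false).word)
      (pushWord (Tree.ofBool true).word)

open Classical in
theorem computes_compare (a b : Tree) :
    Computes compare (.cons a b) (Tree.ofBool (decide (a = b))) (20 * (Tree.cons a b).size + 40) :=
        by
  intro rest
  obtain ⟨z, hz, hzl, hr⟩ := runs_compareLoop rest a.word.reverse b.word.reverse []
  set y := b.word.reverse.drop a.word.reverse.length with hy
  have hyl : y.length ≤ b.size := by simp [hy, Tree.size]
  obtain ⟨z', hz', hzl', hr'⟩ : ∃ z', (z' = [] ↔ a = b) ∧ z'.length ≤ z.length + 1 ∧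
      Runs (.ite Option.isSome (push .tmp₃ true) skip) ⟨y.head?.map .bit, [], rest, [], y.tail, z,
          []⟩
        ⟨y.head?.map .bit, [], rest, [], y.tail, z', []⟩ 2 := by
    by_cases hy0 : y = []
    · refine ⟨z, ?_, by simp, ?_⟩
      · rw [hz]
        simp only [true_and]
        constructor
        · intro hp
          have hl : b.word.reverse.length ≤ a.word.reverse.length := by
            rw [hy, List.drop_eq_nil_iff] at hy0
            exact hy0
          have := hp.eq_of_length_le hl
          exact Tree.word_injective (List.reverse_injective this)
        · rintro rfl
          exact List.prefix_rfl
      · rw [hy0]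
        exact Runs.iteFalse rfl (Runs.prim rfl)
    · refine ⟨true :: z, ?_, by simp, ?_⟩
      · simp only [reduceCtorEq, false_iff]
        rintro rfl
        simp [hy] at hy0
      · obtain ⟨c, y', hy'⟩ := List.exists_cons_of_ne_nil hy0
        rw [hy']
        exact Runs.iteTrue rfl (Runs.prim rfl)
  have h₂ : Runs (pop .tmp₁) (base rest (prependIf false b.word (prependIf true a.word []))
      (prependIf true b.word (prependIf false a.word []))
      (prependIf false b.word (prependIf false a.word [])))
      ⟨a.word.reverse.head?.map .bit, [], rest, a.word.reverse.tail, b.word.reverse, [], []⟩ 1 :=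
    Runs.prim (by simp [base, Prim.exec, St.set, St.get, prependIf])
  have h₃ : Runs (pop .tmp₂) ⟨none, [], rest, [], y, z, []⟩
      ⟨y.head?.map .bit, [], rest, [], y.tail, z, []⟩ 1 := Runs.prim rfl
  have h₄ : Runs (discard .tmp₂) ⟨y.head?.map .bit, [], rest, [], y.tail, z', []⟩
      ⟨none, [], rest, [], [], z', []⟩ (2 * y.tail.length + 2) := runs_discard .tmp₂ _
  have h₅ : Runs (pop .tmp₃) ⟨none, [], rest, [], [], z', []⟩
      ⟨z'.head?.map .bit, [], rest, [], [], z'.tail, []⟩ 1 := Runs.prim rfl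
  have h₆ : Runs (.ite Option.isSome (discard .tmp₃ ;; pushWord (Tree.ofBool false).word)
      (pushWord (Tree.ofBool true).word)) ⟨z'.head?.map .bit, [], rest, [], [], z'.tail, []⟩
      (base ((Tree.ofBool (decide (a = b))).word ++ rest) [] [] []) (2 * z'.length + 10) := by
    by_cases hab : a = b
    · have : z' = [] := hz'.2 hab
      subst this
      simp only [hab, decide_true]
      exact (Runs.iteFalse rfl (runs_pushWord _ rest)).mono (by simp [Tree.ofBool, Tree.word])
    · have : z' ≠ [] := fun h => hab (hz'.1 h)
      obtain ⟨c, z'', rfl⟩ := List.exists_cons_of_ne_nil this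
      simp only [hab, decide_false]
      have h : Runs (discard .tmp₃) ⟨some (.bit c), [], rest, [], [], z'', []⟩
        (base rest [] [] []) (2 * z''.length + 2) := runs_discard .tmp₃ _
      refine (Runs.iteTrue rfl (h.seq (runs_pushWord _ rest))).mono ?_
      simp [Tree.ofBool, Tree.word]
      lia
  have hs : a.word.reverse.length = a.size := by simp [Tree.size]
  have ht : y.tail.length ≤ y.length := by simp
  rw [hs] at hr hzl
  refine ((runs_popVal true (a.word ++ (b.word ++ rest))).seq
    ((runs_scan_base true false false a (b.word ++ rest) [] [] []).seq
    ((runs_scan_base false true false b rest _ _ _).seq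
    (h₂.seq (hr.seq (h₃.seq (hr'.seq (h₄.seq (h₅.seq h₆))))))))).of_eq ?_ rfl ?_
  · simp [Tree.word]
  · simp only [List.length_nil, Tree.size_cons] at hzl ⊢
    lia

end StackProg

/-! ### Coded data types and polynomial-time functions. -/

namespace StackProg

open PVPDA (Letter)

/-! ### Data types coded by trees -/

/-- A data type whose elements are coded by trees. -/
class Coded (α : Type) where
  code : α → Tree
  code_injective : Function.Injective code

open Coded (code)

/-- The size of the code of a datum. -/
def size {α : Type} [Coded α] (a : α) : ℕ := (code a).size

theorem Tree.ofList_injective : Function.Injective Tree.ofList := by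
  intro l
  induction l with
  | nil => intro l' h; cases l' <;> simp_all [Tree.ofList]
  | cons t l ih =>
    intro l' h
    cases l' with
    | nil => simp [Tree.ofList] at h
    | cons t' l' =>
      simp only [Tree.ofList, Tree.cons.injEq] at h
      rw [h.1, ih h.2]

instance : Coded Unit := ⟨fun _ => .nil, fun _ _ _ => rfl⟩

instance : Coded Bool := ⟨Tree.ofBool, by intro a b; cases a <;> cases b <;> simp [Tree.ofBool]⟩

/-- Numbers are coded in unary. An exponentially large number thus serves as padding, and polynomial
time in its code is exponential time in the original input. -/
instance : Coded ℕ := ⟨fun n => Tree.ofList (List.replicate n .nil), by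
  intro m n h
  simpa using congrArg List.length (Tree.ofList_injective h)⟩

instance {α β : Type} [Coded α] [Coded β] : Coded (α × β) := ⟨fun x => .cons (code x.1)
    (code x.2), by
  rintro ⟨a, b⟩ ⟨c, d⟩ h
  simp only [Tree.cons.injEq] at h
  rw [Coded.code_injective h.1, Coded.code_injective h.2]⟩

instance {α : Type} [Coded α] : Coded (List α) := ⟨fun l => Tree.ofList (l.map code), by
  intro l l' h
  exact List.map_injective_iff.2 Coded.code_injective (Tree.ofList_injective h)⟩

/-- The tree of a letter. -/
def letterCode : Letter → Tree
  | .bit false => .nil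
  | .bit true => .cons .nil .nil
  | .mark => .cons .nil (.cons .nil .nil)
  | .close => .cons (.cons .nil .nil) .nil

instance : Coded Letter := ⟨letterCode, by
  intro a b
  rcases a with (_ | _) | _ | _ <;> rcases b with (_ | _) | _ | _ <;> simp [letterCode]⟩

section Size

variable {α β : Type} [Coded α] [Coded β]

@[simp] theorem size_unit (a : Unit) : size a = 1 := rfl

theorem size_bool_le (b : Bool) : size b ≤ 3 := by
  cases b <;> simp [size, code, Tree.ofBool]

@[simp] theorem size_pair (a : α) (b : β) : size (a, b) = size a + size b + 1 := by
  simp [size, code]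

theorem size_prod (x : α × β) : size x = size x.1 + size x.2 + 1 := size_pair _ _

@[simp] theorem size_nil : size ([] : List α) = 1 := rfl

@[simp] theorem size_cons (a : α) (l : List α) : size (a :: l) = size a + size l + 1 := by
  simp [size, code, Tree.ofList]

@[simp] theorem size_nat (n : ℕ) : size n = 2 * n + 1 := by
  induction n with
  | zero => rfl
  | succ n ih =>
    simp only [size, code, List.replicate_succ, Tree.ofList, Tree.size_cons, Tree.size_nil] at ih ⊢
    lia

theorem length_le_size (l : List α) : l.length ≤ size l := by
  induction l with
  | nil => simp
  | cons a l ih => simp; lia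

theorem size_le_of_mem {a : α} {l : List α} (h : a ∈ l) : size a ≤ size l := by
  induction l with
  | nil => simp at h
  | cons b l ih =>
    rcases List.mem_cons.1 h with rfl | h
    · simp; lia
    · have := ih h; simp; lia

theorem size_append (l l' : List α) : size (l ++ l') + 1 = size l + size l' := by
  induction l with
  | nil => simp; lia
  | cons a l ih => simp; lia

theorem size_le_of_sublist {l l' : List α} (h : l.Sublist l') : size l ≤ size l' := by
  induction h with
  | slnil => rfl
  | cons a _ ih => simp; lia
  | cons_cons a _ ih => simp; lia

theorem size_list_le (l : List α) (c : ℕ) (h : ∀ a ∈ l, size a ≤ c) :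
    size l ≤ l.length * (c + 1) + 1 := by
  induction l with
  | nil => simp
  | cons a l ih =>
    have h₁ := h a (by simp)
    have h₂ := ih fun b hb => h b (by simp [hb])
    simp only [size_cons, List.length_cons]
    lia

end Size

/-! ### Polynomially bounded functions -/

/-- A function bounded by a polynomial in the size of the argument. -/
def PolyBdd {α : Type} [Coded α] (g : α → ℕ) : Prop := ∃ k, ∀ a, g a ≤ (size a + 2) ^ k

section PolyBdd

variable {α β : Type} [Coded α] [Coded β]

theorem PolyBdd.mono {f g : α → ℕ} (h : PolyBdd g) (hfg : ∀ a, f a ≤ g a) : PolyBdd f :=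
  let ⟨k, hk⟩ := h
  ⟨k, fun a => (hfg a).trans (hk a)⟩

/-- The base `size a + 2` is at least two, so `c < 2 ^ c` allows `c` itself as exponent. -/
theorem PolyBdd.const (c : ℕ) : PolyBdd fun _ : α => c :=
  ⟨c, fun a => (Nat.lt_two_pow_self (n := c)).le.trans (Nat.pow_le_pow_left (by lia) c)⟩

theorem PolyBdd.size : PolyBdd fun a : α => size a := ⟨1, fun a => by simp⟩

theorem PolyBdd.mul {f g : α → ℕ} (hf : PolyBdd f) (hg : PolyBdd g) :
    PolyBdd fun a => f a * g a :=
  let ⟨k, hk⟩ := hf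
  let ⟨l, hl⟩ := hg
  ⟨k + l, fun a => by rw [pow_add]; exact Nat.mul_le_mul (hk a) (hl a)⟩

theorem PolyBdd.add {f g : α → ℕ} (hf : PolyBdd f) (hg : PolyBdd g) :
    PolyBdd fun a => f a + g a := by
  obtain ⟨k, hk⟩ := hf
  obtain ⟨l, hl⟩ := hg
  refine ⟨max k l + 1, fun a => ?_⟩
  have h₁ := (hk a).trans (Nat.pow_le_pow_right (n := StackProg.size a + 2) (by lia)
      (le_max_left k l))
  have h₂ := (hl a).trans (Nat.pow_le_pow_right (n := StackProg.size a + 2) (by lia)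
      (le_max_right k l))
  rw [pow_succ]
  nlinarith [Nat.zero_le (StackProg.size a * (StackProg.size a + 2) ^ max k l)]

theorem PolyBdd.pow {f : α → ℕ} (hf : PolyBdd f) (k : ℕ) : PolyBdd fun a => f a ^ k := by
  obtain ⟨l, hl⟩ := hf
  exact ⟨l * k, fun a => by rw [pow_mul]; exact Nat.pow_le_pow_left (hl a) k⟩

theorem PolyBdd.comp {g : β → ℕ} {f : α → β} (hg : PolyBdd g)
    (hf : PolyBdd fun a => StackProg.size (f a)) : PolyBdd fun a => g (f a) := by
  obtain ⟨k, hk⟩ := hg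
  exact ((hf.add (PolyBdd.const 2)).pow k).mono fun a => hk (f a)

end PolyBdd

/-! ### Functions computable in polynomial time -/

/-- A function computed by a stack program in polynomial time. -/
@[fun_prop]
def PolyTime {α β : Type} [Coded α] [Coded β] (f : α → β) : Prop :=
  ∃ c, ∃ g : α → ℕ, PolyBdd g ∧ ∀ a, Computes c (code a) (code (f a)) (g a)

namespace PolyTime

variable {α β γ σ : Type} [Coded α] [Coded β] [Coded γ] [Coded σ]

/-- The result has to be written within the running time; so composition needs no separate
hypothesis on sizes. -/
theorem size_bdd {f : α → β} (hf : PolyTime f) : PolyBdd fun a => size (f a) :=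
  let ⟨_, _, hg, hc⟩ := hf
  (PolyBdd.size.add hg).mono fun a => (hc a).size_le

theorem of_code_eq (f : α → β) (h : ∀ a, code (f a) = code a) : PolyTime f :=
  ⟨skip, _, PolyBdd.const 1, fun a => h a ▸ computes_skip _⟩

@[fun_prop]
theorem id : PolyTime fun a : α => a := of_code_eq _ fun _ => rfl

@[fun_prop]
theorem const (b : β) : PolyTime fun _ : α => b :=
  ⟨constant (code b), _, ((PolyBdd.const 9).mul PolyBdd.size).add
    (PolyBdd.const (size b)) |>.add (PolyBdd.const 4), fun a => computes_constant (code a) (code b)⟩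

@[fun_prop]
theorem comp {g : β → γ} {f : α → β} (hg : PolyTime g) (hf : PolyTime f) :
    PolyTime fun a => g (f a) := by
  have hs := hf.size_bdd
  obtain ⟨c, t, ht, hc⟩ := hf
  obtain ⟨d, u, hu, hd⟩ := hg
  exact ⟨c ;; d, _, ht.add (hu.comp hs), fun a => (hc a).seq (hd (f a))⟩

@[fun_prop]
theorem prodMk {f : α → β} {g : α → γ} (hf : PolyTime f) (hg : PolyTime g) :
    PolyTime fun a => (f a, g a) := by
  have hs := hg.size_bdd
  obtain ⟨c, t, ht, hc⟩ := hf
  obtain ⟨d, u, hu, hd⟩ := hg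
  exact ⟨pairUp c d, _, (ht.add hu).add ((((PolyBdd.const 27).mul PolyBdd.size).add
    ((PolyBdd.const 12).mul hs)).add (PolyBdd.const 18)), fun a => (hc a).pairUp (hd a)⟩

theorem fst' : PolyTime (Prod.fst : α × β → α) :=
  ⟨takeFst, _, (PolyBdd.const 12).mul PolyBdd.size, fun a => computes_takeFst (code a.1) (code a.2)⟩

theorem snd' : PolyTime (Prod.snd : α × β → β) :=
  ⟨takeSnd, _, (PolyBdd.const 12).mul PolyBdd.size, fun a => computes_takeSnd (code a.1) (code a.2)⟩

@[fun_prop]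
theorem fst {f : α → β × γ} (hf : PolyTime f) : PolyTime fun a => (f a).1 := fst'.comp hf

@[fun_prop]
theorem snd {f : α → β × γ} (hf : PolyTime f) : PolyTime fun a => (f a).2 := snd'.comp hf

@[fun_prop]
theorem cond {b : α → Bool} {f g : α → β} (hb : PolyTime b) (hf : PolyTime f) (hg : PolyTime g) :
    PolyTime fun a => cond (b a) (f a) (g a) := by
  suffices h : PolyTime fun x : Bool × α => _root_.cond x.1 (f x.2) (g x.2) from
    h.comp (hb.prodMk PolyTime.id)
  obtain ⟨c, t, ht, hc⟩ := hf
  obtain ⟨d, u, hu, hd⟩ := hg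
  have hs : PolyBdd fun x : Bool × α => size x.2 := snd'.size_bdd
  refine ⟨branch d (takeSnd ;; c), _, (((ht.comp hs).add (hu.comp hs)).add
    ((PolyBdd.const 12).mul PolyBdd.size)).add (PolyBdd.const 10), ?_⟩
  rintro ⟨_ | _, a⟩
  · exact (hd a).branch_nil.mono (by lia)
  · exact ((computes_takeSnd (Tree.ofBool true) (code a)).seq (hc a)).branch_cons.mono
      (by simp [size, code]; lia)

theorem isEmpty' : PolyTime (List.isEmpty : List α → Bool) := by
  refine ⟨pairUp skip skip ;; branch (constant (code true)) (constant (code false)), fun l =>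
    (100 * size l + 100), ((PolyBdd.const 100).mul PolyBdd.size).add (PolyBdd.const 100), ?_⟩
  intro l
  have h := (computes_skip (code l)).pairUp (computes_skip (code l))
  cases l with
  | nil =>
    refine (h.seq (Computes.branch_nil (computes_constant _ _))).mono ?_
    simp [size, code, Tree.ofBool, Tree.ofList]
  | cons a l =>
    refine (h.seq (Computes.branch_cons (computes_constant _ _))).mono ?_
    simp [size, code, Tree.ofBool, Tree.ofList]
    lia

@[fun_prop]
theorem isEmpty {l : α → List β} (hl : PolyTime l) : PolyTime fun a => (l a).isEmpty :=
  isEmpty'.comp hl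

theorem tail' : PolyTime (List.tail : List α → List α) := by
  refine ⟨pairUp skip skip ;; branch skip (takeFst ;; takeSnd), fun l =>
    (100 * size l + 100), ((PolyBdd.const 100).mul PolyBdd.size).add (PolyBdd.const 100), ?_⟩
  intro l
  have h := (computes_skip (code l)).pairUp (computes_skip (code l))
  cases l with
  | nil =>
    refine (h.seq (Computes.branch_nil (computes_skip _))).mono ?_
    simp [size, code, Tree.ofList]
  | cons a l =>
    refine (h.seq (Computes.branch_cons ((computes_takeFst _ _).seq
      (computes_takeSnd _ _)))).mono ?_
    simp [size, code, Tree.ofList]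
    lia

@[fun_prop]
theorem tail {l : α → List β} (hl : PolyTime l) : PolyTime fun a => (l a).tail := tail'.comp hl

theorem headD' : PolyTime (fun x : List α × α => x.1.headD x.2) := by
  refine ⟨branch skip (takeFst ;; takeFst), fun l =>
    (100 * size l + 100), ((PolyBdd.const 100).mul PolyBdd.size).add (PolyBdd.const 100), ?_⟩
  rintro ⟨l, d⟩
  cases l with
  | nil =>
    refine (Computes.branch_nil (computes_skip _)).mono ?_
    simp
  | cons a l =>
    refine (Computes.branch_cons ((computes_takeFst _ _).seq
      (computes_takeFst _ _))).mono ?_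
    simp [size, code, Tree.ofList]
    lia

@[fun_prop]
theorem headD {l : α → List β} {d : α → β} (hl : PolyTime l) (hd : PolyTime d) :
    PolyTime fun a => (l a).headD (d a) := headD'.comp (hl.prodMk hd)

@[fun_prop]
theorem cons {l : α → List β} {b : α → β} (hb : PolyTime b) (hl : PolyTime l) :
    PolyTime fun a => b a :: l a :=
  (of_code_eq (fun x : β × List β => x.1 :: x.2) fun _ => rfl).comp (hb.prodMk hl)

theorem eq' [DecidableEq α] : PolyTime (fun x : α × α => decide (x.1 = x.2)) := by
  refine ⟨compare, _, ((PolyBdd.const 20).mul PolyBdd.size).add (PolyBdd.const 40), fun x => ?_⟩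
  have h := computes_compare (code x.1) (code x.2)
  simp only [Coded.code_injective.eq_iff] at h
  change Computes compare (.cons (code x.1) (code x.2)) (Tree.ofBool _)
    (20 * (Tree.cons (code x.1) (code x.2)).size + 40)
  convert h

@[fun_prop]
theorem eq [DecidableEq β] {f g : α → β} (hf : PolyTime f) (hg : PolyTime g) :
    PolyTime fun a => decide (f a = g a) := eq'.comp (hf.prodMk hg)

@[fun_prop]
theorem not {b : α → Bool} (hb : PolyTime b) : PolyTime fun a => !(b a) := by
  have : (fun a => !(b a)) = fun a => _root_.cond (b a) false true := by
    funext a; cases b a <;> rfl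
  rw [this]
  fun_prop

@[fun_prop]
theorem and {b c : α → Bool} (hb : PolyTime b) (hc : PolyTime c) :
    PolyTime fun a => b a && c a := by
  have : (fun a => b a && c a) = fun a => _root_.cond (b a) (c a) false := by
    funext a; cases b a <;> rfl
  rw [this]
  fun_prop

@[fun_prop]
theorem or {b c : α → Bool} (hb : PolyTime b) (hc : PolyTime c) :
    PolyTime fun a => b a || c a := by
  have : (fun a => b a || c a) = fun a => _root_.cond (b a) true (c a) := by
    funext a; cases b a <;> rfl
  rw [this]
  fun_prop

/-! ### Iteration over lists -/

/-- Iterating a polynomial-time step can produce states of exponential size. The hypothesis `hB` on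
all intermediate states excludes this, and then every round has the same polynomial cost. -/
theorem foldl {l : α → List β} {s : α → σ} {f : α → σ → β → σ} (hl : PolyTime l) (hs : PolyTime s)
    (hf : PolyTime fun x : α × σ × β => f x.1 x.2.1 x.2.2)
    (hB : ∃ g : α → ℕ, PolyBdd g ∧ ∀ a, ∀ l₁ l₂, l a = l₁ ++ l₂ → size (l₁.foldl (f a) (s a)) ≤
        g a) :
    PolyTime fun a => (l a).foldl (f a) (s a) := by
  obtain ⟨g, hg, hB⟩ := hB
  -- The parameter `a` is carried inside the state, since the body of `foldCmd` sees only an item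
  -- and the state.
  have hbody : PolyTime fun x : β × α × σ => (x.2.1, f x.2.1 x.2.2 x.1) :=
    (fst'.comp snd').prodMk (hf.comp ((fst'.comp snd').prodMk ((snd'.comp snd').prodMk fst')))
  obtain ⟨c, t, ⟨k, hk⟩, hc⟩ := hbody
  have hpre : PolyTime fun a => (l a, a, s a) := hl.prodMk (PolyTime.id.prodMk hs)
  suffices h : ∃ (u : α → ℕ), PolyBdd u ∧ ∀ a, Computes (foldCmd c) (code (l a, a, s a))
      (code (a, (l a).foldl (f a) (s a))) (u a) by
    obtain ⟨u, hu, h⟩ := h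
    obtain ⟨d, v, hv, hd⟩ := hpre
    refine ⟨d ;; foldCmd c ;; takeSnd, _, hv.add (hu.add ((PolyBdd.const 12).mul
      ((PolyBdd.size.add hg).add (PolyBdd.const 1)))), fun a =>
      (hd a).seq ((h a).seq ((computes_takeSnd _ _).mono (Nat.mul_le_mul_left 12 ?_)))⟩
    have := hB a (l a) [] (by simp)
    simp only [Tree.size_cons]
    change size a + _ + 1 ≤ _
    change size _ ≤ _ at this
    simp only [size] at this ⊢
    lia
  have hls := hl.size_bdd
  have hstate : PolyBdd fun a => size a + g a + 1 := (PolyBdd.size.add hg).add (PolyBdd.const 1)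
  refine ⟨fun a => size (l a) * ((size (l a) + (size a + g a + 1) + 1 + 2) ^ k + 24 * size (l a)
    + 24 * (size a + g a + 1) + 40) + 5,
    (hls.mul (((((((hls.add hstate).add (PolyBdd.const 1)).add (PolyBdd.const 2)).pow k).add
      ((PolyBdd.const 24).mul hls)).add ((PolyBdd.const 24).mul hstate)).add
      (PolyBdd.const 40))).add (PolyBdd.const 5), fun a => ?_⟩
  have hfold : ∀ (l' : List β) (s' : σ), l'.foldl (fun (x : α × σ) b => (x.1, f x.1 x.2 b)) (a, s')
      = (a, l'.foldl (f a) s') := by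
    intro l'
    induction l' with
    | nil => intro s'; rfl
    | cons b l' ih => intro s'; exact ih _
  have h := computes_foldCmd (code : β → Tree) (code : α × σ → Tree) c
    (fun (x : α × σ) b => (x.1, f x.1 x.2 b))
    ((size (l a) + (size a + g a + 1) + 1 + 2) ^ k) (size a + g a + 1) (l a) (a, s a) ?_ ?_
  · rw [hfold] at h
    refine h.mono ?_
    have := length_le_size (l a)
    change _ * (_ + 24 * size (l a) + _ + _) + 5 ≤ _
    exact Nat.add_le_add_right (Nat.mul_le_mul_right _ this) _
  · intro l₁ b l₂ e
    rw [hfold]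
    have h₁ := hB a l₁ (b :: l₂) e
    have h₂ : size b ≤ size (l a) := size_le_of_mem (by rw [e]; simp)
    refine (hc (b, a, l₁.foldl (f a) (s a))).mono ((hk _).trans (Nat.pow_le_pow_left ?_ k))
    simp only [size_pair]
    lia
  · intro l₁ l₂ e
    rw [hfold]
    have h₁ := hB a l₁ l₂ e
    change size (a, _) ≤ _
    simp only [size_pair]
    lia

/-- If each step adds at most `g a` to the size, the intermediate sizes stay below `size (s a) + (l
a).length * g a`. -/
theorem foldl_of_add_le {l : α → List β} {s : α → σ} {f : α → σ → β → σ} (hl : PolyTime l)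
    (hs : PolyTime s) (hf : PolyTime fun x : α × σ × β => f x.1 x.2.1 x.2.2)
    (hB : ∃ g : α → ℕ, PolyBdd g ∧ ∀ a, ∀ s, ∀ b ∈ l a, size (f a s b) ≤ size s + g a) :
    PolyTime fun a => (l a).foldl (f a) (s a) := by
  refine foldl hl hs hf ?_
  obtain ⟨g, hg, hB⟩ := hB
  refine ⟨_, hs.size_bdd.add (hl.size_bdd.mul hg), ?_⟩
  intro a l₁ l₂ e
  have key : ∀ (l' : List β) (s : σ), (∀ b ∈ l', b ∈ l a) →
      size (l'.foldl (f a) s) ≤ size s + l'.length * g a := by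
    intro l'
    induction l' with
    | nil => intro s _; simp
    | cons b l' ih =>
      intro s h
      have h₁ := ih (f a s b) fun c hc => h c (by simp [hc])
      have h₂ := hB a s b (h b (by simp))
      simp only [List.foldl_cons, List.length_cons]
      lia
  refine (key l₁ (s a) fun b hb => by rw [e]; simp [hb]).trans ?_
  have : l₁.length ≤ size (l a) := le_trans (by rw [e]; simp) (length_le_size (l a))
  exact Nat.add_le_add_left (Nat.mul_le_mul_right _ this) _

theorem foldl_of_le {l : α → List β} {s : α → σ} {f : α → σ → β → σ} (hl : PolyTime l)
    (hs : PolyTime s) (hf : PolyTime fun x : α × σ × β => f x.1 x.2.1 x.2.2)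
    (hB : ∃ g : α → ℕ, PolyBdd g ∧ ∀ a, ∀ s, ∀ b ∈ l a, size (f a s b) ≤ g a) :
    PolyTime fun a => (l a).foldl (f a) (s a) := by
  obtain ⟨g, hg, hB⟩ := hB
  exact foldl_of_add_le hl hs hf ⟨g, hg, fun a s b hb => (hB a s b hb).trans (by lia)⟩

theorem size_bdd_mem {l : α → List β} {f : α → β → γ} (hl : PolyTime l)
    (hf : PolyTime fun x : α × β => f x.1 x.2) :
    ∃ g : α → ℕ, PolyBdd g ∧ ∀ a, ∀ b ∈ l a, size (f a b) ≤ g a := by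
  obtain ⟨k, hk⟩ := hf.size_bdd
  refine ⟨_, ((((PolyBdd.size (α := α)).add hl.size_bdd).add (PolyBdd.const 3)).pow k), ?_⟩
  intro a b hb
  refine (hk (a, b)).trans (Nat.pow_le_pow_left ?_ k)
  have := size_le_of_mem hb
  simp only [size_pair]
  lia

@[fun_prop]
theorem reverse {l : α → List β} (hl : PolyTime l) : PolyTime fun a => (l a).reverse := by
  have : (fun a => (l a).reverse) = fun a => (l a).foldl (fun s b => b :: s) [] := by
    funext a; simp
  rw [this]
  refine foldl_of_add_le hl (by fun_prop) (by fun_prop) ⟨_, hl.size_bdd.add (PolyBdd.const 1), ?_⟩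
  intro a s b hb
  have := size_le_of_mem hb
  simp only [size_cons]
  lia

theorem foldr_of_add_le {l : α → List β} {s : α → σ} {f : α → β → σ → σ} (hl : PolyTime l)
    (hs : PolyTime s) (hf : PolyTime fun x : α × β × σ => f x.1 x.2.1 x.2.2)
    (hB : ∃ g : α → ℕ, PolyBdd g ∧ ∀ a, ∀ s, ∀ b ∈ l a, size (f a b s) ≤ size s + g a) :
    PolyTime fun a => (l a).foldr (f a) (s a) := by
  have : (fun a => (l a).foldr (f a) (s a))
      = fun a => (l a).reverse.foldl (fun s b => f a b s) (s a) := by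
    funext a; rw [List.foldl_reverse]
  rw [this]
  obtain ⟨g, hg, hB⟩ := hB
  refine foldl_of_add_le hl.reverse hs ?_ ⟨g, hg, fun a s b hb => hB a s b (by simpa using hb)⟩
  exact hf.comp (f := fun x : α × σ × β => (x.1, x.2.2, x.2.1)) (by fun_prop)

@[fun_prop]
theorem append {l l' : α → List β} (hl : PolyTime l) (hl' : PolyTime l') :
    PolyTime fun a => l a ++ l' a := by
  have : (fun a => l a ++ l' a) = fun a => (l a).foldr (fun b s => b :: s) (l' a) := by
    funext a; simp
  rw [this]
  refine foldr_of_add_le hl hl' (by fun_prop) ⟨_, hl.size_bdd.add (PolyBdd.const 1), ?_⟩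
  intro a s b hb
  have := size_le_of_mem hb
  simp only [size_cons]
  lia

@[fun_prop]
theorem map {l : α → List β} {f : α → β → γ} (hl : PolyTime l)
    (hf : PolyTime fun x : α × β => f x.1 x.2) : PolyTime fun a => (l a).map (f a) := by
  have : (fun a => (l a).map (f a)) = fun a => (l a).foldr (fun b s => f a b :: s) [] := by
    funext a
    induction l a with
    | nil => rfl
    | cons b l ih => rw [List.map_cons, ih]; rfl
  rw [this]
  have hf' : PolyTime fun x : α × β × List γ => f x.1 x.2.1 :=
    hf.comp (f := fun x : α × β × List γ => (x.1, x.2.1)) (by fun_prop)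
  obtain ⟨g, hg, hB⟩ := size_bdd_mem hl hf
  refine foldr_of_add_le hl (by fun_prop) (by fun_prop) ⟨_, hg.add (PolyBdd.const 1), ?_⟩
  intro a s b hb
  have := hB a b hb
  simp only [size_cons]
  lia

@[fun_prop]
theorem filter {l : α → List β} {p : α → β → Bool} (hl : PolyTime l)
    (hp : PolyTime fun x : α × β => p x.1 x.2) : PolyTime fun a => (l a).filter (p a) := by
  have : (fun a => (l a).filter (p a))
      = fun a => (l a).foldr (fun b s => _root_.cond (p a b) (b :: s) s) [] := by
    funext a
    induction l a with
    | nil => rfl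
    | cons b l ih => cases h : p a b <;> simp [ih, h]
  rw [this]
  have hp' : PolyTime fun x : α × β × List β => p x.1 x.2.1 :=
    hp.comp (f := fun x : α × β × List β => (x.1, x.2.1)) (by fun_prop)
  refine foldr_of_add_le hl (by fun_prop) (by fun_prop)
    ⟨_, hl.size_bdd.add (PolyBdd.const 1), ?_⟩
  intro a s b hb
  have := size_le_of_mem hb
  cases p a b
  · simp
  · simp only [cond_true, size_cons]
    lia

@[fun_prop]
theorem all {l : α → List β} {p : α → β → Bool} (hl : PolyTime l)
    (hp : PolyTime fun x : α × β => p x.1 x.2) : PolyTime fun a => (l a).all (p a) := by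
  have : (fun a => (l a).all (p a)) = fun a => (l a).foldr (fun b s => p a b && s) true := by
    funext a
    induction l a with
    | nil => rfl
    | cons b l ih => simp [ih]
  rw [this]
  have hp' : PolyTime fun x : α × β × Bool => p x.1 x.2.1 :=
    hp.comp (f := fun x : α × β × Bool => (x.1, x.2.1)) (by fun_prop)
  exact foldr_of_add_le hl (by fun_prop) (by fun_prop)
    ⟨_, PolyBdd.const 3, fun a s b _ => (size_bool_le _).trans (by lia)⟩

@[fun_prop]
theorem any {l : α → List β} {p : α → β → Bool} (hl : PolyTime l)
    (hp : PolyTime fun x : α × β => p x.1 x.2) : PolyTime fun a => (l a).any (p a) := by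
  have : (fun a => (l a).any (p a)) = fun a => !((l a).all fun b => !(p a b)) := by
    funext a
    rw [List.not_all_eq_any_not]
    simp
  rw [this]
  fun_prop

@[fun_prop]
theorem flatMap {l : α → List β} {f : α → β → List γ} (hl : PolyTime l)
    (hf : PolyTime fun x : α × β => f x.1 x.2) : PolyTime fun a => (l a).flatMap (f a) := by
  have : (fun a => (l a).flatMap (f a)) = fun a => (l a).foldr (fun b s => f a b ++ s) [] := by
    funext a
    induction l a with
    | nil => rfl
    | cons b l ih => simp [ih]
  rw [this]
  have hf' : PolyTime fun x : α × β × List γ => f x.1 x.2.1 :=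
    hf.comp (f := fun x : α × β × List γ => (x.1, x.2.1)) (by fun_prop)
  obtain ⟨g, hg, hB⟩ := size_bdd_mem hl hf
  refine foldr_of_add_le hl (by fun_prop) (by fun_prop) ⟨g, hg, ?_⟩
  intro a s b hb
  have h₁ := hB a b hb
  have h₂ := size_append (f a b) s
  lia

/-! ### Numbers in unary -/

-- A number and a list of that many units have the same code, so only the items have to be erased.
@[fun_prop]
theorem length {l : α → List β} (hl : PolyTime l) : PolyTime fun a => (l a).length := by
  have h₁ : PolyTime fun a => (l a).map fun _ => () := by fun_prop
  have h₂ : PolyTime fun l : List Unit => l.length := by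
    refine of_code_eq _ fun l => ?_
    simp only [code]
    congr 1
    induction l with
    | nil => rfl
    | cons b l ih => simp only [List.length_cons, List.replicate_succ, ih, List.map_cons]
  simpa using h₂.comp h₁

@[fun_prop]
theorem units {n : α → ℕ} (hn : PolyTime n) : PolyTime fun a => List.replicate (n a) () := by
  have h : PolyTime fun n : ℕ => List.replicate n () := by
    refine of_code_eq _ fun n => ?_
    simp only [code, List.map_replicate]
  exact h.comp hn

theorem iterate {n : α → ℕ} {s : α → σ} {f : α → σ → σ} (hn : PolyTime n) (hs : PolyTime s)
    (hf : PolyTime fun x : α × σ => f x.1 x.2)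
    (hB : ∃ g : α → ℕ, PolyBdd g ∧ ∀ a, ∀ i ≤ n a, size ((f a)^[i] (s a)) ≤ g a) :
    PolyTime fun a => (f a)^[n a] (s a) := by
  have key : ∀ a (i : ℕ) (s : σ), (List.replicate i ()).foldl (fun s _ => f a s) s = (f a)^[i] s :=
      by
    intro a i
    induction i with
    | zero => intro s; rfl
    | succ i ih => intro s; simp [List.replicate_succ, ih]
  simp only [← key]
  refine foldl (f := fun a s _ => f a s) hn.units hs ?_ ?_
  · exact hf.comp (f := fun x : α × σ × Unit => (x.1, x.2.1)) (by fun_prop)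
  · obtain ⟨g, hg, hB⟩ := hB
    refine ⟨g, hg, fun a l₁ l₂ e => ?_⟩
    have hl : l₁ = List.replicate l₁.length () := by
      rw [List.eq_replicate_iff]; simp
    rw [hl, key]
    refine hB a _ ?_
    have := congrArg List.length e
    simp at this
    lia

@[fun_prop]
theorem add {m n : α → ℕ} (hm : PolyTime m) (hn : PolyTime n) : PolyTime fun a => m a + n a := by
  have : (fun a => m a + n a) = fun a => (List.replicate (m a) () ++ List.replicate (n a)
      ()).length := by
    simp
  rw [this]
  fun_prop

@[fun_prop]
theorem mul {m n : α → ℕ} (hm : PolyTime m) (hn : PolyTime n) : PolyTime fun a => m a * n a := by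
  have : (fun a => m a * n a) = fun a =>
      ((List.replicate (m a) ()).flatMap fun _ => List.replicate (n a) ()).length := by
    simp
  rw [this]
  fun_prop

@[fun_prop]
theorem drop {l : α → List β} {n : α → ℕ} (hl : PolyTime l) (hn : PolyTime n) :
    PolyTime fun a => (l a).drop (n a) := by
  have : (fun a => (l a).drop (n a)) = fun a => List.tail^[n a] (l a) := by
    funext a; rw [List.tail_iterate]
  rw [this]
  refine iterate hn hl (by fun_prop) ⟨_, hl.size_bdd, fun a i _ => ?_⟩
  rw [List.tail_iterate]
  exact size_le_of_sublist (List.drop_sublist _ _)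

@[fun_prop]
theorem sub {m n : α → ℕ} (hm : PolyTime m) (hn : PolyTime n) : PolyTime fun a => m a - n a := by
  have : (fun a => m a - n a) = fun a => ((List.replicate (m a) ()).drop (n a)).length := by
    simp
  rw [this]
  fun_prop

@[fun_prop]
theorem le {m n : α → ℕ} (hm : PolyTime m) (hn : PolyTime n) :
    PolyTime fun a => decide (m a ≤ n a) := by
  have : (fun a => decide (m a ≤ n a)) = fun a => decide (m a - n a = 0) := by
    simp [Nat.sub_eq_zero_iff_le]
  rw [this]
  fun_prop

@[fun_prop]
theorem lt {m n : α → ℕ} (hm : PolyTime m) (hn : PolyTime n) :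
    PolyTime fun a => decide (m a < n a) := by
  have : (fun a => decide (m a < n a)) = fun a => decide (m a + 1 ≤ n a) := rfl
  rw [this]
  fun_prop

@[fun_prop]
theorem min {m n : α → ℕ} (hm : PolyTime m) (hn : PolyTime n) :
    PolyTime fun a => min (m a) (n a) := by
  have : (fun a => Min.min (m a) (n a)) = fun a => m a - (m a - n a) := by
    funext a; lia
  rw [this]
  fun_prop

@[fun_prop]
theorem range {n : α → ℕ} (hn : PolyTime n) : PolyTime fun a => List.range (n a) := by
  have key : ∀ i, (fun x : ℕ × List ℕ => (x.1 + 1, x.2 ++ [x.1]))^[i] (0, []) =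
      (i, List.range i) := by
    intro i
    induction i with
    | zero => rfl
    | succ i ih => rw [Function.iterate_succ_apply', ih, List.range_succ]
  have : (fun a => List.range (n a)) = fun a =>
      ((fun x : ℕ × List ℕ => (x.1 + 1, x.2 ++ [x.1]))^[n a] (0, [])).2 := by
    simp [key]
  rw [this]
  refine (iterate (f := fun _ x => (x.1 + 1, x.2 ++ [x.1])) hn (by fun_prop) (by fun_prop)
    ⟨_, ((hn.size_bdd.add ((hn.size_bdd.mul (hn.size_bdd.add (PolyBdd.const 2))).add
      (PolyBdd.const 1))).add (PolyBdd.const 1)), fun a i hi => ?_⟩).snd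
  rw [key]
  have h := size_list_le (List.range i) (size (n a)) (fun j hj => by
    simp at hj ⊢; lia)
  have h₂ : i * (size (n a) + 1) ≤ size (n a) * (size (n a) + 2) :=
    Nat.mul_le_mul (by simp; lia) (by lia)
  rw [size_pair]
  simp only [List.length_range] at h
  have h₃ : size i ≤ size (n a) := by simp; lia
  lia

end PolyTime

end StackProg

/-! ### Exponential time by padding with a number in unary. -/

namespace StackProg

open PVPDA (Letter)
open Coded (code)

/-! ### Exponential time -/

/-- A function bounded by an exponential of a polynomial in the size of the argument. -/
def ExpBdd {α : Type} [Coded α] (g : α → ℕ) : Prop := ∃ k, ∀ a, g a ≤ 2 ^ (size a + 2) ^ k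

section ExpBdd

variable {α β : Type} [Coded α] [Coded β]

theorem ExpBdd.mono {f g : α → ℕ} (h : ExpBdd g) (hfg : ∀ a, f a ≤ g a) : ExpBdd f :=
  let ⟨k, hk⟩ := h
  ⟨k, fun a => (hfg a).trans (hk a)⟩

theorem PolyBdd.exp {f : α → ℕ} (h : PolyBdd f) : ExpBdd fun a => 2 ^ f a :=
  let ⟨k, hk⟩ := h
  ⟨k, fun a => Nat.pow_le_pow_right (by simp) (hk a)⟩

theorem PolyBdd.expBdd {f : α → ℕ} (h : PolyBdd f) : ExpBdd f :=
  h.exp.mono fun _ => Nat.lt_two_pow_self.le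

theorem ExpBdd.mul {f g : α → ℕ} (hf : ExpBdd f) (hg : ExpBdd g) : ExpBdd fun a => f a * g a := by
  obtain ⟨k, hk⟩ := hf
  obtain ⟨l, hl⟩ := hg
  have h : PolyBdd fun a : α => (size a + 2) ^ k + (size a + 2) ^ l :=
    PolyBdd.add ⟨k, fun _ => le_rfl⟩ ⟨l, fun _ => le_rfl⟩
  exact h.exp.mono fun a => by rw [pow_add]; exact Nat.mul_le_mul (hk a) (hl a)

theorem ExpBdd.add {f g : α → ℕ} (hf : ExpBdd f) (hg : ExpBdd g) : ExpBdd fun a => f a + g a := by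
  have h₁ : ExpBdd fun a => f a + 1 := by
    obtain ⟨k, hk⟩ := hf
    have h : PolyBdd fun a : α => (size a + 2) ^ k + 1 :=
      PolyBdd.add ⟨k, fun _ => le_rfl⟩ (PolyBdd.const 1)
    refine h.exp.mono fun a => ?_
    have := hk a
    have := Nat.one_le_two_pow (n := (size a + 2) ^ k)
    rw [pow_succ]
    lia
  have h₂ : ExpBdd fun a => g a + 1 := by
    obtain ⟨k, hk⟩ := hg
    have h : PolyBdd fun a : α => (size a + 2) ^ k + 1 :=
      PolyBdd.add ⟨k, fun _ => le_rfl⟩ (PolyBdd.const 1)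
    refine h.exp.mono fun a => ?_
    have := hk a
    have := Nat.one_le_two_pow (n := (size a + 2) ^ k)
    rw [pow_succ]
    lia
  exact (h₁.mul h₂).mono fun a => by nlinarith [Nat.zero_le (f a * g a)]

theorem ExpBdd.pow {f : α → ℕ} (hf : ExpBdd f) (k : ℕ) : ExpBdd fun a => f a ^ k := by
  induction k with
  | zero => exact (PolyBdd.const 1).expBdd.mono (by simp)
  | succ k ih => exact (ih.mul hf).mono fun a => (pow_succ _ _).le

theorem PolyBdd.comp_exp {g : β → ℕ} {f : α → β} (hg : PolyBdd g)
    (hf : ExpBdd fun a => StackProg.size (f a)) : ExpBdd fun a => g (f a) := by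
  obtain ⟨k, hk⟩ := hg
  exact ((hf.add (PolyBdd.const 2).expBdd).pow k).mono fun a => hk (f a)

end ExpBdd

/-- A function computed by a stack program in exponential time. -/
def ExpTime {α β : Type} [Coded α] [Coded β] (f : α → β) : Prop :=
  ∃ c, ∃ g : α → ℕ, ExpBdd g ∧ ∀ a, Computes c (code a) (code (f a)) (g a)

section ExpTime

variable {α β γ : Type} [Coded α] [Coded β] [Coded γ]

theorem ExpTime.size_bdd {f : α → β} (hf : ExpTime f) : ExpBdd fun a => size (f a) :=
  let ⟨_, _, hg, hc⟩ := hf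
  (PolyBdd.size.expBdd.add hg).mono fun a => (hc a).size_le

theorem PolyTime.comp_exp {g : β → γ} {f : α → β} (hg : PolyTime g) (hf : ExpTime f) :
    ExpTime fun a => g (f a) := by
  have hs := hf.size_bdd
  obtain ⟨c, t, ht, hc⟩ := hf
  obtain ⟨d, u, hu, hd⟩ := hg
  exact ⟨c ;; d, _, ht.add (hu.comp_exp hs), fun a => (hc a).seq (hd (f a))⟩

theorem ExpTime.comp_poly {g : β → γ} {f : α → β} (hg : ExpTime g) (hf : PolyTime f) :
    ExpTime fun a => g (f a) := by
  obtain ⟨k, hk⟩ := hf.size_bdd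
  obtain ⟨c, t, ht, hc⟩ := hf
  obtain ⟨d, u, ⟨l, hl⟩, hd⟩ := hg
  have h : PolyBdd fun a : α => ((size a + 2) ^ k + 2) ^ l :=
    (PolyBdd.add ⟨k, fun _ => le_rfl⟩ (PolyBdd.const 2)).pow l
  exact ⟨c ;; d, _, ht.expBdd.add h.exp, fun a => (hc a).seq ((hd (f a)).mono ((hl _).trans
    (Nat.pow_le_pow_right (by simp) (Nat.pow_le_pow_left (Nat.add_le_add_right (hk a) 2) l))))⟩

/-- A unary number is doubled once per unit of the list. The states are exponentially large, so the
fold program is analysed directly instead of through `PolyTime.foldl`: every round is polynomial in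
an exponential bound. -/
theorem expTime_pad : ExpTime fun x : List Unit × α => (x.2, 2 ^ x.1.length) := by
  have e : ∀ (l : List Unit) (a : α) (m : ℕ), l.foldl
      (fun (y : α × ℕ) _ => (y.1, y.2 + y.2)) (a, m) = (a, 2 ^ l.length * m) := by
    intro l
    induction l with
    | nil => intro a m; simp
    | cons u l ih =>
      intro a m
      rw [List.foldl_cons, ih, List.length_cons, pow_succ]
      simp only [Prod.mk.injEq, true_and]
      ring
  have hbody : PolyTime fun x : Unit × α × ℕ => (x.2.1, x.2.2 + x.2.2) := by fun_prop
  obtain ⟨c, t, ⟨k, hk⟩, hc⟩ := hbody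
  have hpre : PolyTime fun x : List Unit × α => (x.1, x.2, 1) := by fun_prop
  suffices h : ExpTime fun x : List Unit × α × ℕ => x.1.foldl
      (fun (y : α × ℕ) _ => (y.1, y.2 + y.2)) (x.2.1, 1) by
    have := h.comp_poly hpre
    simpa [e] using this
  have h₀ : PolyTime fun x : List Unit × α × ℕ => (x.1, x.2.1, 1) := by fun_prop
  have hl : PolyBdd fun x : List Unit × α × ℕ => size x.1 := PolyTime.fst'.size_bdd
  have ha : PolyBdd fun x : List Unit × α × ℕ => size x.2.1 :=
    (PolyTime.fst'.comp PolyTime.snd').size_bdd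
  have hB : ExpBdd fun x : List Unit × α × ℕ => size x.2.1 + 2 * 2 ^ size x.1 + 2 :=
    (ha.expBdd.add ((PolyBdd.const 2).expBdd.mul hl.exp)).add (PolyBdd.const 2).expBdd
  suffices h : ∃ u : List Unit × α × ℕ → ℕ, ExpBdd u ∧ ∀ x : List Unit × α × ℕ,
      Computes (foldCmd c) (code (x.1, x.2.1, 1))
        (code (x.1.foldl (fun (y : α × ℕ) _ => (y.1, y.2 + y.2)) (x.2.1, 1))) (u x) by
    obtain ⟨u, hu, h⟩ := h
    obtain ⟨d, v, hv, hd⟩ := h₀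
    exact ⟨d ;; foldCmd c, _, hv.expBdd.add hu, fun x => (hd x).seq (h x)⟩
  refine ⟨_, (hl.expBdd.mul (((((hB.add (PolyBdd.const 4).expBdd).pow k).add
    ((PolyBdd.const 24).expBdd.mul hl.expBdd)).add ((PolyBdd.const 24).expBdd.mul hB)).add
    (PolyBdd.const 40).expBdd)).add (PolyBdd.const 5).expBdd, fun x => ?_⟩
  have hsz : ∀ l₁ l₂, x.1 = l₁ ++ l₂ → size (l₁.foldl
      (fun (y : α × ℕ) _ => (y.1, y.2 + y.2)) (x.2.1, 1)) ≤
        size x.2.1 + 2 * 2 ^ size x.1 + 2 := by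
    intro l₁ l₂ hx
    have h₁ : l₁.length ≤ size x.1 := le_trans (by rw [hx]; simp) (length_le_size x.1)
    have h₂ := Nat.pow_le_pow_right (n := 2) (by simp) h₁
    rw [e]
    simp only [size_pair, size_nat]
    lia
  have h := computes_foldCmd (code : Unit → Tree) (code : α × ℕ → Tree) c
    (fun (y : α × ℕ) _ => (y.1, y.2 + y.2))
    ((size x.2.1 + 2 * 2 ^ size x.1 + 2 + 4) ^ k) (size x.2.1 + 2 * 2 ^ size x.1 + 2) x.1 (x.2.1, 1)
    ?_ hsz
  · exact h.mono (Nat.add_le_add_right (Nat.mul_le_mul_right _ (length_le_size x.1)) _)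
  · intro l₁ b l₂ hx
    have h₁ := hsz l₁ _ hx
    refine (hc (b, _)).mono ((hk _).trans (Nat.pow_le_pow_left ?_ k))
    simp only [size_pair, size_unit]
    lia

end ExpTime

/-! ### From programs to machines -/

/-- Push the code of the letter in the register. -/
def pushLetter : Cmd :=
  .ite (fun r => decide (r = some (.bit false))) (pushWord (letterCode (.bit false)).word)
    (.ite (fun r => decide (r = some (.bit true))) (pushWord (letterCode (.bit true)).word)
      (.ite (fun r => decide (r = some .mark)) (pushWord (letterCode .mark).word)
        (pushWord (letterCode .close).word)))

theorem runs_pushLetter (x : Letter) (i : List Letter) (v : List Bool) :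
    Runs pushLetter ⟨some x, i, v, [], [], [], []⟩
      ⟨some x, i, (letterCode x).word ++ v, [], [], [], []⟩ 10 := by
  have key : ∀ l : List Bool, Runs (pushWord l) ⟨some x, i, v, [], [], [], []⟩
      ⟨some x, i, l ++ v, [], [], [], []⟩ (l.length + 1) := by
    intro l
    induction l with
    | nil => exact Runs.prim rfl
    | cons b l ih => exact Runs.seq ih (Runs.prim rfl)
  rcases x with (_ | _) | _ | _
  · exact (Runs.iteTrue rfl (key _)).mono (by decide)
  · exact (Runs.iteFalse rfl (Runs.iteTrue rfl (key _))).mono (by decide)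
  · exact (Runs.iteFalse rfl (Runs.iteFalse rfl (Runs.iteTrue rfl (key _)))).mono (by decide)
  · exact (Runs.iteFalse rfl (Runs.iteFalse rfl (Runs.iteFalse rfl (key _)))).mono (by decide)

/-- Move the input to the value stack, as a list in reverse order. -/
def readInput : Cmd :=
  push .val false ;; .prim .read ;;
    .loop Option.isSome (pushLetter ;; push .val true ;; .prim .read)

theorem runs_readInput (w : List Letter) :
    Runs readInput (St.input w) (base (code w.reverse).word [] [] []) (13 * w.length + 3) := by
  have key : ∀ w u : List Letter,
      Runs (.loop Option.isSome (pushLetter ;; push .val true ;; .prim .read))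
      ⟨w.head?, w.tail, (code u).word, [], [], [], []⟩
      (base (code (w.reverse ++ u)).word [] [] []) (13 * w.length + 1) := by
    intro w
    induction w with
    | nil => intro u; exact Runs.loopDone rfl
    | cons x w ih =>
      intro u
      refine (Runs.loopStep rfl ((runs_pushLetter x w (code u).word).seq
        ((Runs.prim rfl).seq (Runs.prim rfl))) ((ih (x :: u)).of_eq ?_ rfl le_rfl)).of_eq rfl ?_ ?_
      · simp [Prim.exec, St.set, St.get, code, Tree.ofList, Tree.word]
      · simp
      · simp; lia
  refine ((Runs.prim rfl).seq ((Runs.prim rfl).seq (key w []))).of_eq rfl ?_ ?_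
  · simp
  · lia

/-- Replace the code of a truth value by the corresponding bit. -/
def writeOutput : Cmd :=
  pop .val ;; .ite regBit (popVal ;; popVal ;; push .val true) (clear ;; push .val false)

theorem runs_writeOutput (b : Bool) :
    Runs writeOutput (base (code b).word [] [] []) (St.output [b]) 10 := by
  cases b
  · exact ((Runs.prim rfl).seq (Runs.iteFalse rfl ((Runs.prim rfl).seq (Runs.prim rfl)))).mono
      (by simp)
  · exact ((Runs.prim rfl).seq (Runs.iteTrue rfl (((Runs.prim rfl).seq (Runs.prim rfl)).seq
      (((Runs.prim rfl).seq (Runs.prim rfl)).seq (Runs.prim rfl))))).mono (by simp)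

/-- A letter has a code of at most five nodes, and its list cell adds one. -/
theorem size_word_le (w : List Letter) : size w ≤ 6 * w.length + 1 := by
  have := size_list_le w 5 fun a _ => by
    rcases a with (_ | _) | _ | _ <;> simp [size, code, letterCode]
  lia

open Classical in
/-- A language is in EXPTIME if it is decided by a polynomial time function that has access to an
exponentially large number in unary. -/
theorem inEXPTIME_of_polyTime (L : Language Letter) (q : List Letter → ℕ) (hq : PolyTime q)
    (f : List Letter × ℕ → Bool) (hf : PolyTime f)
    (h : ∀ w, w ∈ L ↔ f (w, 2 ^ q w) = true) : PVPDA.InEXPTIME L := by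
  -- Reading the input onto the value stack reverses it; the reversals here undo this.
  have hpre : PolyTime fun w : List Letter => (List.replicate (q w.reverse) (), w.reverse) := by
    fun_prop
  have hE : ExpTime fun w : List Letter => f (w.reverse, 2 ^ q w.reverse) := by
    have := hf.comp_exp (expTime_pad.comp_poly hpre)
    simpa using this
  obtain ⟨c, g, ⟨k, hk⟩, hc⟩ := hE
  have hrun : ∀ w : List Letter, ∃ n ≤ 13 * w.length + 13 + 2 ^ (6 * w.length + 3) ^ k,
      Run (readInput ;; c ;; writeOutput) (St.input w) (St.output [decide (w ∈ L)]) n := by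
    intro w
    have h₁ := hc w.reverse []
    simp only [List.append_nil] at h₁
    have h₂ := (runs_readInput w).seq (h₁.seq (runs_writeOutput _))
    have h₃ : f (w.reverse.reverse, 2 ^ q w.reverse.reverse) = decide (w ∈ L) := by
      rw [Bool.eq_iff_iff, List.reverse_reverse, ← h w]
      simp
    rw [h₃] at h₂
    refine h₂.mono ?_
    have h₄ := hk w.reverse
    have h₅ : 2 ^ (size w.reverse + 2) ^ k ≤ 2 ^ (6 * w.length + 3) ^ k := by
      refine Nat.pow_le_pow_right (by simp) (Nat.pow_le_pow_left ?_ k)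
      have := size_word_le w.reverse
      simp at this
      lia
    lia
  -- The linear summands pay for input, output and the halting step: with `E = 2 ^ (6 * n + 3) ^ k`,
  -- which is at least one, `13 * n + 14 + E ≤ E * 2 ^ (14 * n + 15)`.
  refine ⟨(6 * Polynomial.X + 3) ^ k + 14 * Polynomial.X + 15, Cmd.computable
    (readInput ;; c ;; writeOutput) _ (fun n => 13 * n + 13 + 2 ^ (6 * n + 3) ^ k) hrun, ?_, ?_⟩
  · rintro (_ | _)
    · exact inferInstanceAs (Finite Letter)
    · exact inferInstanceAs (Finite Bool)
  · intro n
    change 13 * n + 13 + 2 ^ (6 * n + 3) ^ k + 1 ≤ _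
    have e : Polynomial.eval n ((6 * Polynomial.X + 3) ^ k + 14 * Polynomial.X + 15 : Polynomial ℕ)
        = (6 * n + 3) ^ k + (14 * n + 15) := by
      simp only [Polynomial.eval_add, Polynomial.eval_pow, Polynomial.eval_mul, Polynomial.eval_X,
        Polynomial.eval_ofNat]
      ring
    rw [e, pow_add]
    have h₁ : 14 * n + 15 < 2 ^ (14 * n + 15) := Nat.lt_two_pow_self
    have h₂ : 1 ≤ 2 ^ (6 * n + 3) ^ k := Nat.one_le_two_pow
    nlinarith

end StackProg

/-! ### Bisimilarity as a greatest fixed point, and its reduction to a finite table. -/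

namespace PVPDA

/-! ### Bisimilarity by liftings of arbitrary relations -/

/-- The lifting of a relation to distributions: each set has at most the probability of its image.
-/
def Lift {S T : Type} (R : S → T → Prop) (d : PMF S) (d' : PMF T) : Prop :=
  ∀ U : Set S, d.toOuterMeasure U ≤ d'.toOuterMeasure {t | ∃ s ∈ U, R s t}

namespace Lift

variable {S T V : Type}

theorem mono {R R' : S → T → Prop} {d : PMF S} {d' : PMF T} (h : Lift R d d')
    (hR : ∀ s t, R s t → R' s t) : Lift R' d d' := fun U =>
  (h U).trans (d'.toOuterMeasure.mono fun _ ⟨s, hs, hst⟩ => ⟨s, hs, hR _ _ hst⟩)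

theorem refl {R : S → S → Prop} (hR : ∀ s, R s s) (d : PMF S) : Lift R d d := fun _ =>
  d.toOuterMeasure.mono fun s hs => ⟨s, hs, hR s⟩

theorem trans {R : S → T → Prop} {R' : T → V → Prop} {d : PMF S} {d' : PMF T} {d'' : PMF V}
    (h : Lift R d d') (h' : Lift R' d' d'') : Lift (fun s v => ∃ t, R s t ∧ R' t v) d d'' := by
  intro U
  refine (h U).trans ((h' _).trans (d''.toOuterMeasure.mono ?_))
  rintro v ⟨t, ⟨s, hs, hst⟩, htv⟩
  exact ⟨s, hs, t, hst, htv⟩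

theorem toOuterMeasure_add_compl (d : PMF S) (U : Set S) :
    d.toOuterMeasure U + d.toOuterMeasure Uᶜ = 1 := by
  classical
  rw [PMF.toOuterMeasure_apply, PMF.toOuterMeasure_apply, ← ENNReal.tsum_add, ← d.tsum_coe]
  congr 1
  funext s
  by_cases hs : s ∈ U <;> simp [hs]

/-- Complementation turns the condition around. With `W` the set of points that have an
`R`-successor in `V`, no point of `Wᶜ` has one, so `d Wᶜ ≤ d' Vᶜ`; as both total masses are one, `d'
V ≤ d W`. -/
theorem symm {R : S → T → Prop} {d : PMF S} {d' : PMF T} (h : Lift R d d') :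
    Lift (fun t s => R s t) d' d := by
  intro V
  set W : Set S := {s | ∃ t ∈ V, R s t} with hW
  have h₁ := h Wᶜ
  have h₂ : d'.toOuterMeasure {t | ∃ s ∈ Wᶜ, R s t} ≤ d'.toOuterMeasure Vᶜ := by
    refine d'.toOuterMeasure.mono ?_
    rintro t ⟨s, hs, hst⟩ ht
    exact hs ⟨t, ht, hst⟩
  have h₃ := toOuterMeasure_add_compl d W
  have h₄ := toOuterMeasure_add_compl d' V
  have h₅ : d.toOuterMeasure Wᶜ ≠ ⊤ := by
    intro h
    rw [h] at h₃
    simp at h₃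
  refine (ENNReal.add_le_add_iff_right h₅).1 ?_
  rw [h₃, ← h₄]
  gcongr
  exact h₁.trans h₂

/-- Transitions are images of rule distributions under appending the rest of the stack; this brings
the lifting back to the rules. -/
theorem map_iff {S' T' : Type} {R : S' → T' → Prop} {f : S → S'} {g : T → T'} {d : PMF S}
    {d' : PMF T} : Lift R (d.map f) (d'.map g) ↔ Lift (fun s t => R (f s) (g t)) d d' := by
  constructor
  · intro h U
    have := h (f '' U)
    rw [PMF.toOuterMeasure_map_apply, PMF.toOuterMeasure_map_apply] at this
    refine (d.toOuterMeasure.mono (Set.subset_preimage_image f U)).trans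
      (this.trans (d'.toOuterMeasure.mono ?_))
    rintro t ⟨_, ⟨s, hs, rfl⟩, hst⟩
    exact ⟨s, hs, hst⟩
  · intro h U
    rw [PMF.toOuterMeasure_map_apply, PMF.toOuterMeasure_map_apply]
    refine (h _).trans (d'.toOuterMeasure.mono ?_)
    rintro t ⟨s, hs, hst⟩
    exact ⟨f s, hs, hst⟩

/-- The visibility condition constrains only the supports of the rules, so related points must be
assumed to lie there. -/
theorem inter_support {R : S → T → Prop} {d : PMF S} {d' : PMF T} (h : Lift R d d') :
    Lift (fun s t => s ∈ d.support ∧ t ∈ d'.support ∧ R s t) d d' := by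
  intro U
  rw [← PMF.toOuterMeasure_apply_inter_support]
  refine (h _).trans ?_
  rw [← PMF.toOuterMeasure_apply_inter_support]
  refine d'.toOuterMeasure.mono ?_
  rintro t ⟨⟨s, ⟨hs, hs'⟩, hst⟩, ht⟩
  exact ⟨s, hs, hs', ht, hst⟩

/-- Equal masses on all classes mean equal images in the quotient, where the lifting of equality is
reflexive. This also covers sets that meet infinitely many classes. -/
theorem of_distEquiv {R : Setoid S} {d d' : PMF S} (h : DistEquiv R d d') :
    Lift (fun s t => R s t) d d' := by
  have hq : d.map (Quotient.mk R) = d'.map (Quotient.mk R) := by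
    refine PMF.ext fun x => ?_
    induction x using Quotient.inductionOn with
    | h s =>
      have := h {t | R t s} (Setoid.mem_classes R s)
      have e : Quotient.mk R ⁻¹' {Quotient.mk R s} = {t | R t s} := by
        ext t
        simp only [Set.mem_preimage, Set.mem_singleton_iff, Set.mem_ofPred_eq]
        exact Quotient.eq
      rw [← PMF.toOuterMeasure_apply_singleton, ← PMF.toOuterMeasure_apply_singleton,
        PMF.toOuterMeasure_map_apply, PMF.toOuterMeasure_map_apply, e, this]
  have h₁ : Lift Eq (d.map (Quotient.mk R)) (d'.map (Quotient.mk R)) := by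
    rw [hq]
    exact Lift.refl (fun _ => rfl) _
  exact (map_iff.1 h₁).mono fun s t e => Quotient.exact e

theorem distEquiv {R : Setoid S} {d d' : PMF S} (h : Lift (fun s t => R s t) d d') :
    DistEquiv R d d' := by
  have key : ∀ {d d' : PMF S}, Lift (fun s t => R s t) d d' → ∀ E ∈ R.classes,
      d.toOuterMeasure E ≤ d'.toOuterMeasure E := by
    rintro d d' h E ⟨x, rfl⟩
    refine (h _).trans (d'.toOuterMeasure.mono ?_)
    rintro t ⟨s, hs, hst⟩
    exact R.trans (R.symm hst) hs
  intro E hE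
  exact le_antisymm (key h E hE) (key (h.symm.mono fun s t hst => R.symm hst) E hE)

end Lift

/-- A relation that is closed under the transfer conditions with respect to the lifting. -/
def PLTS.IsTransfer {S A : Type} (L : PLTS S A) (R : S → S → Prop) : Prop :=
  ∀ s t, R s t →
    (∀ a d, (s, a, d) ∈ L.tran → ∃ d', (t, a, d') ∈ L.tran ∧ Lift R d d') ∧
    (∀ a d', (t, a, d') ∈ L.tran → ∃ d, (s, a, d) ∈ L.tran ∧ Lift R d d')

/-- The union of all relations that satisfy the transfer conditions. -/
def PLTS.Transfer {S A : Type} (L : PLTS S A) (s t : S) : Prop := ∃ R, L.IsTransfer R ∧ R s t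

theorem PLTS.isTransfer_transfer {S A : Type} (L : PLTS S A) : L.IsTransfer L.Transfer := by
  rintro s t ⟨R, hR, hst⟩
  refine ⟨fun a d hd => ?_, fun a d hd => ?_⟩
  · obtain ⟨d', hd', h⟩ := (hR s t hst).1 a d hd
    exact ⟨d', hd', h.mono fun s t h => ⟨R, hR, h⟩⟩
  · obtain ⟨d', hd', h⟩ := (hR s t hst).2 a d hd
    exact ⟨d', hd', h.mono fun s t h => ⟨R, hR, h⟩⟩

/-- A transfer relation need not be an equivalence, but converses and composites of transfer
relations are transfer relations, by symmetry and transitivity of the lifting. So the largest one is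
an equivalence. -/
theorem PLTS.equivalence_transfer {S A : Type} (L : PLTS S A) : Equivalence L.Transfer where
  refl s := ⟨Eq, fun s t h => by
    subst h
    exact ⟨fun a d hd => ⟨d, hd, Lift.refl (fun _ => rfl) d⟩,
      fun a d hd => ⟨d, hd, Lift.refl (fun _ => rfl) d⟩⟩, rfl⟩
  symm := by
    intro s t h
    refine ⟨fun s t => L.Transfer t s, fun s t hst => ⟨fun a d hd => ?_, fun a d hd => ?_⟩, h⟩
    · obtain ⟨d', hd', h⟩ := (L.isTransfer_transfer t s hst).2 a d hd
      exact ⟨d', hd', h.symm⟩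
    · obtain ⟨d', hd', h⟩ := (L.isTransfer_transfer t s hst).1 a d hd
      exact ⟨d', hd', h.symm⟩
  trans := by
    intro s t u h h'
    refine ⟨fun s u => ∃ t, L.Transfer s t ∧ L.Transfer t u, ?_, t, h, h'⟩
    rintro s u ⟨t, hst, htu⟩
    refine ⟨fun a d hd => ?_, fun a d hd => ?_⟩
    · obtain ⟨d', hd', h⟩ := (L.isTransfer_transfer s t hst).1 a d hd
      obtain ⟨d'', hd'', h'⟩ := (L.isTransfer_transfer t u htu).1 a d' hd'
      exact ⟨d'', hd'', h.trans h'⟩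
    · obtain ⟨d', hd', h⟩ := (L.isTransfer_transfer t u htu).2 a d hd
      obtain ⟨d'', hd'', h'⟩ := (L.isTransfer_transfer s t hst).2 a d' hd'
      exact ⟨d'', hd'', h'.trans h⟩

/-- Bisimilarity can now be shown by exhibiting any relation closed under transfer, such as the one
defined by a table. -/
theorem PLTS.bisimilar_iff_transfer {S A : Type} (L : PLTS S A) (s t : S) :
    L.Bisimilar s t ↔ L.Transfer s t := by
  constructor
  · rintro ⟨R, hR, hst⟩
    refine ⟨fun s t => R s t, fun s t hst => ⟨fun a d hd => ?_, fun a d hd => ?_⟩, hst⟩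
    · obtain ⟨d', hd', h⟩ := hR s t hst a d hd
      exact ⟨d', hd', Lift.of_distEquiv h⟩
    · obtain ⟨d', hd', h⟩ := hR t s (R.symm hst) a d hd
      exact ⟨d', hd', (Lift.of_distEquiv h).symm.mono fun s t h => R.symm h⟩
  · intro h
    refine ⟨⟨L.Transfer, L.equivalence_transfer⟩, fun s t hst a d hd => ?_, h⟩
    obtain ⟨d', hd', h⟩ := (L.isTransfer_transfer s t hst).1 a d hd
    exact ⟨d', hd', Lift.distEquiv h⟩

/-! ### The finite table that determines bisimilarity -/

section Table

variable {Q Γ A : Type}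

/-- A table: `T X Y B p q` is meant to say that `pXβ` and `qYβ'` are bisimilar if `B` is the
relation between the control states that are bisimilar on `β` and `β'`. -/
abbrev Table (Q Γ : Type) : Type := Γ → Γ → (Q → Q → Prop) → Q → Q → Prop

/-- The relation between targets of rules that is prescribed by a table. -/
def Table.Rel (T : Table Q Γ) (B : Q → Q → Prop) (x y : Q × List Γ) : Prop :=
  match x.2, y.2 with
  | [], [] => B x.1 y.1
  | [X], [Y] => T X Y B x.1 y.1
  | [X, X'], [Y, Y'] => T X Y (T X' Y' B) x.1 y.1
  | _, _ => False

/-- A table that is monotone in the relation. -/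
def Table.Mono (T : Table Q Γ) : Prop :=
  ∀ X Y (B B' : Q → Q → Prop), (∀ p q, B p q → B' p q) → ∀ p q, T X Y B p q → T X Y B' p q

theorem Table.Rel.mono {T T' : Table Q Γ} {B B' : Q → Q → Prop} (hT : T.Mono)
    (hTT' : ∀ X Y B p q, T X Y B p q → T' X Y B p q) (hB : ∀ p q, B p q → B' p q)
    {x y : Q × List Γ} (h : T.Rel B x y) : T'.Rel B' x y := by
  rcases x with ⟨p, _ | ⟨X, _ | ⟨X', _ | _⟩⟩⟩ <;> rcases y with ⟨q, _ | ⟨Y, _ | ⟨Y', _ | _⟩⟩⟩ <;>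
    simp only [Table.Rel] at h ⊢
  · exact hB _ _ h
  · exact hTT' _ _ _ _ _ (hT _ _ _ _ hB _ _ h)
  -- Monotonicity of `T` suffices: the inner relation is enlarged while `T` is still outside, and
  -- then the outer `T` is replaced by `T'`.
  · refine hTT' _ _ _ _ _ (hT _ _ _ _ (fun p q h => ?_) _ _ h)
    exact hTT' _ _ _ _ _ (hT _ _ _ _ hB _ _ h)

variable [Finite Q] [Finite Γ] [Finite A]

/-- One step of the refinement of a table. -/
def PPDA.refine (D : PPDA Q Γ A) (T : Table Q Γ) : Table Q Γ := fun X Y B p q =>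
  (∀ a d, (p, X, a, d) ∈ D.rules → ∃ d', (q, Y, a, d') ∈ D.rules ∧
    Lift (fun x y => T.Rel B (x.1, x.2.1) (y.1, y.2.1)) d d') ∧
  (∀ a d', (q, Y, a, d') ∈ D.rules → ∃ d, (p, X, a, d) ∈ D.rules ∧
    Lift (fun x y => T.Rel B (x.1, x.2.1) (y.1, y.2.1)) d d')

/-- A control state without a rule for the topmost symbol. -/
def PPDA.Stuck (D : PPDA Q Γ A) (p : Q) (X : Γ) : Prop := ∀ a d, (p, X, a, d) ∉ D.rules

/-- The relation between control states on two stack contents that is prescribed by a table. -/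
def PPDA.stackRel (D : PPDA Q Γ A) (T : Table Q Γ) : List Γ → List Γ → Q → Q → Prop
  | [], [] => fun _ _ => True
  | [], Y :: _ => fun _ q => D.Stuck q Y
  | X :: _, [] => fun p _ => D.Stuck p X
  | X :: β, Y :: β' => T X Y (D.stackRel T β β')

theorem PPDA.refine_mono (D : PPDA Q Γ A) {T T' : Table Q Γ} (hT : T.Mono)
    (hTT' : ∀ X Y B p q, T X Y B p q → T' X Y B p q) {X Y : Γ} {B B' : Q → Q → Prop}
    (hB : ∀ p q, B p q → B' p q) {p q : Q} (h : D.refine T X Y B p q) :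
    D.refine T' X Y B' p q := by
  refine ⟨fun a d hd => ?_, fun a d hd => ?_⟩
  · obtain ⟨d', hd', hl⟩ := h.1 a d hd
    exact ⟨d', hd', hl.mono fun x y h => h.mono hT hTT' hB⟩
  · obtain ⟨d', hd', hl⟩ := h.2 a d hd
    exact ⟨d', hd', hl.mono fun x y h => h.mono hT hTT' hB⟩

/-- The approximations of the greatest table. -/
def PPDA.approx (D : PPDA Q Γ A) (k : ℕ) : Table Q Γ := D.refine^[k] fun _ _ _ _ _ => True

theorem PPDA.approx_succ (D : PPDA Q Γ A) (k : ℕ) : D.approx (k + 1) = D.refine (D.approx k) :=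
  Function.iterate_succ_apply' _ _ _

theorem PPDA.approx_mono (D : PPDA Q Γ A) (k : ℕ) : (D.approx k).Mono := by
  induction k with
  | zero => intro _ _ _ _ _ _ _ _; trivial
  | succ k ih =>
    intro X Y B B' hB p q h
    rw [PPDA.approx_succ] at h ⊢
    exact D.refine_mono ih (fun _ _ _ _ _ h => h) hB h

theorem PPDA.approx_antitone (D : PPDA Q Γ A) (k : ℕ) :
    ∀ X Y B p q, D.approx (k + 1) X Y B p q → D.approx k X Y B p q := by
  induction k with
  | zero => intro _ _ _ _ _ _; trivial
  | succ k ih =>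
    intro X Y B p q h
    rw [PPDA.approx_succ] at h ⊢
    exact D.refine_mono (D.approx_mono _) ih (fun _ _ h => h) h

theorem PPDA.mem_tran_cons (D : PPDA Q Γ A) (p : Q) (X : Γ) (β : List Γ) (a : A)
    (e : PMF (Config Q Γ)) : ((p, X :: β), a, e) ∈ D.toPLTS.tran ↔
      ∃ d, (p, X, a, d) ∈ D.rules ∧ e = d.map fun x => (x.1, x.2.1 ++ β) := by
  constructor
  · rintro ⟨q, Y, b, d, hd, γ, h⟩
    simp only [Prod.mk.injEq, List.cons.injEq] at h
    obtain ⟨⟨rfl, rfl, rfl⟩, rfl, rfl⟩ := h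
    exact ⟨d, hd, rfl⟩
  · rintro ⟨d, hd, rfl⟩
    exact ⟨p, X, a, d, hd, β, rfl⟩

theorem PPDA.not_mem_tran_nil (D : PPDA Q Γ A) (p : Q) (a : A) (e : PMF (Config Q Γ)) :
    ((p, []), a, e) ∉ D.toPLTS.tran := by
  rintro ⟨q, Y, b, d, hd, γ, h⟩
  simp at h

/-- The relation between configurations that is prescribed by a table. -/
def PPDA.configRel (D : PPDA Q Γ A) (T : Table Q Γ) (s t : Config Q Γ) : Prop :=
  D.stackRel T s.2 t.2 s.1 t.1

theorem PPDA.configRel_of_rel (D : PPDA Q Γ A) (T : Table Q Γ) (β β' : List Γ) (x y : Q × List Γ)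
    (h : T.Rel (D.stackRel T β β') x y) : D.configRel T (x.1, x.2 ++ β) (y.1, y.2 ++ β') := by
  rcases x with ⟨p, _ | ⟨X, _ | ⟨X', _ | _⟩⟩⟩ <;> rcases y with ⟨q, _ | ⟨Y, _ | ⟨Y', _ | _⟩⟩⟩ <;>
    simp only [Table.Rel] at h <;> exact h

/-- Soundness. Refinement is applied with `B` the relation prescribed on the two lower stacks;
nested lookups then agree with the relation on the longer stacks after a call. If just one stack is
empty, the other configuration is stuck, and neither can move. -/
theorem PPDA.isTransfer_configRel (D : PPDA Q Γ A) (T : Table Q Γ)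
    (hT : ∀ X Y B p q, T X Y B p q → D.refine T X Y B p q) :
    D.toPLTS.IsTransfer (D.configRel T) := by
  rintro ⟨p, α⟩ ⟨q, α'⟩ h
  rcases α with _ | ⟨X, β⟩ <;> rcases α' with _ | ⟨Y, β'⟩
  · exact ⟨fun a d hd => absurd hd (D.not_mem_tran_nil p a d),
      fun a d hd => absurd hd (D.not_mem_tran_nil q a d)⟩
  · refine ⟨fun a d hd => absurd hd (D.not_mem_tran_nil p a d), fun a d hd => ?_⟩
    obtain ⟨d', hd', rfl⟩ := (D.mem_tran_cons _ _ _ _ _).1 hd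
    exact absurd hd' (h a d')
  · refine ⟨fun a d hd => ?_, fun a d hd => absurd hd (D.not_mem_tran_nil q a d)⟩
    obtain ⟨d', hd', rfl⟩ := (D.mem_tran_cons _ _ _ _ _).1 hd
    exact absurd hd' (h a d')
  · have h' := hT _ _ _ _ _ h
    refine ⟨fun a e he => ?_, fun a e he => ?_⟩
    · obtain ⟨d, hd, rfl⟩ := (D.mem_tran_cons _ _ _ _ _).1 he
      obtain ⟨d', hd', hl⟩ := h'.1 a d hd
      exact ⟨_, (D.mem_tran_cons _ _ _ _ _).2 ⟨d', hd', rfl⟩, Lift.map_iff.2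
        (hl.mono fun x y hxy => D.configRel_of_rel T β β' (x.1, x.2.1) (y.1, y.2.1) hxy)⟩
    · obtain ⟨d, hd, rfl⟩ := (D.mem_tran_cons _ _ _ _ _).1 he
      obtain ⟨d', hd', hl⟩ := h'.2 a d hd
      exact ⟨_, (D.mem_tran_cons _ _ _ _ _).2 ⟨d', hd', rfl⟩, Lift.map_iff.2
        (hl.mono fun x y hxy => D.configRel_of_rel T β β' (x.1, x.2.1) (y.1, y.2.1) hxy)⟩

/-- Completeness. `B` is bisimilarity itself on the lower stacks. Matching transitions carry the
same action, so by visibility all words in the two supports have the same length, and only the three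
equal-length cases of `Table.Rel` arise. -/
theorem PvPDA.approx_of_transfer (D : PvPDA Q Γ A) (k : ℕ) : ∀ X Y β β' p q,
    D.toPLTS.Transfer (p, X :: β) (q, Y :: β') →
      D.approx k X Y (fun p q => D.toPLTS.Transfer (p, β) (q, β')) p q := by
  induction k with
  | zero => intros; trivial
  | succ k ih =>
    intro X Y β β' p q h
    rw [PPDA.approx_succ]
    have key : ∀ a d d', (p, X, a, d) ∈ D.rules → (q, Y, a, d') ∈ D.rules →
        Lift D.toPLTS.Transfer (d.map fun x => (x.1, x.2.1 ++ β))
          (d'.map fun x => (x.1, x.2.1 ++ β')) →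
        Lift (fun x y => (D.approx k).Rel (fun p q => D.toPLTS.Transfer (p, β) (q, β'))
          (x.1, x.2.1) (y.1, y.2.1)) d d' := by
      intro a d d' hd hd' hl
      refine (Lift.map_iff.1 hl).inter_support.mono ?_
      rintro ⟨p', u, hu⟩ ⟨q', v, hv⟩ ⟨hx, hy, hxy⟩
      have h₁ := D.visibly _ _ _ _ hd _ hx
      have h₂ := D.visibly _ _ _ _ hd' _ hy
      have h₃ : u.length = v.length := h₁.trans h₂.symm
      rcases u with _ | ⟨X₁, _ | ⟨X₂, _ | _⟩⟩ <;> rcases v with _ | ⟨Y₁, _ | ⟨Y₂, _ | _⟩⟩ <;>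
        simp at h₃ hu hv
      · exact hxy
      · exact ih _ _ _ _ _ _ hxy
      -- A call uses the induction hypothesis twice: for the upper symbols, with bisimilarity below
      -- `X₂` and `Y₂` as the relation, and then for `X₂` and `Y₂`, to enlarge that relation to the
      -- one in the table.
      · refine D.approx_mono k _ _ _ _ ?_ _ _ (ih _ _ _ _ _ _ hxy)
        exact fun p q h => ih _ _ _ _ _ _ h
    refine ⟨fun a d hd => ?_, fun a d hd => ?_⟩
    · obtain ⟨e, he, hl⟩ := (D.toPLTS.isTransfer_transfer _ _ h).1 a _
        ((D.mem_tran_cons _ _ _ _ _).2 ⟨d, hd, rfl⟩)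
      obtain ⟨d', hd', rfl⟩ := (D.mem_tran_cons _ _ _ _ _).1 he
      exact ⟨d', hd', key a d d' hd hd' hl⟩
    · obtain ⟨e, he, hl⟩ := (D.toPLTS.isTransfer_transfer _ _ h).2 a _
        ((D.mem_tran_cons _ _ _ _ _).2 ⟨d, hd, rfl⟩)
      obtain ⟨d', hd', rfl⟩ := (D.mem_tran_cons _ _ _ _ _).1 he
      exact ⟨d', hd', key a d' d hd' hd hl⟩

/-- The two stacks are descended together, using monotonicity at each level. When one is exhausted,
bisimilarity with a configuration that cannot move forces the other to be stuck. -/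
theorem PvPDA.stackRel_of_transfer (D : PvPDA Q Γ A) (k : ℕ) : ∀ α α' p q,
    D.toPLTS.Transfer (p, α) (q, α') → D.stackRel (D.approx k) α α' p q
  | [], [], _, _, _ => trivial
  | [], Y :: β', p, q, h => fun a d hd => by
    obtain ⟨e, he, _⟩ := (D.toPLTS.isTransfer_transfer _ _ h).2 a _
      ((D.mem_tran_cons _ _ _ _ _).2 ⟨d, hd, rfl⟩)
    exact D.not_mem_tran_nil _ _ _ he
  | X :: β, [], p, q, h => fun a d hd => by
    obtain ⟨e, he, _⟩ := (D.toPLTS.isTransfer_transfer _ _ h).1 a _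
      ((D.mem_tran_cons _ _ _ _ _).2 ⟨d, hd, rfl⟩)
    exact D.not_mem_tran_nil _ _ _ he
  | X :: β, Y :: β', p, q, h =>
    D.approx_mono k _ _ _ _ (fun p q h => D.stackRel_of_transfer k β β' p q h) _ _
      (D.approx_of_transfer k X Y β β' p q h)

/-- Bisimilarity is determined by a stable approximation. -/
theorem PvPDA.bisimilar_iff (D : PvPDA Q Γ A) (k : ℕ) (hk : D.approx (k + 1) = D.approx k)
    (s t : Config Q Γ) : D.toPLTS.Bisimilar s t ↔ D.stackRel (D.approx k) s.2 t.2 s.1 t.1 := by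
  rw [PLTS.bisimilar_iff_transfer]
  constructor
  · exact D.stackRel_of_transfer k _ _ _ _
  · intro h
    refine ⟨_, D.isTransfer_configRel (D.approx k) ?_, h⟩
    intro X Y B p q h
    rwa [← PPDA.approx_succ, hk]

end Table

end PVPDA

/-! ### Binary numbers, encodings and parsers. -/

namespace PVPDA

open StackProg

/-! ### Numbers in binary -/

/-- The successor of a number in binary. -/
def incr : List Bool → List Bool
  | [] => [true]
  | false :: l => true :: l
  | true :: l => false :: incr l

theorem bits_succ (n : ℕ) : (n + 1).bits = incr n.bits := by
  induction n using Nat.strong_induction_on with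
  | _ n ih =>
    rcases Nat.even_or_odd' n with ⟨m, rfl | rfl⟩
    · rcases Nat.eq_zero_or_pos m with rfl | hm
      · simp [incr]
      · rw [Nat.bit1_bits, Nat.bit0_bits m hm.ne', incr]
    · have e : 2 * m + 1 + 1 = 2 * (m + 1) := by ring
      rw [e, Nat.bit1_bits, Nat.bit0_bits _ (by simp), incr, ih m (by lia)]

/-- Carry propagation as a left fold, with the carry and the reversed output as state; a final carry
becomes the top bit. -/
theorem incr_eq_foldl (l : List Bool) : ∀ (c : Bool) (acc : List Bool),
    (fun s : Bool × List Bool => (cond s.1 (true :: s.2) s.2).reverse)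
      (l.foldl (fun s b => (b && s.1, cond s.1 (!b) b :: s.2)) (c, acc))
      = acc.reverse ++ cond c (incr l) l := by
  induction l with
  | nil => intro c acc; cases c <;> simp [incr]
  | cons b l ih =>
    intro c acc
    rw [List.foldl_cons, ih]
    cases b <;> cases c <;> simp [incr]

theorem polyTime_incr : PolyTime incr := by
  have h : incr = fun l => (fun s : Bool × List Bool => (cond s.1 (true :: s.2) s.2).reverse)
      (l.foldl (fun s b => (b && s.1, cond s.1 (!b) b :: s.2)) (true, [])) := by
    funext l
    rw [incr_eq_foldl]
    simp
  rw [h]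
  refine PolyTime.comp (g := fun s : Bool × List Bool => (cond s.1 (true :: s.2) s.2).reverse)
    (by fun_prop) (PolyTime.foldl_of_add_le (f := fun _ s b => (b && s.1, cond s.1 (!b) b :: s.2))
      (by fun_prop) (by fun_prop) (by fun_prop) ⟨_, PolyBdd.const 8, ?_⟩)
  intro l s b _
  have h₁ := size_bool_le (b && s.1)
  have h₂ := size_bool_le (cond s.1 (!b) b)
  have h₃ := size_prod s
  simp only [size_pair, size_cons]
  lia

-- Counting up from zero takes `n` increments, which is polynomial because `n` is given in unary.
@[fun_prop]
theorem polyTime_bits {α : Type} [Coded α] {n : α → ℕ} (hn : PolyTime n) :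
    PolyTime fun a => (n a).bits := by
  have key : ∀ i : ℕ, incr^[i] [] = i.bits := by
    intro i
    induction i with
    | zero => simp
    | succ i ih => rw [Function.iterate_succ_apply', ih, bits_succ]
  have : PolyTime fun n : ℕ => incr^[n] [] := by
    refine PolyTime.iterate (f := fun _ l => incr l) (by fun_prop) (by fun_prop)
      (polyTime_incr.comp (by fun_prop))
      ⟨_, ((PolyBdd.size (α := ℕ)).mul (PolyBdd.const 4)).add (PolyBdd.const 1), ?_⟩
    intro n i hi
    rw [key]
    refine (size_list_le i.bits 3 fun b _ => size_bool_le b).trans ?_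
    have : i.bits.length ≤ i := by
      rw [Nat.size_eq_bits_len, Nat.size_le]
      exact Nat.lt_two_pow_self
    simp only [size_nat]
    lia
  simp only [key] at this
  exact this.comp hn

/-- The value of a number in binary, truncated at `N`. -/
def bitsValue (N : ℕ) (l : List Bool) : ℕ := l.foldr (fun b n => min N (n + n + cond b 1 0)) 0

theorem bitsValue_bits (N n : ℕ) (h : n ≤ N) : bitsValue N n.bits = n := by
  induction n using Nat.strong_induction_on with
  | _ n ih =>
    rcases Nat.even_or_odd' n with ⟨m, rfl | rfl⟩
    · rcases Nat.eq_zero_or_pos m with rfl | hm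
      · simp [bitsValue]
      · rw [Nat.bit0_bits m hm.ne']
        have := ih m (by lia) (by lia)
        simp only [bitsValue, List.foldr_cons] at this ⊢
        rw [this]
        simp; lia
    · rw [Nat.bit1_bits]
      have := ih m (by lia) (by lia)
      simp only [bitsValue, List.foldr_cons] at this ⊢
      rw [this]
      simp; lia

/-- Truncation at `N` keeps the accumulator small; without it the unary value would be exponential
in the number of bits. -/
theorem polyTime_bitsValue : PolyTime fun x : ℕ × List Bool => bitsValue x.1 x.2 := by
  refine PolyTime.foldr_of_add_le (l := fun x : ℕ × List Bool => x.2)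
    (f := fun x b n => min x.1 (n + n + cond b 1 0)) (by fun_prop)
    (by fun_prop) (by fun_prop) ⟨_, PolyBdd.size, ?_⟩
  rintro ⟨N, l⟩ n b _
  simp only [size_pair, size_nat]
  lia

/-! ### Encodings -/

/-- The concatenation of two encodings. -/
def encSeq {α β : Type} (e : α → List Letter) (e' : β → List Letter) (x : α × β) : List Letter :=
  e x.1 ++ e' x.2

/-- Entries, rules and instances in which all names are natural numbers. -/
abbrev NatEntry : Type := ℕ × ℕ × ℕ × List ℕ

/-- A rule: state, symbol, action, distribution. -/
abbrev NatRule : Type := ℕ × ℕ × ℕ × List NatEntry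

/-- An instance: numbers of states and symbols, widths of the actions, rules, configurations. -/
abbrev NatInst : Type := ℕ × ℕ × List ℕ × List NatRule × (ℕ × List ℕ) × (ℕ × List ℕ)

/-- The encoding of an entry. -/
def encNatEntry : NatEntry → List Letter :=
  encSeq encNat (encSeq encNat (encSeq encNat (encList encNat)))

/-- The encoding of a rule. -/
def encNatRule : NatRule → List Letter :=
  encSeq encNat (encSeq encNat (encSeq encNat (encList encNatEntry)))

/-- The encoding of an instance. -/
def encNatInst : NatInst → List Letter :=
  encSeq encUnary (encSeq encUnary (encSeq (encList encNat) (encSeq (encList encNatRule)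
    (encSeq (encSeq encNat (encList encNat)) (encSeq encNat (encList encNat))))))

section

variable {α β : Type} [Coded α] [Coded β]

theorem polyTime_encSeq {e : α → List Letter} {e' : β → List Letter} (he : PolyTime e)
    (he' : PolyTime e') : PolyTime (encSeq e e') := by
  unfold encSeq
  fun_prop

theorem polyTime_encList {e : α → List Letter} (he : PolyTime e) : PolyTime (encList e) := by
  unfold encList
  fun_prop

theorem polyTime_encUnary : PolyTime encUnary := by
  have : encUnary = fun n => (List.replicate n ()).map (fun _ => Letter.mark) ++ [Letter.close] :=
      by
    funext n; simp [encUnary]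
  rw [this]
  fun_prop

theorem polyTime_encNat : PolyTime encNat := by
  have : encNat = fun n => n.bits.map (fun b => cond b (Letter.bit true) (Letter.bit false))
      ++ [Letter.close] := by
    funext n
    rw [encNat]
    congr 2
    funext b
    cases b <;> rfl
  rw [this]
  fun_prop

theorem polyTime_encNatInst : PolyTime encNatInst := by
  have hN := polyTime_encNat
  have hU := polyTime_encUnary
  have hE : PolyTime encNatEntry :=
    polyTime_encSeq hN (polyTime_encSeq hN (polyTime_encSeq hN (polyTime_encList hN)))
  have hR : PolyTime encNatRule :=
    polyTime_encSeq hN (polyTime_encSeq hN (polyTime_encSeq hN (polyTime_encList hE)))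
  have hC := polyTime_encSeq hN (polyTime_encList hN)
  exact polyTime_encSeq hU (polyTime_encSeq hU (polyTime_encSeq (polyTime_encList hN)
    (polyTime_encSeq (polyTime_encList hR) (polyTime_encSeq hC hC))))

end

/-! ### Parsers -/

/-- A parser returns a value and the remaining word, and may use a bound on all numbers. This one
runs in polynomial time and does not lengthen the word. -/
structure IsParser {α : Type} [Coded α] (p : ℕ × List Letter → α × List Letter) : Prop where
  polyTime : PolyTime p
  rest_le : ∀ x, size (p x).2 ≤ size x.2

/-- The parser `p` inverts the encoding `e`, if the bound is large enough. -/
def Parses {α : Type} (p : ℕ × List Letter → α × List Letter) (e : α → List Letter) : Prop :=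
  ∀ N x rest, 2 ^ (e x ++ rest).length ≤ N → p (N, e x ++ rest) = (x, rest)

/-- Parse two parts. -/
def seqP {α β : Type} (p : ℕ × List Letter → α × List Letter) (q : ℕ × List Letter →
    β × List Letter) : ℕ × List Letter → (α × β) × List Letter := fun x =>
  (((p x).1, (q (x.1, (p x).2)).1), (q (x.1, (p x).2)).2)

/-- Parse items as long as the next letter passes a test, and then drop a letter. -/
def manyP {α : Type} (test : Letter → Bool) (p : ℕ × List Letter → α × List Letter) :
    ℕ × List Letter → List α × List Letter := fun x =>
  let r := (fun s : List α × List Letter =>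
    -- There are at most as many items as letters, and once the test fails the state stays fixed. An
    -- exhausted word behaves like a closing letter.
    cond (test (s.2.headD .close)) (s.1 ++ [(p (x.1, s.2)).1], (p (x.1, s.2)).2) s)^[x.2.length]
      ([], x.2)
  (r.1, r.2.tail)

/-- Parse a list. -/
def listP {α : Type} (p : ℕ × List Letter → α × List Letter) : ℕ × List Letter →
    List α × List Letter :=
  manyP (fun x => decide (x = .mark)) fun x => p (x.1, x.2.tail)

/-- Parse a number in unary. -/
def unaryP : ℕ × List Letter → ℕ × List Letter := fun x =>
  let r := listP (fun x => ((), x.2)) x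
  (r.1.length, r.2)

/-- Parse a sequence of bits. -/
def bitsP : ℕ × List Letter → List Bool × List Letter :=
  manyP (fun x => decide (x = .bit true) || decide (x = .bit false))
    (fun x => (decide (x.2.headD .close = .bit true), x.2.tail))

/-- Parse a number in binary. -/
def natP : ℕ × List Letter → ℕ × List Letter := fun x => (bitsValue x.1 (bitsP x).1, (bitsP x).2)

theorem size_tail_le {α : Type} [Coded α] (l : List α) : size l.tail ≤ size l :=
  size_le_of_sublist (List.tail_sublist l)

section

variable {α β : Type} [Coded α] [Coded β]

theorem IsParser.seqP {p : ℕ × List Letter → α × List Letter} {q : ℕ × List Letter →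
    β × List Letter} (hp : IsParser p) (hq : IsParser q) :
    IsParser (seqP p q) := by
  obtain ⟨hp₁, hp₂⟩ := hp
  obtain ⟨hq₁, hq₂⟩ := hq
  refine ⟨?_, fun x => (hq₂ _).trans (hp₂ x)⟩
  have h : PolyTime fun x : ℕ × List Letter => q (x.1, (p x).2) := hq₁.comp (by fun_prop)
  unfold PVPDA.seqP
  fun_prop

/-- The remaining word never grows, so each item has size polynomial in the original word, and the
list grows by at most that much per round. -/
theorem IsParser.manyP {test : Letter → Bool} (ht : PolyTime test) {p : ℕ × List Letter →
    α × List Letter}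
    (hp : IsParser p) : IsParser (manyP test p) := by
  obtain ⟨hp₁, hp₂⟩ := hp
  obtain ⟨k, hk⟩ := hp₁.size_bdd
  have key : ∀ (N : ℕ) (w : List Letter) (i : ℕ),
      let r := (fun s : List α × List Letter => cond (test (s.2.headD .close))
        (s.1 ++ [(p (N, s.2)).1], (p (N, s.2)).2) s)^[i] ([], w)
      size r.1 ≤ i * ((size (N, w) + 2) ^ k + 1) + 1 ∧ size r.2 ≤ size w := by
    intro N w i
    induction i with
    | zero => simp
    | succ i ih =>
      rw [Function.iterate_succ_apply']
      set r := (fun s : List α × List Letter => cond (test (s.2.headD .close))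
        (s.1 ++ [(p (N, s.2)).1], (p (N, s.2)).2) s)^[i] ([], w)
      simp only at ih ⊢
      cases test (r.2.headD .close)
      · simp only [cond_false]
        refine ⟨ih.1.trans ?_, ih.2⟩
        gcongr
        simp
      · simp only [cond_true]
        refine ⟨?_, (hp₂ _).trans ih.2⟩
        have h₁ := size_append r.1 [(p (N, r.2)).1]
        have h₂ := hk (N, r.2)
        have h₃ : (size (N, r.2) + 2) ^ k ≤ (size (N, w) + 2) ^ k := by
          refine Nat.pow_le_pow_left ?_ k
          simp only [size_pair]
          lia
        have h₄ := size_prod (p (N, r.2))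
        simp only [size_cons, size_nil] at h₁
        have := ih.1
        rw [Nat.add_mul]
        lia
  refine ⟨?_, ?_⟩
  · unfold PVPDA.manyP
    have h₁ : PolyTime fun y : (ℕ × List Letter) × List α × List Letter => p (y.1.1, y.2.2) :=
      hp₁.comp (by fun_prop)
    have h₂ : PolyTime fun y : (ℕ × List Letter) × List α × List Letter =>
      test (y.2.2.headD .close) := ht.comp (by fun_prop)
    have h : PolyTime fun x : ℕ × List Letter => (fun s : List α × List Letter =>
        cond (test (s.2.headD .close)) (s.1 ++ [(p (x.1, s.2)).1], (p (x.1, s.2)).2) s)^[x.2.length]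
        ([], x.2) := by
      refine PolyTime.iterate (f := fun (x : ℕ × List Letter) (s : List α × List Letter) =>
        cond (test (s.2.headD .close)) (s.1 ++ [(p (x.1, s.2)).1], (p (x.1, s.2)).2) s)
        (by fun_prop) (by fun_prop) (by fun_prop)
        ⟨fun x => size x * ((size x + 2) ^ k + 1) + 1 + size x + 1, ?_, ?_⟩
      · exact (((PolyBdd.size.mul (PolyBdd.add ⟨k, fun _ => le_rfl⟩ (PolyBdd.const 1))).add
          (PolyBdd.const 1)).add PolyBdd.size).add (PolyBdd.const 1)
      · rintro ⟨N, w⟩ i hi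
        have h := key N w i
        simp only at h hi ⊢
        rw [size_prod]
        have h₁ : i ≤ size (N, w) := by
          have := length_le_size w
          simp only [size_pair]
          lia
        have h₂ := Nat.mul_le_mul_right ((size (N, w) + 2) ^ k + 1) h₁
        have h₃ : size w ≤ size (N, w) := by simp only [size_pair]; lia
        lia
    fun_prop
  · rintro ⟨N, w⟩
    exact (size_tail_le _).trans (key N w w.length).2

theorem IsParser.listP {p : ℕ × List Letter → α × List Letter} (hp : IsParser p) : IsParser
    (listP p) :=
  IsParser.manyP (by fun_prop) ⟨hp.polyTime.comp (by fun_prop),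
    fun x => (hp.rest_le _).trans (size_tail_le _)⟩

end

theorem isParser_unaryP : IsParser unaryP := by
  have h : IsParser fun x : ℕ × List Letter => ((), x.2) := ⟨by fun_prop, fun x => le_rfl⟩
  have hl := h.listP
  refine ⟨?_, fun x => hl.rest_le x⟩
  have := hl.polyTime
  unfold unaryP
  fun_prop

theorem isParser_natP : IsParser natP := by
  have h : IsParser fun x : ℕ × List Letter => (decide (x.2.headD .close = .bit true), x.2.tail) :=
    ⟨by fun_prop, fun x => size_tail_le _⟩
  have hm : IsParser bitsP := IsParser.manyP (by fun_prop) h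
  refine ⟨?_, fun x => hm.rest_le x⟩
  have h₁ := hm.polyTime
  have h₂ := polyTime_bitsValue
  unfold natP
  exact (h₂.comp (f := fun x : ℕ × List Letter => (x.1, (bitsP x).1)) (by fun_prop)).prodMk
    (by fun_prop)

/-- Parse an instance. -/
def instP : ℕ × List Letter → NatInst × List Letter :=
  let entryP : ℕ × List Letter → NatEntry × List Letter := seqP natP (seqP natP (seqP natP
      (listP natP)))
  let ruleP : ℕ × List Letter → NatRule × List Letter := seqP natP (seqP natP (seqP natP
      (listP entryP)))
  let configP : ℕ × List Letter → (ℕ × List ℕ) × List Letter := seqP natP (listP natP)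
  seqP unaryP (seqP unaryP (seqP (listP natP) (seqP (listP ruleP) (seqP configP configP))))

theorem isParser_instP : IsParser instP := by
  have hN := isParser_natP
  have hU := isParser_unaryP
  have hE := hN.seqP (hN.seqP (hN.seqP hN.listP))
  have hR := hN.seqP (hN.seqP (hN.seqP hE.listP))
  have hC := hN.seqP hN.listP
  exact hU.seqP (hU.seqP (hN.listP.seqP (hR.listP.seqP (hC.seqP hC))))

theorem Parses.seqP {α β : Type} {p : ℕ × List Letter → α × List Letter} {q : ℕ × List Letter →
    β × List Letter} {e : α → List Letter}
    {e' : β → List Letter} (hp : Parses p e) (hq : Parses q e') :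
    Parses (seqP p q) (encSeq e e') := by
  rintro N ⟨a, b⟩ rest h
  simp only [encSeq, List.append_assoc] at h ⊢
  have h₁ := hp N a _ h
  have h₂ := hq N b rest ((Nat.pow_le_pow_right (by simp) (by simp)).trans h)
  simp [PVPDA.seqP, h₁, h₂]

/-- Items have nonempty encodings, so the number of rounds suffices to reach the closing letter; the
superfluous rounds do nothing (`hfix`). -/
theorem manyP_eq {α : Type} {test : Letter → Bool} {p : ℕ × List Letter → α × List Letter} {e : α →
    List Letter}
    (N : ℕ) (he : ∀ x, e x ≠ []) (ht : ∀ x rest, test ((e x ++ rest).headD .close) = true)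
    (hc : test .close = false)
    (hp : ∀ x rest, 2 ^ (e x ++ rest).length ≤ N → p (N, e x ++ rest) = (x, rest))
    (l : List α) (rest : List Letter) (hN : 2 ^ (l.flatMap e ++ .close :: rest).length ≤ N) :
    manyP test p (N, l.flatMap e ++ .close :: rest) = (l, rest) := by
  set step := fun s : List α × List Letter => cond (test (s.2.headD .close))
      (s.1 ++ [(p (N, s.2)).1], (p (N, s.2)).2) s with hstep
  have hfix : ∀ (i : ℕ) (acc : List α), step^[i] (acc, .close :: rest) = (acc, .close :: rest) := by
    intro i acc
    induction i with
    | zero => rfl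
    | succ i ih => rw [Function.iterate_succ_apply', ih]; simp [hstep, hc]
  have key : ∀ (l acc : List α) (i : ℕ), l.length ≤ i →
      2 ^ (l.flatMap e ++ .close :: rest).length ≤ N →
      step^[i] (acc, l.flatMap e ++ .close :: rest) = (acc ++ l, .close :: rest) := by
    intro l
    induction l with
    | nil => intro acc i _ _; simpa using hfix i acc
    | cons x l ih =>
      intro acc i hi hN
      obtain ⟨i, rfl⟩ : ∃ j, i = j + 1 := ⟨i - 1, by simp at hi; lia⟩
      simp only [List.flatMap_cons, List.append_assoc] at hN ⊢
      rw [Function.iterate_succ_apply]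
      have h₁ : step (acc, e x ++ (l.flatMap e ++ .close :: rest))
          = (acc ++ [x], l.flatMap e ++ .close :: rest) := by
        simp only [hstep, ht, cond_true, hp _ _ hN]
      rw [h₁, ih _ i (by simpa using hi) ((Nat.pow_le_pow_right (by simp) (by simp)).trans hN)]
      simp
  have hl : l.length ≤ (l.flatMap e ++ .close :: rest).length := by
    have : l.length ≤ (l.flatMap e).length := by
      clear hN
      induction l with
      | nil => simp
      | cons x l ih =>
        have := List.length_pos_of_ne_nil (he x)
        simp only [List.flatMap_cons, List.length_append, List.length_cons]
        lia
    simp only [List.length_append]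
    lia
  have h := key l [] _ hl hN
  simp only [PVPDA.manyP]
  rw [← hstep, h]
  simp

theorem Parses.listP {α : Type} {p : ℕ × List Letter → α × List Letter} {e : α → List Letter} (hp :
    Parses p e) :
    Parses (listP p) (encList e) := by
  intro N l rest h
  simp only [encList, List.append_assoc, List.singleton_append] at h ⊢
  refine manyP_eq (e := fun x => Letter.mark :: e x) N (by simp) (by simp) (by simp) ?_ l rest h
  intro x rest h
  exact hp N x rest ((Nat.pow_le_pow_right (by simp) (by simp)).trans h)

theorem parses_unaryP : Parses unaryP encUnary := by
  have h : Parses (fun x => ((), x.2)) (fun _ : Unit => []) := fun N x rest _ => rfl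
  intro N n rest hN
  have e : encUnary n = encList (fun _ : Unit => []) (List.replicate n ()) := by
    simp only [encUnary, encList]
    congr 1
    clear hN
    induction n with
    | zero => rfl
    | succ n ih => simp [List.replicate_succ, ih]
  rw [e] at hN ⊢
  simp [unaryP, h.listP N _ rest hN]

theorem parses_natP : Parses natP encNat := by
  intro N n rest hN
  have e : encNat n ++ rest = n.bits.flatMap (fun b => [Letter.bit b]) ++ .close :: rest := by
    rw [encNat, List.map_eq_flatMap]
    simp
  -- `n` is less than two to the number of its bits, so the hypothesis on `N` prevents truncation.
  have hn : n ≤ N := by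
    refine le_trans ?_ hN
    have h₁ : n < 2 ^ n.size := Nat.lt_size_self n
    refine h₁.le.trans (Nat.pow_le_pow_right (by simp) ?_)
    rw [← Nat.size_eq_bits_len]
    simp [encNat]
  rw [e] at hN ⊢
  have h := manyP_eq (test := fun x => decide (x = .bit true) || decide (x = .bit false))
    (p := fun x => (decide (x.2.headD .close = .bit true), x.2.tail)) (e := fun b => [Letter.bit b])
    N (by simp) (by intro b; cases b <;> simp) (by simp)
    (by intro b rest _; cases b <;> simp) n.bits rest hN
  unfold natP bitsP
  rw [h]
  simp [bitsValue_bits N n hn]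

theorem parses_instP : Parses instP encNatInst := by
  have hN := parses_natP
  have hU := parses_unaryP
  have hE : Parses _ encNatEntry := hN.seqP (hN.seqP (hN.seqP hN.listP))
  have hR : Parses _ encNatRule := hN.seqP (hN.seqP (hN.seqP hE.listP))
  have hC := hN.seqP hN.listP
  exact hU.seqP (hU.seqP (hN.listP.seqP (hR.listP.seqP (hC.seqP hC))))

end PVPDA

/-! ### The decision procedure and its running time. -/

namespace PVPDA

open StackProg

/-! ### The decision procedure -/

/-- Membership in a list. -/
def elemTest {α : Type} [DecidableEq α] (a : α) (l : List α) : Bool := l.any fun b => decide (a = b)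

@[simp] theorem elemTest_eq_true {α : Type} [DecidableEq α] (a : α) (l : List α) :
    elemTest a l = true ↔ a ∈ l := by
  simp [elemTest]

/-- The sublists of a list, provided that there are at most `N`. -/
def subsets {α : Type} (N : ℕ) (l : List α) : List (List α) :=
  l.foldr (fun a s => cond (decide ((s ++ s.map fun t => a :: t).length ≤ N))
    (s ++ s.map fun t => a :: t) []) [[]]

/-- The sum of the probabilities of the entries, as numerator and denominator, truncated at `N`. -/
def fracSum (N : ℕ) (l : List NatEntry) : ℕ × ℕ :=
  l.foldr (fun e s => (min N (s.1 * e.2.1 + e.1 * s.2), min N (s.2 * e.2.1))) (0, 1)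

/-- Compare the total probabilities of two lists of entries. -/
def fracLe (N : ℕ) (l l' : List NatEntry) : Bool :=
  decide ((fracSum N l).1 * (fracSum N l').2 ≤ (fracSum N l').1 * (fracSum N l).2)

/-- A tuple `(X, Y, B, p, q)` of a table. -/
abbrev Tup : Type := ℕ × ℕ × List (ℕ × ℕ) × ℕ × ℕ

/-- The pairs of states that a table relates. -/
def lookup (ps : List (ℕ × ℕ)) (T : List Tup) (X Y : ℕ) (B : List (ℕ × ℕ)) : List (ℕ × ℕ) :=
  ps.filter fun x => elemTest (X, Y, B, x) T

/-- The relation between targets of rules that is prescribed by a table. -/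
def targetRel (ps : List (ℕ × ℕ)) (T : List Tup) (B : List (ℕ × ℕ)) (x y : ℕ × List ℕ) : Bool :=
  (decide (x.2.length = 0) && decide (y.2.length = 0) && elemTest (x.1, y.1) B) ||
  (decide (x.2.length = 1) && decide (y.2.length = 1) &&
    elemTest (x.2.headD 0, y.2.headD 0, B, x.1, y.1) T) ||
  (decide (x.2.length = 2) && decide (y.2.length = 2) &&
    elemTest (x.2.headD 0, y.2.headD 0,
      lookup ps T (x.2.tail.headD 0) (y.2.tail.headD 0) B, x.1, y.1) T)

/-- Test whether two distributions are related by the lifting. -/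
def liftTest (N : ℕ) (ps : List (ℕ × ℕ)) (T : List Tup) (B : List (ℕ × ℕ)) (l l' : List NatEntry) :
    Bool :=
  (subsets N l).all fun u => fracLe N u (l'.filter fun e' => u.any fun e =>
    targetRel ps T B e.2.2 e'.2.2)

/-- Test whether a rule has a given state and topmost symbol. -/
def applies (p X : ℕ) (r : NatRule) : Bool := decide (r.1 = p) && decide (r.2.1 = X)

/-- One step of the refinement, for a single tuple. -/
def refineTest (N : ℕ) (rs : List NatRule) (ps : List (ℕ × ℕ)) (T : List Tup) (t : Tup) : Bool :=
  (rs.all fun r => !applies t.2.2.2.1 t.1 r || rs.any fun r' =>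
    applies t.2.2.2.2 t.2.1 r' && (decide (r'.2.2.1 = r.2.2.1) &&
      liftTest N ps T t.2.2.1 r.2.2.2 r'.2.2.2)) &&
  (rs.all fun r' => !applies t.2.2.2.2 t.2.1 r' || rs.any fun r =>
    applies t.2.2.2.1 t.1 r && (decide (r.2.2.1 = r'.2.2.1) &&
      liftTest N ps T t.2.2.1 r.2.2.2 r'.2.2.2))

/-- All pairs of states. -/
def pairs (n : ℕ) : List (ℕ × ℕ) :=
  (List.range n).flatMap fun p => (List.range n).map fun q => (p, q)

/-- All tuples. -/
def allTuples (N n m : ℕ) : List Tup :=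
  (List.range m).flatMap fun X => (List.range m).flatMap fun Y =>
    (subsets N (pairs n)).flatMap fun B => (pairs n).map fun x => (X, Y, B, x)

/-- The greatest table, for `n` states and `m` symbols. -/
def tableOf (N n m : ℕ) (rs : List NatRule) : List Tup :=
  -- A round that is not yet stationary loses a tuple, so the number of tuples is a sufficient
  -- number of rounds.
  (fun T => (allTuples N n m).filter fun t => refineTest N rs
      (pairs n) T t)^[(allTuples N n m).length]
    (allTuples N n m)

/-- The pairs of corresponding symbols of two stacks, from bottom to top. -/
def revZip (α β : List ℕ) : List (ℕ × ℕ) :=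
  (α.foldl (fun s X => (s.1.tail, cond s.1.isEmpty s.2 ((X, s.1.headD 0) :: s.2))) (β, [])).2

/-- Test whether no rule applies. -/
def stuckTest (rs : List NatRule) (p X : ℕ) : Bool := rs.all fun r => !applies p X r

/-- The related states if only the longer stack is left. -/
def bottomRel (n : ℕ) (rs : List NatRule) (α β : List ℕ) : List (ℕ × ℕ) :=
  (pairs n).filter fun x =>
    -- Stacks are aligned at their tops, so these are the lower remainders. Only the first symbol of
    -- a remainder matters: the opposite stack is empty there and allows no move.
    ((α.drop β.length).isEmpty || stuckTest rs x.1 ((α.drop β.length).headD 0)) &&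
    ((β.drop α.length).isEmpty || stuckTest rs x.2 ((β.drop α.length).headD 0))

/-- The states related on two stacks. -/
def stackRelOf (n : ℕ) (rs : List NatRule) (T : List Tup) (α β : List ℕ) : List (ℕ × ℕ) :=
  (revZip α β).foldl (fun B x => lookup (pairs n) T x.1 x.2 B) (bottomRel n rs α β)

/-- Test whether two configurations are bisimilar. -/
def bisimTest (N : ℕ) (x : NatInst) : Bool :=
  elemTest (x.2.2.2.2.1.1, x.2.2.2.2.2.1) (stackRelOf x.1 x.2.2.2.1
    (tableOf N x.1 x.2.1 x.2.2.2.1) x.2.2.2.2.1.2 x.2.2.2.2.2.2)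

/-- Test whether a configuration is one of an automaton with `n` states and `m` symbols. -/
def configTest (n m : ℕ) (c : ℕ × List ℕ) : Bool :=
  decide (c.1 < n) && c.2.all fun X => decide (X < m)

/-- Test whether all names are in range. -/
def wfTest (x : NatInst) : Bool :=
  (x.2.2.1.all fun k => decide (k ≤ 2)) &&
  ((x.2.2.2.1.all fun r => decide (r.1 < x.1) && (decide (r.2.1 < x.2.1) &&
    (decide (r.2.2.1 < x.2.2.1.length) && r.2.2.2.all fun e => decide (0 < e.2.1) &&
      (configTest x.1 x.2.1 e.2.2 && decide (e.2.2.2.length ≤ 2))))) &&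
  (configTest x.1 x.2.1 x.2.2.2.2.1 && configTest x.1 x.2.1 x.2.2.2.2.2))

/-- Test whether the rules are those of a visibly pushdown automaton. -/
def visiblyTest (N : ℕ) (x : NatInst) : Bool :=
  x.2.2.2.1.all fun r => decide ((fracSum N r.2.2.2).1 = (fracSum N r.2.2.2).2) &&
    r.2.2.2.all fun e => decide (e.1 = 0) ||
      -- Dropping and taking the head is indexing; the default `0` is not reached if `wfTest`
      -- succeeds.
      decide (e.2.2.2.length = (x.2.2.1.drop r.2.2.1).headD 0)

/-- Test whether all distributions are Dirac. -/
def diracTest (x : NatInst) : Bool :=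
  x.2.2.2.1.all fun r => r.2.2.2.all fun e => r.2.2.2.all fun e' =>
    decide (e.1 = 0) || (decide (e'.1 = 0) || decide (e.2.2 = e'.2.2))

/-- The decision procedure for probabilistic visibly pushdown automata. -/
def decidePv (y : List Letter × ℕ) : Bool :=
  -- The parser returns a value on every word; encoding that value again and comparing recognises
  -- the genuine encodings.
  decide (encNatInst (instP (y.2, y.1)).1 = y.1) && (wfTest (instP (y.2, y.1)).1 &&
    (visiblyTest y.2 (instP (y.2, y.1)).1 && bisimTest y.2 (instP (y.2, y.1)).1))

/-- The decision procedure for visibly pushdown automata. -/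
def decideV (y : List Letter × ℕ) : Bool :=
  decidePv y && diracTest (instP (y.2, y.1)).1

/-! ### The decision procedure runs in polynomial time -/

theorem subsets_cons {β : Type} (N : ℕ) (a : β) (l : List β) : subsets N (a :: l) =
    cond (decide ((subsets N l ++ (subsets N l).map fun t => a :: t).length ≤ N))
      (subsets N l ++ (subsets N l).map fun t => a :: t) [] := rfl

/-- The summand `1` accounts for the empty list, whose only sublist is not tested against `N`. -/
theorem length_subsets_le {β : Type} (N : ℕ) (l : List β) : (subsets N l).length ≤ N + 1 := by
  cases l with
  | nil => simp [subsets]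
  | cons a l =>
    rw [subsets_cons]
    by_cases h : (subsets N l ++ (subsets N l).map fun t => a :: t).length ≤ N
    · simp only [h, decide_true, cond_true]
      lia
    · simp only [h, decide_false, cond_false, List.length_nil]
      lia

theorem sublist_of_mem_subsets {β : Type} {N : ℕ} {l t : List β} (h : t ∈ subsets N l) :
    t.Sublist l := by
  induction l generalizing t with
  | nil => simp [subsets] at h; simp [h]
  | cons a l ih =>
    rw [subsets_cons] at h
    by_cases hN : (subsets N l ++ (subsets N l).map fun t => a :: t).length ≤ N
    · simp only [hN, decide_true, cond_true, List.mem_append, List.mem_map] at h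
      rcases h with h | ⟨u, hu, rfl⟩
      · exact (ih h).cons a
      · exact (ih hu).cons_cons a
    · simp only [hN, decide_false, cond_false, List.not_mem_nil] at h

section

variable {α β : Type} [Coded α] [Coded β]

@[fun_prop]
theorem polyTime_elemTest [DecidableEq β] {b : α → β} {l : α → List β} (hb : PolyTime b)
    (hl : PolyTime l) : PolyTime fun a => elemTest (b a) (l a) := by
  unfold elemTest
  fun_prop

-- The state may double at each step, so additive growth is not available. The bound comes from the
-- truncation: at most `N a + 1` members, each a sublist of `l a`.
@[fun_prop]
theorem polyTime_subsets {N : α → ℕ} {l : α → List β} (hN : PolyTime N) (hl : PolyTime l) :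
    PolyTime fun a => subsets (N a) (l a) := by
  have e : (fun a => subsets (N a) (l a)) = fun a => (l a).reverse.foldl
      (fun s b => cond (decide ((s ++ s.map fun t => b :: t).length ≤ N a))
        (s ++ s.map fun t => b :: t) []) [[]] := by
    funext a
    rw [List.foldl_reverse, subsets]
  rw [e]
  refine PolyTime.foldl (f := fun a (s : List (List β)) (b : β) => cond (decide ((s ++
      s.map fun t => b :: t).length ≤ N a))
    (s ++ s.map fun t => b :: t) []) (by fun_prop) (by fun_prop) (by fun_prop)
    ⟨_, ((hN.size_bdd.add (PolyBdd.const 1)).mul (hl.size_bdd.add (PolyBdd.const 1))).add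
      (PolyBdd.const 1), ?_⟩
  intro a l₁ l₂ h
  have e' : l₁.foldl (fun s b => cond (decide ((s ++ s.map fun t => b :: t).length ≤ N a))
      (s ++ s.map fun t => b :: t) []) [[]] = subsets (N a) l₁.reverse := by
    rw [subsets, List.foldr_reverse]
  rw [e']
  have hs : l₁.reverse.Sublist (l a) := by
    rw [← List.reverse_reverse (l a), h, List.reverse_append]
    exact List.sublist_append_right _ _
  refine (size_list_le _ (size (l a)) fun t ht =>
    size_le_of_sublist ((sublist_of_mem_subsets ht).trans hs)).trans ?_
  have := length_subsets_le (N a) l₁.reverse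
  gcongr
  simp
  lia

@[fun_prop]
theorem polyTime_fracSum {N : α → ℕ} {l : α → List NatEntry} (hN : PolyTime N) (hl : PolyTime l) :
    PolyTime fun a => fracSum (N a) (l a) := by
  unfold fracSum
  refine PolyTime.foldr_of_add_le (f := fun a (e : NatEntry) (s : ℕ × ℕ) => (min (N a)
      (s.1 * e.2.1 + e.1 * s.2),
    min (N a) (s.2 * e.2.1))) hl (by fun_prop) (by fun_prop)
    ⟨_, ((hN.size_bdd.add hN.size_bdd).add (PolyBdd.const 1)), ?_⟩
  intro a s e _
  simp only [size_pair, size_nat]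
  lia

@[fun_prop]
theorem polyTime_fracLe {N : α → ℕ} {l l' : α → List NatEntry} (hN : PolyTime N) (hl : PolyTime l)
    (hl' : PolyTime l') : PolyTime fun a => fracLe (N a) (l a) (l' a) := by
  unfold fracLe
  fun_prop

@[fun_prop]
theorem polyTime_lookup {ps : α → List (ℕ × ℕ)} {T : α → List Tup} {X Y : α → ℕ}
    {B : α → List (ℕ × ℕ)} (hps : PolyTime ps) (hT : PolyTime T) (hX : PolyTime X)
    (hY : PolyTime Y) (hB : PolyTime B) :
    PolyTime fun a => lookup (ps a) (T a) (X a) (Y a) (B a) := by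
  unfold lookup
  fun_prop

@[fun_prop]
theorem polyTime_targetRel {ps : α → List (ℕ × ℕ)} {T : α → List Tup} {B : α → List (ℕ × ℕ)}
    {x y : α → ℕ × List ℕ} (hps : PolyTime ps) (hT : PolyTime T) (hB : PolyTime B)
    (hx : PolyTime x) (hy : PolyTime y) :
    PolyTime fun a => targetRel (ps a) (T a) (B a) (x a) (y a) := by
  unfold targetRel
  fun_prop

@[fun_prop]
theorem polyTime_liftTest {N : α → ℕ} {ps : α → List (ℕ × ℕ)} {T : α → List Tup}
    {B : α → List (ℕ × ℕ)} {l l' : α → List NatEntry} (hN : PolyTime N) (hps : PolyTime ps)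
    (hT : PolyTime T) (hB : PolyTime B) (hl : PolyTime l) (hl' : PolyTime l') :
    PolyTime fun a => liftTest (N a) (ps a) (T a) (B a) (l a) (l' a) := by
  unfold liftTest
  fun_prop

@[fun_prop]
theorem polyTime_applies {p X : α → ℕ} {r : α → NatRule} (hp : PolyTime p) (hX : PolyTime X)
    (hr : PolyTime r) : PolyTime fun a => applies (p a) (X a) (r a) := by
  unfold applies
  fun_prop

@[fun_prop]
theorem polyTime_refineTest {N : α → ℕ} {rs : α → List NatRule} {ps : α → List (ℕ × ℕ)}
    {T : α → List Tup} {t : α → Tup} (hN : PolyTime N) (hrs : PolyTime rs) (hps : PolyTime ps)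
    (hT : PolyTime T) (ht : PolyTime t) :
    PolyTime fun a => refineTest (N a) (rs a) (ps a) (T a) (t a) := by
  unfold refineTest
  fun_prop

@[fun_prop]
theorem polyTime_pairs {n : α → ℕ} (hn : PolyTime n) : PolyTime fun a => pairs (n a) := by
  unfold pairs
  fun_prop

@[fun_prop]
theorem polyTime_allTuples {N n m : α → ℕ} (hN : PolyTime N) (hn : PolyTime n) (hm : PolyTime m) :
    PolyTime fun a => allTuples (N a) (n a) (m a) := by
  unfold allTuples
  fun_prop

-- Every iterate is a sublist of the list of all tuples, which bounds its size.
@[fun_prop]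
theorem polyTime_tableOf {N n m : α → ℕ} {rs : α → List NatRule} (hN : PolyTime N)
    (hn : PolyTime n) (hm : PolyTime m) (hrs : PolyTime rs) :
    PolyTime fun a => tableOf (N a) (n a) (m a) (rs a) := by
  unfold tableOf
  have hu : PolyTime fun a => allTuples (N a) (n a) (m a) := by fun_prop
  refine PolyTime.iterate (f := fun a T => (allTuples (N a) (n a) (m a)).filter fun t =>
    refineTest (N a) (rs a) (pairs (n a)) T t) (by fun_prop) hu (by fun_prop) ⟨_, hu.size_bdd, ?_⟩
  intro a i _
  cases i with
  | zero => exact le_rfl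
  | succ i =>
    rw [Function.iterate_succ_apply']
    exact size_le_of_sublist List.filter_sublist

@[fun_prop]
theorem polyTime_revZip {l l' : α → List ℕ} (hl : PolyTime l) (hl' : PolyTime l') :
    PolyTime fun a => revZip (l a) (l' a) := by
  unfold revZip
  refine (PolyTime.foldl_of_add_le (f := fun _ (s : List ℕ × List (ℕ × ℕ)) (X : ℕ) =>
    (s.1.tail, cond s.1.isEmpty s.2 ((X, s.1.headD 0) :: s.2))) hl (by fun_prop) (by fun_prop)
    ⟨_, hl.size_bdd.add (PolyBdd.const 10), ?_⟩).snd
  rintro a ⟨s, t⟩ X hX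
  have := size_le_of_mem hX
  cases s with
  | nil => simp
  | cons Y s =>
    simp at this ⊢
    lia

@[fun_prop]
theorem polyTime_stuckTest {rs : α → List NatRule} {p X : α → ℕ} (hrs : PolyTime rs)
    (hp : PolyTime p) (hX : PolyTime X) : PolyTime fun a => stuckTest (rs a) (p a) (X a) := by
  unfold stuckTest
  fun_prop

@[fun_prop]
theorem polyTime_bottomRel {n : α → ℕ} {rs : α → List NatRule} {l l' : α → List ℕ}
    (hn : PolyTime n) (hrs : PolyTime rs) (hl : PolyTime l) (hl' : PolyTime l') :
    PolyTime fun a => bottomRel (n a) (rs a) (l a) (l' a) := by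
  unfold bottomRel
  fun_prop

@[fun_prop]
theorem polyTime_stackRelOf {n : α → ℕ} {rs : α → List NatRule} {T : α → List Tup}
    {l l' : α → List ℕ} (hn : PolyTime n) (hrs : PolyTime rs) (hT : PolyTime T) (hl : PolyTime l)
    (hl' : PolyTime l') : PolyTime fun a => stackRelOf (n a) (rs a) (T a) (l a) (l' a) := by
  unfold stackRelOf
  refine PolyTime.foldl_of_le (f := fun a B (x : ℕ × ℕ) => lookup (pairs (n a)) (T a) x.1 x.2 B)
      (by fun_prop)
    (by fun_prop) (by fun_prop) ⟨_, (polyTime_pairs hn).size_bdd, ?_⟩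
  intro a B x _
  exact size_le_of_sublist List.filter_sublist

@[fun_prop]
theorem polyTime_bisimTest {N : α → ℕ} {x : α → NatInst} (hN : PolyTime N) (hx : PolyTime x) :
    PolyTime fun a => bisimTest (N a) (x a) := by
  unfold bisimTest
  fun_prop

@[fun_prop]
theorem polyTime_configTest {n m : α → ℕ} {c : α → ℕ × List ℕ} (hn : PolyTime n) (hm : PolyTime m)
    (hc : PolyTime c) : PolyTime fun a => configTest (n a) (m a) (c a) := by
  unfold configTest
  fun_prop

@[fun_prop]
theorem polyTime_wfTest {x : α → NatInst} (hx : PolyTime x) : PolyTime fun a => wfTest (x a) := by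
  unfold wfTest
  fun_prop

@[fun_prop]
theorem polyTime_visiblyTest {N : α → ℕ} {x : α → NatInst} (hN : PolyTime N) (hx : PolyTime x) :
    PolyTime fun a => visiblyTest (N a) (x a) := by
  unfold visiblyTest
  fun_prop

@[fun_prop]
theorem polyTime_diracTest {x : α → NatInst} (hx : PolyTime x) :
    PolyTime fun a => diracTest (x a) := by
  unfold diracTest
  fun_prop

end

theorem polyTime_decidePv : PolyTime decidePv := by
  have h₁ : PolyTime fun y : List Letter × ℕ => (instP (y.2, y.1)).1 :=
    PolyTime.fst'.comp (isParser_instP.polyTime.comp (by fun_prop))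
  have h₂ := polyTime_encNatInst.comp h₁
  unfold decidePv
  fun_prop

theorem polyTime_decideV : PolyTime decideV := by
  have h₁ : PolyTime fun y : List Letter × ℕ => (instP (y.2, y.1)).1 :=
    PolyTime.fst'.comp (isParser_instP.polyTime.comp (by fun_prop))
  have h₂ := polyTime_decidePv
  unfold decideV
  fun_prop

end PVPDA

/-! ### Instances as data, numerical bounds, and sums of probabilities. -/

namespace PVPDA

/-! ### Instances and their versions with natural numbers -/

section

variable {nQ nΓ nA : ℕ}

/-- The target of an entry, with natural numbers as names. -/
def natTarget (x : Fin nQ × ShortWord (Fin nΓ)) : ℕ × List ℕ := (x.1.val, x.2.1.map Fin.val)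

/-- An entry, with natural numbers as names. -/
def Entry.toNat (e : Entry nQ nΓ) : NatEntry := (e.num, e.den, natTarget e.target)

/-- A rule, with natural numbers as names. -/
def RawRule.toNat (r : RawRule nQ nΓ nA) : NatRule :=
  (r.state.val, r.top.val, r.action.val, r.dist.map Entry.toNat)

/-- An instance, with natural numbers as names. -/
def Instance.toNat (I : Instance) : NatInst :=
  (I.numStates, I.numSymbols, I.kinds.map StackKind.width, I.rules.map RawRule.toNat,
    (I.left.1.val, I.left.2.map Fin.val), (I.right.1.val, I.right.2.map Fin.val))

theorem natTarget_injective :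
    Function.Injective (natTarget : Fin nQ × ShortWord (Fin nΓ) → ℕ × List ℕ) := by
  rintro ⟨p, u, hu⟩ ⟨q, v, hv⟩ h
  simp only [natTarget, Prod.mk.injEq] at h
  obtain ⟨h₁, h₂⟩ := h
  have h₃ := List.map_injective_iff.2 Fin.val_injective h₂
  have h₄ := Fin.val_injective h₁
  subst h₃ h₄
  rfl

theorem encList_map {α β : Type} (f : β → List Letter) (g : α → β) (l : List α) :
    encList f (l.map g) = encList (fun x => f (g x)) l := by
  simp [encList, List.flatMap_map]

theorem encNatEntry_toNat (e : Entry nQ nΓ) : encNatEntry e.toNat = encEntry e := by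
  simp [encNatEntry, encSeq, Entry.toNat, natTarget, encEntry, encWord, encList_map]

theorem encNatRule_toNat (r : RawRule nQ nΓ nA) : encNatRule r.toNat = encRule r := by
  simp [encNatRule, encSeq, RawRule.toNat, encRule, encList_map, encNatEntry_toNat]

theorem encNatInst_toNat (I : Instance) : encNatInst I.toNat = I.encode := by
  simp [encNatInst, encSeq, Instance.toNat, Instance.encode, encConfig, encWord, encList_map,
    encNatRule_toNat]

theorem configTest_iff {n m : ℕ} {c : ℕ × List ℕ} : configTest n m c = true ↔
    ∃ c' : Config (Fin n) (Fin m), (c'.1.val, c'.2.map Fin.val) = c := by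
  constructor
  · intro h
    simp only [configTest, Bool.and_eq_true, decide_eq_true_eq, List.all_eq_true] at h
    have : c.2 ∈ Set.range (List.map (Fin.val : Fin m → ℕ)) := by
      rw [Set.range_list_map]
      exact fun x hx => ⟨⟨x, h.2 x hx⟩, rfl⟩
    obtain ⟨l, hl⟩ := this
    exact ⟨(⟨c.1, h.1⟩, l), by simp [hl]⟩
  · rintro ⟨c', rfl⟩
    simp [configTest]

theorem exists_map_eq_iff {α β : Type} (f : α → β) (l : List β) :
    (∃ l' : List α, l'.map f = l) ↔ ∀ y ∈ l, ∃ x, f x = y := by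
  change l ∈ Set.range (List.map f) ↔ _
  rw [Set.range_list_map]
  rfl

theorem exists_entry_iff {e : NatEntry} : (decide (0 < e.2.1) &&
    (configTest nQ nΓ e.2.2 && decide (e.2.2.2.length ≤ 2))) = true ↔
      ∃ e' : Entry nQ nΓ, e'.toNat = e := by
  simp only [Bool.and_eq_true, decide_eq_true_eq, configTest_iff]
  constructor
  · rintro ⟨h₁, ⟨c, hc⟩, h₂⟩
    refine ⟨⟨e.1, ⟨e.2.1, h₁⟩, c.1, c.2, ?_⟩, ?_⟩
    · rw [← hc] at h₂
      simpa using h₂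
    · simp [Entry.toNat, natTarget, hc]
  · rintro ⟨e', rfl⟩
    exact ⟨e'.den.pos, ⟨(e'.target.1, e'.target.2.1), rfl⟩, by
      simpa [Entry.toNat, natTarget] using e'.target.2.2⟩

theorem exists_rule_iff {r : NatRule} : (decide (r.1 < nQ) && (decide (r.2.1 < nΓ) &&
    (decide (r.2.2.1 < nA) && r.2.2.2.all fun e => decide (0 < e.2.1) &&
      (configTest nQ nΓ e.2.2 && decide (e.2.2.2.length ≤ 2))))) = true ↔
      ∃ r' : RawRule nQ nΓ nA, r'.toNat = r := by
  rw [Bool.and_eq_true, Bool.and_eq_true, Bool.and_eq_true, List.all_eq_true]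
  simp only [exists_entry_iff, decide_eq_true_eq]
  rw [← exists_map_eq_iff]
  constructor
  · rintro ⟨h₁, h₂, h₃, l, hl⟩
    exact ⟨⟨⟨_, h₁⟩, ⟨_, h₂⟩, ⟨_, h₃⟩, l⟩, by simp [RawRule.toNat, hl]⟩
  · rintro ⟨r', rfl⟩
    exact ⟨r'.state.2, r'.top.2, r'.action.2, r'.dist, rfl⟩

theorem wfTest_iff {x : NatInst} : wfTest x = true ↔ ∃ I : Instance, I.toNat = x := by
  unfold wfTest
  rw [Bool.and_eq_true, Bool.and_eq_true, Bool.and_eq_true, List.all_eq_true, List.all_eq_true]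
  simp only [exists_rule_iff, configTest_iff, decide_eq_true_eq]
  rw [← exists_map_eq_iff]
  constructor
  · rintro ⟨h₁, ⟨l, hl⟩, ⟨c, hc⟩, ⟨c', hc'⟩⟩
    obtain ⟨kinds, hk⟩ : ∃ ks : List StackKind, ks.map StackKind.width = x.2.2.1 := by
      rw [exists_map_eq_iff]
      intro k hk
      have := h₁ k hk
      interval_cases k
      exacts [⟨.ret, rfl⟩, ⟨.int, rfl⟩, ⟨.call, rfl⟩]
    obtain ⟨n, m, ks, rs, c₁, c₂⟩ := x
    simp only at hk hl hc hc'
    subst hk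
    -- The rules in `l` have as many actions as the list of widths is long; the cast identifies this
    -- number with `kinds.length`.
    refine ⟨⟨n, m, kinds, l.map fun r =>
      ⟨r.state, r.top, Fin.cast (by simp) r.action, r.dist⟩, c, c'⟩, ?_⟩
    simp only [Instance.toNat, ← hl, hc, hc', List.map_map]
    rfl
  · rintro ⟨I, rfl⟩
    refine ⟨?_, ⟨I.rules.map fun r =>
      ⟨r.state, r.top, Fin.cast (by simp [Instance.toNat]) r.action, r.dist⟩, ?_⟩,
      ⟨I.left, rfl⟩, ⟨I.right, rfl⟩⟩
    · intro k hk
      simp only [Instance.toNat, List.mem_map] at hk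
      obtain ⟨k, -, rfl⟩ := hk
      cases k <;> simp [StackKind.width]
    · simp only [Instance.toNat, List.map_map]
      rfl

end

/-! ### Bounds by the length of the encoding -/

/-- A bound for the numerators and denominators of the partial sums. -/
def fracBound (l : List NatEntry) : ℕ := (l.map fun e => e.1 + e.2.1).prod

theorem length_le_encList {α : Type} (f : α → List Letter) (l : List α) :
    l.length ≤ (encList f l).length := by
  have : l.length ≤ (l.flatMap fun x => Letter.mark :: f x).length := by
    induction l with
    | nil => simp
    | cons x l ih => simp only [List.flatMap_cons, List.length_append, List.length_cons]; lia
  simp only [encList, List.length_append]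
  lia

theorem length_le_encList_of_mem {α : Type} (f : α → List Letter) {l : List α} {x : α}
    (h : x ∈ l) : (f x).length ≤ (encList f l).length := by
  induction l with
  | nil => simp at h
  | cons y l ih =>
    simp only [encList, List.flatMap_cons, List.length_append, List.length_cons,
      List.mem_cons] at h ih ⊢
    rcases h with rfl | h
    · lia
    · have := ih h
      lia

theorem lt_two_pow_length_encNat (n : ℕ) : n < 2 ^ (encNat n).length := by
  refine (Nat.lt_size_self n).trans_le (Nat.pow_le_pow_right (by simp) ?_)
  rw [← Nat.size_eq_bits_len]
  simp [encNat]

/-- Each factor is a sum of two numbers below the powers of two given by the lengths of their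
encodings, hence at most the product of these powers; lengths add up as factors multiply. -/
theorem fracBound_le (l : List NatEntry) : fracBound l ≤ 2 ^ (encList encNatEntry l).length := by
  have : fracBound l ≤ 2 ^ (l.flatMap fun x => Letter.mark :: encNatEntry x).length := by
    induction l with
    | nil => simp [fracBound]
    | cons e l ih =>
      have e₁ : fracBound (e :: l) = (e.1 + e.2.1) * fracBound l := by simp [fracBound]
      rw [e₁, List.flatMap_cons, List.length_append, pow_add]
      refine Nat.mul_le_mul ?_ ih
      have h₁ := lt_two_pow_length_encNat e.1
      have h₂ := lt_two_pow_length_encNat e.2.1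
      have h₃ : 2 ^ ((encNat e.1).length + (encNat e.2.1).length) ≤
          2 ^ (Letter.mark :: encNatEntry e).length := by
        refine Nat.pow_le_pow_right (by simp) ?_
        simp only [encNatEntry, encSeq, List.length_cons, List.length_append]
        lia
      refine le_trans ?_ h₃
      rw [pow_add]
      nlinarith
  refine this.trans (Nat.pow_le_pow_right (by simp) ?_)
  simp [encList]

/-- The number `N` exceeds all the numbers that occur in the tests for `I`. -/
structure Instance.Bounded (I : Instance) (N : ℕ) : Prop where
  states : 2 ^ (I.numStates * I.numStates) ≤ N
  entries : ∀ r ∈ I.rules, 2 ^ r.dist.length ≤ N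
  frac : ∀ r ∈ I.rules, fracBound (r.dist.map Entry.toNat) ≤ N

/-- In the exponent, the square pays for the relations between states, and the linear term for
sublists of entries and for fractions. -/
theorem Instance.bounded (I : Instance) :
    I.Bounded (2 ^ (I.encode.length * I.encode.length + I.encode.length)) := by
  have h₁ : I.numStates ≤ I.encode.length := by
    simp only [Instance.encode, encUnary, List.length_append, List.length_replicate]
    lia
  have h₂ : ∀ r ∈ I.rules, (encList encEntry r.dist).length ≤ I.encode.length := by
    intro r hr
    have h := length_le_encList_of_mem encRule hr
    simp only [encRule, Instance.encode, List.length_append] at h ⊢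
    lia
  refine ⟨Nat.pow_le_pow_right (by simp) ?_, fun r hr => Nat.pow_le_pow_right (by simp) ?_,
    fun r hr => (fracBound_le _).trans (Nat.pow_le_pow_right (by simp) ?_)⟩
  · exact (Nat.mul_le_mul h₁ h₁).trans (Nat.le_add_right _ _)
  · have := length_le_encList encEntry r.dist
    have := h₂ r hr
    lia
  · have := h₂ r hr
    simp only [encList_map, encNatEntry_toNat]
    exact this.trans (Nat.le_add_left _ _)

/-! ### Sums of probabilities -/

theorem mem_subsets_iff {α : Type} {N : ℕ} {l u : List α} (h : 2 ^ l.length ≤ N) :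
    u ∈ subsets N l ↔ u.Sublist l := by
  refine ⟨sublist_of_mem_subsets, ?_⟩
  have key : ∀ l : List α, 2 ^ l.length ≤ N →
      (subsets N l).length = 2 ^ l.length ∧ ∀ u, u.Sublist l → u ∈ subsets N l := by
    intro l
    induction l with
    | nil => intro _; simp [subsets]
    | cons a l ih =>
      intro hN
      rw [List.length_cons, pow_succ] at hN
      obtain ⟨ih₁, ih₂⟩ := ih (by lia)
      have hl : (subsets N l ++ (subsets N l).map fun t => a :: t).length = 2 ^ l.length * 2 := by
        simp [ih₁, mul_two]
      have e : subsets N (a :: l) = subsets N l ++ (subsets N l).map fun t => a :: t := by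
        have : (subsets N l ++ (subsets N l).map fun t => a :: t).length ≤ N := hl ▸ hN
        rw [subsets_cons]
        simp only [this, decide_true, cond_true]
      rw [e]
      refine ⟨by rw [hl, List.length_cons, pow_succ], fun u hu => ?_⟩
      rw [List.mem_append, List.mem_map]
      cases hu with
      | cons _ hu => exact Or.inl (ih₂ _ hu)
      | cons_cons _ hu => exact Or.inr ⟨_, ih₂ _ hu, rfl⟩
  exact (key l h).2 u

/-- The total probability of a list of entries. -/
noncomputable def natWeight (l : List NatEntry) : ℝ≥0 :=
  (l.map fun e => (e.1 : ℝ≥0) / (e.2.1 : ℝ≥0)).sum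

/-- The invariant bounds the sum of the unreduced numerator and denominator by the product of all
`num + den`. This sum is submultiplicative under addition of fractions, so `min` never takes effect.
-/
theorem fracSum_spec {N : ℕ} {l : List NatEntry} (hl : ∀ e ∈ l, 0 < e.2.1)
    (hN : fracBound l ≤ N) : (fracSum N l).1 + (fracSum N l).2 ≤ fracBound l ∧
      0 < (fracSum N l).2 ∧ ((fracSum N l).1 : ℝ≥0) / (fracSum N l).2 = natWeight l := by
  induction l with
  | nil => simp [fracSum, fracBound, natWeight]
  | cons e l ih =>
    have e₁ : fracBound (e :: l) = (e.1 + e.2.1) * fracBound l := by simp [fracBound]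
    have he := hl e (by simp)
    rw [e₁] at hN ⊢
    obtain ⟨h₁, h₂, h₃⟩ := ih (fun e' h => hl e' (by simp [h])) (by nlinarith)
    have e₂ : fracSum N (e :: l) = (min N ((fracSum N l).1 * e.2.1 + e.1 * (fracSum N l).2),
      min N ((fracSum N l).2 * e.2.1)) := rfl
    have h₄ : (fracSum N l).1 * e.2.1 + e.1 * (fracSum N l).2 + (fracSum N l).2 * e.2.1 ≤
        (e.1 + e.2.1) * fracBound l := by nlinarith
    have h₅ : 0 < (fracSum N l).2 * e.2.1 := by positivity
    rw [e₂, min_eq_right (by lia), min_eq_right (by lia)]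
    refine ⟨h₄, h₅, ?_⟩
    have e₃ : natWeight (e :: l) = (e.1 : ℝ≥0) / (e.2.1 : ℝ≥0) + natWeight l := by simp [natWeight]
    rw [e₃, ← h₃]
    have : ((fracSum N l).2 : ℝ≥0) ≠ 0 := by exact_mod_cast h₂.ne'
    have : (e.2.1 : ℝ≥0) ≠ 0 := by exact_mod_cast he.ne'
    push_cast
    field_simp
    ring

theorem fracSum_eq_iff {N : ℕ} {l : List NatEntry} (hl : ∀ e ∈ l, 0 < e.2.1)
    (hN : fracBound l ≤ N) : (fracSum N l).1 = (fracSum N l).2 ↔ natWeight l = 1 := by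
  obtain ⟨-, h₂, h₃⟩ := fracSum_spec hl hN
  rw [← h₃, div_eq_one_iff_eq (by exact_mod_cast h₂.ne')]
  norm_cast

theorem fracLe_iff {N : ℕ} {l l' : List NatEntry} (hl : ∀ e ∈ l, 0 < e.2.1)
    (hN : fracBound l ≤ N) (hl' : ∀ e ∈ l', 0 < e.2.1) (hN' : fracBound l' ≤ N) :
    fracLe N l l' = true ↔ natWeight l ≤ natWeight l' := by
  obtain ⟨-, h₂, h₃⟩ := fracSum_spec hl hN
  obtain ⟨-, h₂', h₃'⟩ := fracSum_spec hl' hN'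
  rw [← h₃, ← h₃', div_le_div_iff₀ (by exact_mod_cast h₂) (by exact_mod_cast h₂'), fracLe,
    decide_eq_true_eq]
  norm_cast

/-- Positive denominators make every omitted factor at least one. -/
theorem fracBound_le_of_sublist {l l' : List NatEntry} (h : l.Sublist l')
    (hl' : ∀ e ∈ l', 0 < e.2.1) : fracBound l ≤ fracBound l' := by
  induction h with
  | slnil => rfl
  | @cons l l' e h ih =>
    have e₁ : fracBound (e :: l') = (e.1 + e.2.1) * fracBound l' := by simp [fracBound]
    have := hl' e (by simp)
    have := ih fun e' h => hl' e' (by simp [h])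
    rw [e₁]
    nlinarith
  | @cons_cons l l' e h ih =>
    have e₁ : ∀ l, fracBound (e :: l) = (e.1 + e.2.1) * fracBound l := by simp [fracBound]
    rw [e₁, e₁]
    exact Nat.mul_le_mul_left _ (ih fun e' h => hl' e' (by simp [h]))

section

variable {nQ nΓ : ℕ}

theorem coe_natWeight (l : List (Entry nQ nΓ)) :
    ((natWeight (l.map Entry.toNat) : ℝ≥0) : ℝ≥0∞) = (l.map Entry.weight).sum := by
  induction l with
  | nil => simp [natWeight]
  | cons e l ih =>
    have : natWeight ((e :: l).map Entry.toNat) =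
      (e.num : ℝ≥0) / ((e.den : ℕ) : ℝ≥0) + natWeight (l.map Entry.toNat) := by
      simp [natWeight, Entry.toNat]
    rw [this, ENNReal.coe_add, ih, List.map_cons, List.sum_cons, Entry.weight,
      ENNReal.coe_div (by exact_mod_cast e.den.ne_zero)]
    simp

theorem den_pos (l : List (Entry nQ nΓ)) : ∀ e ∈ l.map Entry.toNat, 0 < e.2.1 := by
  intro e he
  obtain ⟨e, -, rfl⟩ := List.mem_map.1 he
  exact e.den.pos

theorem Entry.weight_eq_zero_iff (e : Entry nQ nΓ) : e.weight = 0 ↔ e.num = 0 := by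
  simp [Entry.weight, ENNReal.div_eq_zero_iff]

open Classical in
theorem tsum_indicator_entries (l : List (Entry nQ nΓ)) (U : Set (Fin nQ × ShortWord (Fin nΓ))) :
    ∑' x, U.indicator (fun x => (l.map fun e => if e.target = x then e.weight else 0).sum) x =
      ((l.filter fun e => decide (e.target ∈ U)).map Entry.weight).sum := by
  induction l with
  | nil => simp
  | cons e l ih =>
    have : ∀ x, U.indicator (fun x => ((e :: l).map fun e =>
        if e.target = x then e.weight else 0).sum) x =
        (if x = e.target then U.indicator (fun _ => e.weight) e.target else 0) +
        U.indicator (fun x => (l.map fun e => if e.target = x then e.weight else 0).sum) x := by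
      intro x
      by_cases hx : x ∈ U
      · by_cases h : x = e.target
        · subst h; simp [hx]
        · simp [hx, h, Ne.symm h]
      · by_cases h : x = e.target
        · subst h; simp [hx]
        · simp [hx, h]
    simp only [this]
    rw [ENNReal.tsum_add, tsum_ite_eq, ih, List.filter_cons]
    by_cases h : e.target ∈ U <;> simp [h]

open Classical in
theorem PresentsDist.toOuterMeasure_apply {l : List (Entry nQ nΓ)}
    {d : PMF (Fin nQ × ShortWord (Fin nΓ))} (h : PresentsDist l d)
    (U : Set (Fin nQ × ShortWord (Fin nΓ))) : d.toOuterMeasure U =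
      ((l.filter fun e => decide (e.target ∈ U)).map Entry.weight).sum := by
  rw [PMF.toOuterMeasure_apply, ← tsum_indicator_entries]
  congr 1
  funext x
  congr 1
  funext x
  convert h x

theorem PresentsDist.unique {l : List (Entry nQ nΓ)} {d d' : PMF (Fin nQ × ShortWord (Fin nΓ))}
    (h : PresentsDist l d) (h' : PresentsDist l d') : d = d' :=
  PMF.ext fun x => (h x).trans (h' x).symm

theorem exists_presentsDist_iff (l : List (Entry nQ nΓ)) :
    (∃ d, PresentsDist l d) ↔ (l.map Entry.weight).sum = 1 := by
  classical
  have key := tsum_indicator_entries l Set.univ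
  simp only [Set.indicator_univ, Set.mem_univ, decide_true, List.filter_true] at key
  constructor
  · rintro ⟨d, hd⟩
    rw [← d.tsum_coe, ← key]
    congr 1
    funext x
    rw [hd x]
  · intro h
    refine ⟨⟨fun x => (l.map fun e => if e.target = x then e.weight else 0).sum, ?_⟩, ?_⟩
    · rw [← h, ← key]
      exact ENNReal.summable.hasSum
    · intro x
      change (l.map fun e => if e.target = x then e.weight else 0).sum = _
      congr!

theorem PresentsDist.mem_support_iff {l : List (Entry nQ nΓ)}
    {d : PMF (Fin nQ × ShortWord (Fin nΓ))} (h : PresentsDist l d)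
    (x : Fin nQ × ShortWord (Fin nΓ)) :
    x ∈ d.support ↔ ∃ e ∈ l, e.num ≠ 0 ∧ e.target = x := by
  rw [PMF.mem_support_iff, h x, Ne, List.sum_eq_zero_iff]
  simp only [List.mem_map, forall_exists_index, and_imp, forall_apply_eq_imp_iff₂, ite_eq_right_iff,
    Entry.weight_eq_zero_iff]
  push Not
  exact exists_congr fun e => and_congr_right fun _ => and_comm

theorem PresentsDist.rational {l : List (Entry nQ nΓ)}
    {d : PMF (Fin nQ × ShortWord (Fin nΓ))} (h : PresentsDist l d)
    (x : Fin nQ × ShortWord (Fin nΓ)) : ∃ r : ℚ≥0, d x = ((r : ℝ≥0) : ℝ≥0∞) := by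
  rw [h x]
  clear h
  induction l with
  | nil => exact ⟨0, by simp⟩
  | cons e l ih =>
    obtain ⟨r, hr⟩ := ih
    rw [List.map_cons, List.sum_cons, hr]
    split_ifs
    · refine ⟨(e.num : ℚ≥0) / ((e.den : ℕ) : ℚ≥0) + r, ?_⟩
      rw [Entry.weight, NNRat.cast_add, ENNReal.coe_add, NNRat.cast_div, NNRat.cast_natCast,
        NNRat.cast_natCast, ENNReal.coe_div (by exact_mod_cast e.den.ne_zero), ENNReal.coe_natCast,
        ENNReal.coe_natCast]
    · exact ⟨r, by simp⟩

theorem PresentsDist.exists_eq_pure_iff {l : List (Entry nQ nΓ)}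
    {d : PMF (Fin nQ × ShortWord (Fin nΓ))} (h : PresentsDist l d) :
    (∃ x, d = PMF.pure x) ↔
      ∀ e ∈ l, ∀ e' ∈ l, e.num = 0 ∨ e'.num = 0 ∨ e.target = e'.target := by
  constructor
  · rintro ⟨x, rfl⟩ e he e' he'
    by_contra! hc
    have h₁ := (h.mem_support_iff e.target).2 ⟨e, he, hc.1, rfl⟩
    have h₂ := (h.mem_support_iff e'.target).2 ⟨e', he', hc.2.1, rfl⟩
    simp only [PMF.support_pure, Set.mem_singleton_iff] at h₁ h₂
    exact hc.2.2 (h₁.trans h₂.symm)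
  · intro hl
    obtain ⟨x, hx⟩ := d.support_nonempty
    have hs : d.support = {x} := by
      refine Set.eq_singleton_iff_unique_mem.2 ⟨hx, fun y hy => ?_⟩
      obtain ⟨e, he, h₁, rfl⟩ := (h.mem_support_iff x).1 hx
      obtain ⟨e', he', h₂, rfl⟩ := (h.mem_support_iff y).1 hy
      rcases hl e he e' he' with h | h | h
      exacts [absurd h h₁, absurd h h₂, h.symm]
    refine ⟨x, PMF.ext fun y => ?_⟩
    classical
    rw [PMF.pure_apply]
    split_ifs with hy
    · rw [hy, PMF.apply_eq_one_iff, hs]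
    · rw [PMF.apply_eq_zero_iff, hs]
      exact hy

theorem sum_weight_le_of_sublist {l l' : List (Entry nQ nΓ)} (h : l.Sublist l') :
    (l.map Entry.weight).sum ≤ (l'.map Entry.weight).sum :=
  (h.map _).sum_le_sum fun _ _ => zero_le

/-- The lifting of a relation, tested on sublists of the presentations. -/
theorem lift_iff_sublist {l l' : List (Entry nQ nΓ)} {d d' : PMF (Fin nQ × ShortWord (Fin nΓ))}
    (h : PresentsDist l d) (h' : PresentsDist l' d')
    (R : Fin nQ × ShortWord (Fin nΓ) → Fin nQ × ShortWord (Fin nΓ) → Prop)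
    (r : Entry nQ nΓ → Entry nQ nΓ → Bool) (hr : ∀ e e', r e e' = true ↔ R e.target e'.target) :
    Lift R d d' ↔ ∀ u : List (Entry nQ nΓ), u.Sublist l → (u.map Entry.weight).sum ≤
      ((l'.filter fun e' => u.any fun e => r e e').map Entry.weight).sum := by
  classical
  constructor
  · intro hR u hu
    obtain ⟨U, hU⟩ : ∃ U : Set (Fin nQ × ShortWord (Fin nΓ)), ∀ x, x ∈ U ↔ ∃ e ∈ u, e.target = x :=
      ⟨{x | ∃ e ∈ u, e.target = x}, fun _ => Iff.rfl⟩
    have := hR U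
    rw [h.toOuterMeasure_apply, h'.toOuterMeasure_apply] at this
    -- Several entries can share a target, so `u` may be a proper sublist of the entries with target
    -- in `U`.
    have h₁ : u.Sublist (l.filter fun e => decide (e.target ∈ U)) := by
      have := hu.filter fun e => decide (e.target ∈ U)
      rwa [List.filter_eq_self.2] at this
      intro e he
      simpa [hU] using ⟨e, he, rfl⟩
    refine (sum_weight_le_of_sublist h₁).trans (this.trans (le_of_eq ?_))
    congr 2
    refine List.filter_congr fun e' _ => ?_
    rw [Bool.eq_iff_iff]
    simp [hr, hU]
  · intro hu U
    rw [h.toOuterMeasure_apply, h'.toOuterMeasure_apply]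
    -- For a given `U`, the sublist to test consists of all entries with target in `U`.
    refine (hu _ List.filter_sublist).trans (sum_weight_le_of_sublist ?_)
    refine List.monotone_filter_right _ fun e' he' => ?_
    simp only [List.any_filter, List.any_eq_true, Bool.and_eq_true, decide_eq_true_eq, hr] at he' ⊢
    obtain ⟨e, -, he, hR⟩ := he'
    exact ⟨_, he, hR⟩

theorem liftTest_iff {N : ℕ} {ps : List (ℕ × ℕ)} {T : List Tup} {B : List (ℕ × ℕ)}
    {l l' : List (Entry nQ nΓ)} {d d' : PMF (Fin nQ × ShortWord (Fin nΓ))}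
    (h : PresentsDist l d) (h' : PresentsDist l' d') (hl : 2 ^ l.length ≤ N)
    (hN : fracBound (l.map Entry.toNat) ≤ N) (hN' : fracBound (l'.map Entry.toNat) ≤ N)
    (R : Fin nQ × ShortWord (Fin nΓ) → Fin nQ × ShortWord (Fin nΓ) → Prop)
    (hR : ∀ x y, targetRel ps T B (natTarget x) (natTarget y) = true ↔ R x y) :
    liftTest N ps T B (l.map Entry.toNat) (l'.map Entry.toNat) = true ↔ Lift R d d' := by
  rw [lift_iff_sublist h h' R (fun e e' => targetRel ps T B e.toNat.2.2 e'.toNat.2.2)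
    fun e e' => hR _ _]
  simp only [liftTest, List.all_eq_true]
  have key : ∀ u : List (Entry nQ nΓ), u.Sublist l → (fracLe N (u.map Entry.toNat)
      ((l'.map Entry.toNat).filter fun e' =>
      (u.map Entry.toNat).any fun e => targetRel ps T B e.2.2 e'.2.2) = true ↔
      (u.map Entry.weight).sum ≤ ((l'.filter fun e' => u.any fun e =>
        targetRel ps T B e.toNat.2.2 e'.toNat.2.2).map Entry.weight).sum) := by
    intro u hu
    have e₁ : (l'.map Entry.toNat).filter (fun e' =>
        (u.map Entry.toNat).any fun e => targetRel ps T B e.2.2 e'.2.2) =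
        (l'.filter fun e' => u.any fun e =>
          targetRel ps T B e.toNat.2.2 e'.toNat.2.2).map Entry.toNat := by
      rw [List.filter_map]
      simp only [List.any_map]
      rfl
    rw [e₁, fracLe_iff (den_pos _) _ (den_pos _) _, ← ENNReal.coe_le_coe, coe_natWeight,
      coe_natWeight]
    · exact (fracBound_le_of_sublist (hu.map _) (den_pos _)).trans hN
    · exact (fracBound_le_of_sublist (List.filter_sublist.map _) (den_pos _)).trans hN'
  constructor
  · intro H u hu
    exact (key u hu).1 (H _ ((mem_subsets_iff (by simpa using hl)).2 (hu.map _)))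
  · intro H u hu
    obtain ⟨v, hv, rfl⟩ := List.sublist_map_iff.1 ((mem_subsets_iff (by simpa using hl)).1 hu)
    exact (key v hv).2 (H v hv)

end

end PVPDA

/-! ### Correctness of the decision procedure. -/

namespace PVPDA

/-! ### The approximations of the table become stationary -/

/-- The approximations form a decreasing chain of subsets of a finite set, and a chain that pauses
once is stationary from then on. Instability at `k` would thus mean strict decrease at every `j ≤
k`, more often than the cardinality permits. -/
theorem PPDA.approx_stable {Q Γ A : Type} [Finite Q] [Finite Γ] [Finite A] (D : PPDA Q Γ A) (k : ℕ)
    (hk : Nat.card (Γ × Γ × (Q → Q → Prop) × Q × Q) ≤ k) : D.approx (k + 1) = D.approx k := by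
  by_contra hne
  set F : ℕ → Set (Γ × Γ × (Q → Q → Prop) × Q × Q) := fun j =>
    {v | D.approx j v.1 v.2.1 v.2.2.1 v.2.2.2.1 v.2.2.2.2} with hF
  have hlt : ∀ j ≤ k, (F (j + 1)).ncard < (F j).ncard := by
    intro j hj
    refine Set.ncard_lt_ncard ?_ (Set.toFinite _)
    have hsub : F (j + 1) ⊆ F j := fun v hv => D.approx_antitone j _ _ _ _ _ hv
    refine hsub.ssubset_of_ne fun he => hne ?_
    have hj' : D.approx (j + 1) = D.approx j := by
      funext X Y B p q
      have := Set.ext_iff.1 he (X, Y, B, p, q)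
      exact propext this
    obtain ⟨i, rfl⟩ := Nat.exists_eq_add_of_le hj
    clear hne hk hj
    induction i with
    | zero => exact hj'
    | succ i ih =>
      rw [← add_assoc, PPDA.approx_succ, ih, ← PPDA.approx_succ, ih]
  have key : ∀ j ≤ k + 1, (F j).ncard + j ≤ Nat.card (Γ × Γ × (Q → Q → Prop) × Q × Q) := by
    intro j
    induction j with
    | zero => intro _; exact Set.ncard_le_card _
    | succ j ih =>
      intro hj
      have := hlt j (by lia)
      have := ih (by lia)
      lia
  have := key (k + 1) le_rfl
  lia

/-! ### Relations and tables as lists -/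

theorem mem_pairs {n : ℕ} {x : ℕ × ℕ} : x ∈ pairs n ↔ ∃ p q : Fin n, (p.val, q.val) = x := by
  obtain ⟨p, q⟩ := x
  simp only [pairs, List.mem_flatMap, List.mem_range, List.mem_map, Prod.mk.injEq]
  constructor
  · rintro ⟨p', hp, q', hq, rfl, rfl⟩
    exact ⟨⟨p', hp⟩, ⟨q', hq⟩, rfl, rfl⟩
  · rintro ⟨p', q', rfl, rfl⟩
    exact ⟨p', p'.2, q', q'.2, rfl, rfl⟩

theorem length_pairs (n : ℕ) : (pairs n).length = n * n := by
  simp [pairs, List.length_flatMap]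

open Classical in
/-- The list of the pairs in a relation. -/
noncomputable def relList {n : ℕ} (B : Fin n → Fin n → Prop) : List (ℕ × ℕ) :=
  (pairs n).filter fun x => decide (∃ p q : Fin n, B p q ∧ (p.val, q.val) = x)

theorem mem_relList {n : ℕ} {B : Fin n → Fin n → Prop} {p q : Fin n} :
    (p.val, q.val) ∈ relList B ↔ B p q := by
  simp only [relList, List.mem_filter, mem_pairs, decide_eq_true_eq, Prod.mk.injEq,
    Fin.val_inj]
  constructor
  · rintro ⟨-, p', q', h, rfl, rfl⟩
    exact h
  · intro h
    exact ⟨⟨p, q, rfl, rfl⟩, p, q, h, rfl, rfl⟩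

theorem relList_injective {n : ℕ} :
    Function.Injective (relList : (Fin n → Fin n → Prop) → List (ℕ × ℕ)) := by
  intro B B' h
  funext p q
  rw [← @mem_relList n B, ← @mem_relList n B', h]

/-- Each relation has a canonical list, obtained by filtering `pairs n` in its fixed order. Equal
relations therefore give identical lists, and a lookup in a table may compare lists literally. -/
theorem filter_pairs_eq_relList {n : ℕ} {f : ℕ × ℕ → Bool} {B : Fin n → Fin n → Prop}
    (h : ∀ p q : Fin n, f (p.val, q.val) = true ↔ B p q) : (pairs n).filter f = relList B := by
  classical
  refine List.filter_congr fun x hx => ?_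
  obtain ⟨p, q, rfl⟩ := mem_pairs.1 hx
  rw [Bool.eq_iff_iff, h, decide_eq_true_eq]
  simp only [Prod.mk.injEq, Fin.val_inj]
  constructor
  · exact fun h => ⟨p, q, h, rfl, rfl⟩
  · rintro ⟨p', q', h, rfl, rfl⟩
    exact h

/-- The table that is given by a list of tuples. -/
def tableRel (n m : ℕ) (T : List Tup) : Table (Fin n) (Fin m) := fun X Y B p q =>
  (X.val, Y.val, relList B, p.val, q.val) ∈ T

theorem lookup_relList {n m : ℕ} (T : List Tup) (X Y : Fin m) (B : Fin n → Fin n → Prop) :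
    lookup (pairs n) T X Y (relList B) = relList (tableRel n m T X Y B) :=
  filter_pairs_eq_relList fun p q => by simp [tableRel]

theorem targetRel_iff {n m : ℕ} (T : List Tup) (B : Fin n → Fin n → Prop)
    (x y : Fin n × ShortWord (Fin m)) :
    targetRel (pairs n) T (relList B) (natTarget x) (natTarget y) = true ↔
      (tableRel n m T).Rel B (x.1, x.2.1) (y.1, y.2.1) := by
  rcases x with ⟨p, u, hu⟩
  rcases y with ⟨q, v, hv⟩
  rcases u with _ | ⟨X, _ | ⟨X', _ | ⟨X'', u⟩⟩⟩ <;> rcases v with _ | ⟨Y, _ | ⟨Y', _ |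
      ⟨Y'', v⟩⟩⟩ <;>
    simp at hu hv <;>
    simp [targetRel, natTarget, Table.Rel, mem_relList, tableRel, lookup_relList]

theorem mem_allTuples {N n m : ℕ} (hN : 2 ^ (n * n) ≤ N) (X Y : Fin m) (B : Fin n → Fin n → Prop)
    (p q : Fin n) : (X.val, Y.val, relList B, p.val, q.val) ∈ allTuples N n m := by
  simp only [allTuples, List.mem_flatMap, List.mem_map, List.mem_range]
  exact ⟨X, X.2, Y, Y.2, relList B, (mem_subsets_iff (by rwa [length_pairs])).2 List.filter_sublist,
    (p.val, q.val), mem_pairs.2 ⟨p, q, rfl⟩, rfl⟩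

/-- Connects the number of rounds in `tableOf` with the bound in `PPDA.approx_stable`. -/
theorem card_le_length_allTuples {N n m : ℕ} (hN : 2 ^ (n * n) ≤ N) :
    Nat.card (Fin m × Fin m × (Fin n → Fin n → Prop) × Fin n × Fin n) ≤
      (allTuples N n m).length := by
  have : Function.Injective fun v : Fin m × Fin m × (Fin n → Fin n → Prop) × Fin n × Fin n =>
      (⟨(v.1.val, v.2.1.val, relList v.2.2.1, v.2.2.2.1.val, v.2.2.2.2.val),
        List.mem_toFinset.2 (mem_allTuples hN _ _ _ _ _)⟩ : (allTuples N n m).toFinset) := by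
    rintro ⟨X, Y, B, p, q⟩ ⟨X', Y', B', p', q'⟩ h
    simp only [Subtype.mk.injEq, Prod.mk.injEq, Fin.val_inj] at h
    obtain ⟨rfl, rfl, h, rfl, rfl⟩ := h
    rw [relList_injective h]
  refine (Nat.card_le_card_of_injective _ this).trans ?_
  rw [Nat.card_eq_fintype_card, Fintype.card_coe]
  exact List.toFinset_card_le _

/-! ### Correctness of the tests -/

section

variable {I : Instance} {D : PvPDA (Fin I.numStates) (Fin I.numSymbols) (Fin I.kinds.length)}

theorem applies_iff {nQ nΓ nA : ℕ} (p : Fin nQ) (X : Fin nΓ) (r : RawRule nQ nΓ nA) :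
    applies p X r.toNat = true ↔ r.state = p ∧ r.top = X := by
  simp [applies, RawRule.toNat, Fin.val_inj]

theorem stuckTest_iff (h : I.Presents D) (p : Fin I.numStates) (X : Fin I.numSymbols) :
    stuckTest (I.rules.map RawRule.toNat) p X = true ↔ D.Stuck p X := by
  rw [stuckTest, List.all_map, List.all_eq_true]
  simp only [Function.comp, Bool.not_eq_true', ← Bool.not_eq_true, applies_iff]
  constructor
  · intro H a d hd
    obtain ⟨r, hr, h₁, h₂, -⟩ := h.2.2 _ _ _ _ hd
    exact H r hr ⟨h₁, h₂⟩
  · rintro H r hr ⟨rfl, rfl⟩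
    obtain ⟨d, hd, -⟩ := h.2.1 r hr
    exact H _ _ hd

/-- The test `t` and the relation `R` are left open so that both halves of the transfer condition
are instances, the second with the roles of the two sides exchanged. -/
theorem transferTest_iff (h : I.Presents D) (p q : Fin I.numStates) (X Y : Fin I.numSymbols)
    (R : PMF (Fin I.numStates × ShortWord (Fin I.numSymbols)) →
      PMF (Fin I.numStates × ShortWord (Fin I.numSymbols)) → Prop)
    (t : NatRule → NatRule → Bool)
    (ht : ∀ r ∈ I.rules, ∀ r' ∈ I.rules, ∀ d d', PresentsDist r.dist d → PresentsDist r'.dist d' →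
      (t r.toNat r'.toNat = true ↔ R d d')) :
    ((I.rules.map RawRule.toNat).all fun r => !applies p X r ||
      (I.rules.map RawRule.toNat).any fun r' => applies q Y r' &&
        (decide (r'.2.2.1 = r.2.2.1) && t r r')) = true ↔
    ∀ a d, (p, X, a, d) ∈ D.rules → ∃ d', (q, Y, a, d') ∈ D.rules ∧ R d d' := by
  simp only [List.all_map, List.any_map, List.all_eq_true, List.any_eq_true, Function.comp,
    Bool.or_eq_true, Bool.and_eq_true, Bool.not_eq_true', ← Bool.not_eq_true, applies_iff,
    decide_eq_true_eq, ← imp_iff_not_or]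
  constructor
  · intro H a d hd
    obtain ⟨r, hr, h₁, h₂, rfl, hrd⟩ := h.2.2 _ _ _ _ hd
    obtain ⟨r', hr', ⟨rfl, rfl⟩, h₃, h₄⟩ := H r hr ⟨h₁, h₂⟩
    obtain ⟨d', hd', hrd'⟩ := h.2.1 r' hr'
    have e : r'.action = r.action := Fin.val_injective h₃
    exact ⟨d', e ▸ hd', (ht r hr r' hr' d d' hrd hrd').1 h₄⟩
  · rintro H r hr ⟨rfl, rfl⟩
    obtain ⟨d, hd, hrd⟩ := h.2.1 r hr
    obtain ⟨d', hd', hR⟩ := H _ _ hd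
    obtain ⟨r', hr', h₁, h₂, h₃, hrd'⟩ := h.2.2 _ _ _ _ hd'
    exact ⟨r', hr', ⟨h₁, h₂⟩, congrArg Fin.val h₃, (ht r hr r' hr' d d' hrd hrd').2 hR⟩

theorem refineTest_iff {N : ℕ} (h : I.Presents D) (hN : I.Bounded N) (T : List Tup)
    (X Y : Fin I.numSymbols) (B : Fin I.numStates → Fin I.numStates → Prop)
    (p q : Fin I.numStates) :
    refineTest N (I.rules.map RawRule.toNat) (pairs I.numStates) T
      (X.val, Y.val, relList B, p.val, q.val) = true ↔
      D.refine (tableRel I.numStates I.numSymbols T) X Y B p q := by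
  have key : ∀ r ∈ I.rules, ∀ r' ∈ I.rules, ∀ d d', PresentsDist r.dist d →
      PresentsDist r'.dist d' → (liftTest N (pairs I.numStates) T (relList B) r.toNat.2.2.2
        r'.toNat.2.2.2 = true ↔ Lift (fun x y => (tableRel I.numStates I.numSymbols T).Rel B
          (x.1, x.2.1) (y.1, y.2.1)) d d') := fun r hr r' hr' d d' hd hd' =>
    liftTest_iff hd hd' (hN.entries r hr) (hN.frac r hr) (hN.frac r' hr') _ (targetRel_iff T B)
  rw [refineTest, Bool.and_eq_true, PPDA.refine]
  exact and_congr
    (transferTest_iff h p q X Y _ (fun r r' => liftTest N (pairs I.numStates) T (relList B) r.2.2.2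
      r'.2.2.2) key)
    (transferTest_iff h q p Y X _ (fun r' r => liftTest N (pairs I.numStates) T (relList B) r.2.2.2
      r'.2.2.2) fun r' hr' r hr d' d hd' hd => key r hr r' hr' d d' hd hd')

/-- The two iterations agree round by round: all tuples represent the full table, and filtering by
`refineTest` represents `PPDA.refine`. -/
theorem tableRel_tableOf {N : ℕ} (h : I.Presents D) (hN : I.Bounded N) :
    tableRel I.numStates I.numSymbols
      (tableOf N I.numStates I.numSymbols (I.rules.map RawRule.toNat)) =
      D.approx (allTuples N I.numStates I.numSymbols).length := by
  rw [tableOf]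
  generalize (allTuples N I.numStates I.numSymbols).length = k
  induction k with
  | zero =>
    funext X Y B p q
    simp only [PPDA.approx, Function.iterate_zero, id]
    exact eq_true (mem_allTuples hN.states X Y B p q)
  | succ k ih =>
    rw [Function.iterate_succ_apply', PPDA.approx_succ, ← ih]
    funext X Y B p q
    rw [← refineTest_iff h hN, tableRel, List.mem_filter, eq_iff_iff]
    exact and_iff_right (mem_allTuples hN.states X Y B p q)

theorem revZip_eq (α β : List ℕ) : revZip α β = (α.zip β).reverse := by
  have key : ∀ (α β : List ℕ) (acc : List (ℕ × ℕ)), (α.foldl (fun s X => (s.1.tail,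
      cond s.1.isEmpty s.2 ((X, s.1.headD 0) :: s.2))) (β, acc)).2 =
      (α.zip β).reverse ++ acc := by
    intro α
    induction α with
    | nil => simp
    | cons X α ih =>
      intro β acc
      rw [List.foldl_cons, ih]
      cases β <;> simp
  rw [revZip, key, List.append_nil]

theorem stackRelOf_cons (n : ℕ) (rs : List NatRule) (T : List Tup) (X Y : ℕ) (α β : List ℕ) :
    stackRelOf n rs T (X :: α) (Y :: β) = lookup (pairs n) T X Y (stackRelOf n rs T α β) := by
  have e : bottomRel n rs (X :: α) (Y :: β) = bottomRel n rs α β := by simp [bottomRel]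
  simp only [stackRelOf, revZip_eq, e, List.zip_cons_cons, List.foldl_reverse, List.foldr_cons]

theorem stackRelOf_eq (h : I.Presents D) (T : List Tup) (α β : List (Fin I.numSymbols)) :
    stackRelOf I.numStates (I.rules.map RawRule.toNat) T (α.map Fin.val) (β.map Fin.val) =
      relList (D.stackRel (tableRel I.numStates I.numSymbols T) α β) := by
  induction α generalizing β with
  | nil =>
    cases β with
    | nil =>
      exact filter_pairs_eq_relList fun p q => by simp [PPDA.stackRel]
    | cons Y β =>
      exact filter_pairs_eq_relList fun p q => by simp [PPDA.stackRel, stuckTest_iff h]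
  | cons X α ih =>
    cases β with
    | nil =>
      rw [stackRelOf, revZip_eq, List.map_nil, List.zip_nil_right]
      exact filter_pairs_eq_relList fun p q => by simp [PPDA.stackRel, stuckTest_iff h]
    | cons Y β =>
      rw [List.map_cons, List.map_cons, stackRelOf_cons, ih, lookup_relList]
      rfl

theorem bisimTest_iff {N : ℕ} (h : I.Presents D) (hN : I.Bounded N) :
    bisimTest N I.toNat = true ↔ D.toPLTS.Bisimilar I.left I.right := by
  rw [PvPDA.bisimilar_iff D _ (D.approx_stable _ (card_le_length_allTuples hN.states)),
    ← tableRel_tableOf h hN, bisimTest, elemTest_eq_true]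
  simp only [Instance.toNat, stackRelOf_eq h, mem_relList]

theorem diracTest_iff (h : I.Presents D) : diracTest I.toNat = true ↔ D.IsStandard := by
  have key : ∀ r ∈ I.rules, ∀ d, PresentsDist r.dist d → ((r.toNat.2.2.2.all fun e =>
      r.toNat.2.2.2.all fun e' => decide (e.1 = 0) || (decide (e'.1 = 0) ||
        decide (e.2.2 = e'.2.2))) = true ↔ ∃ x, d = PMF.pure x) := by
    intro r hr d hd
    rw [hd.exists_eq_pure_iff]
    simp only [RawRule.toNat, List.all_map, List.all_eq_true, Function.comp, Bool.or_eq_true,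
      decide_eq_true_eq]
    simp only [Entry.toNat, natTarget_injective.eq_iff]
  rw [diracTest, Instance.toNat, List.all_map, List.all_eq_true]
  constructor
  · intro H q X a d hd
    obtain ⟨r, hr, -, -, -, hrd⟩ := h.2.2 _ _ _ _ hd
    exact (key r hr d hrd).1 (H r hr)
  · intro H r hr
    obtain ⟨d, hd, hrd⟩ := h.2.1 r hr
    exact (key r hr d hrd).2 (H _ _ _ _ hd)

end

/-- The only obstacles to an automaton are entries that do not sum to one and targets of the wrong
length. Entries with numerator zero are exempt from the latter, as they do not contribute to the
support. -/
theorem visiblyTest_iff {I : Instance} {N : ℕ} (hN : I.Bounded N) :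
    visiblyTest N I.toNat = true ↔ ∃ D, I.Presents D := by
  have h₁ : visiblyTest N I.toNat = true ↔ ∀ r ∈ I.rules, (∃ d, PresentsDist r.dist d) ∧
      ∀ e ∈ r.dist, e.num = 0 ∨ e.target.2.1.length = (I.kinds.get r.action).width := by
    rw [visiblyTest, Instance.toNat, List.all_map, List.all_eq_true]
    refine forall₂_congr fun r hr => ?_
    rw [exists_presentsDist_iff, ← coe_natWeight, ENNReal.coe_eq_one,
      ← fracSum_eq_iff (den_pos _) (hN.frac r hr), Function.comp, Bool.and_eq_true,
      decide_eq_true_eq, RawRule.toNat]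
    refine and_congr_right fun _ => ?_
    simp only [List.all_map, List.all_eq_true, Function.comp, Bool.or_eq_true, decide_eq_true_eq]
    simp [Entry.toNat, natTarget, List.headD_eq_head?_getD]
  rw [h₁]
  constructor
  · intro H
    refine ⟨⟨⟨{t | ∃ r ∈ I.rules, ∃ d, PresentsDist r.dist d ∧
      t = (r.state, r.top, r.action, d)}, ?_, ?_⟩, I.kinds.get, ?_⟩, fun _ => rfl, ?_, ?_⟩
    · have : {t | ∃ r ∈ I.rules, ∃ d, PresentsDist r.dist d ∧
          t = (r.state, r.top, r.action, d)} = ⋃ r ∈ {r | r ∈ I.rules},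
          {t | ∃ d, PresentsDist r.dist d ∧ t = (r.state, r.top, r.action, d)} := by
        ext t
        simp
      rw [this]
      -- A written-out rule presents at most one distribution, so finitely many rules arise.
      refine Set.Finite.biUnion (List.finite_toSet I.rules) fun r _ => Set.Subsingleton.finite ?_
      rintro _ ⟨d, hd, rfl⟩ _ ⟨d', hd', rfl⟩
      rw [hd.unique hd']
    · rintro q X a d ⟨r, hr, d', hd', h⟩
      simp only [Prod.mk.injEq] at h
      obtain ⟨rfl, rfl, rfl, rfl⟩ := h
      exact hd'.rational
    · rintro q X a d ⟨r, hr, d', hd', h⟩ x hx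
      simp only [Prod.mk.injEq] at h
      obtain ⟨rfl, rfl, rfl, rfl⟩ := h
      obtain ⟨e, he, h₀, rfl⟩ := (hd'.mem_support_iff x).1 hx
      exact ((H r hr).2 e he).resolve_left h₀
    · intro r hr
      obtain ⟨d, hd⟩ := (H r hr).1
      exact ⟨d, ⟨r, hr, d, hd, rfl⟩, hd⟩
    · rintro q X a d ⟨r, hr, d', hd', h⟩
      simp only [Prod.mk.injEq] at h
      obtain ⟨rfl, rfl, rfl, rfl⟩ := h
      exact ⟨r, hr, rfl, rfl, rfl, hd'⟩
  · rintro ⟨D, h⟩ r hr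
    obtain ⟨d, hd, hrd⟩ := h.2.1 r hr
    refine ⟨⟨d, hrd⟩, fun e he => ?_⟩
    by_cases h₀ : e.num = 0
    · exact Or.inl h₀
    · refine Or.inr ?_
      rw [← h.1]
      exact D.visibly _ _ _ _ hd _ ((hrd.mem_support_iff _).2 ⟨e, he, h₀, rfl⟩)

theorem decidePv_iff {w : List Letter} {N : ℕ} (hN : 2 ^ w.length ≤ N) :
    decidePv (w, N) = true ↔ ∃ I : Instance, I.encode = w ∧ (instP (N, w)).1 = I.toNat ∧
      visiblyTest N I.toNat = true ∧ bisimTest N I.toNat = true := by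
  simp only [decidePv, Bool.and_eq_true, decide_eq_true_eq, wfTest_iff]
  constructor
  · rintro ⟨h₁, ⟨I, hI⟩, h₂, h₃⟩
    rw [← hI] at h₁ h₂ h₃
    exact ⟨I, by rw [← encNatInst_toNat, h₁], hI.symm, h₂, h₃⟩
  · rintro ⟨I, rfl, hI, h₂, h₃⟩
    rw [hI]
    exact ⟨encNatInst_toNat I, ⟨I, rfl⟩, h₂, h₃⟩

theorem instP_encode {I : Instance} {N : ℕ} (hN : 2 ^ I.encode.length ≤ N) :
    (instP (N, I.encode)).1 = I.toNat := by
  rw [← encNatInst_toNat] at hN ⊢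
  have := parses_instP N I.toNat [] (by simpa using hN)
  rw [List.append_nil] at this
  rw [this]

theorem two_pow_length_le (w : List Letter) :
    2 ^ w.length ≤ 2 ^ (w.length * w.length + w.length) :=
  Nat.pow_le_pow_right (by simp) (Nat.le_add_left _ _)

theorem mem_pvPDABisimilarity_iff (w : List Letter) : w ∈ pvPDABisimilarity ↔
    decidePv (w, 2 ^ (w.length * w.length + w.length)) = true := by
  rw [decidePv_iff (two_pow_length_le w)]
  constructor
  · rintro ⟨I, rfl, D, hD, hb⟩
    exact ⟨I, rfl, instP_encode (two_pow_length_le _), (visiblyTest_iff I.bounded).2 ⟨D, hD⟩,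
      (bisimTest_iff hD I.bounded).2 hb⟩
  · rintro ⟨I, rfl, -, hv, hb⟩
    obtain ⟨D, hD⟩ := (visiblyTest_iff I.bounded).1 hv
    exact ⟨I, rfl, D, hD, (bisimTest_iff hD I.bounded).1 hb⟩

theorem mem_vPDABisimilarity_iff (w : List Letter) : w ∈ vPDABisimilarity ↔
    decideV (w, 2 ^ (w.length * w.length + w.length)) = true := by
  rw [decideV, Bool.and_eq_true, decidePv_iff (two_pow_length_le w)]
  constructor
  · rintro ⟨I, rfl, D, hD, hs, hb⟩
    have hI := instP_encode (I := I) (two_pow_length_le _)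
    exact ⟨⟨I, rfl, hI, (visiblyTest_iff I.bounded).2 ⟨D, hD⟩, (bisimTest_iff hD I.bounded).2 hb⟩,
      by rw [hI]; exact (diracTest_iff hD).2 hs⟩
  · rintro ⟨⟨I, rfl, hI, hv, hb⟩, hs⟩
    obtain ⟨D, hD⟩ := (visiblyTest_iff I.bounded).1 hv
    rw [hI] at hs
    exact ⟨I, rfl, D, hD, (diracTest_iff hD).1 hs, (bisimTest_iff hD I.bounded).1 hb⟩

end PVPDA

theorem theorem4p2 :
    PVPDA.InEXPTIME PVPDA.pvPDABisimilarity ∧ PVPDA.InEXPTIME PVPDA.vPDABisimilarity := by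
  have hq : StackProg.PolyTime fun w : List PVPDA.Letter => w.length * w.length + w.length := by
    fun_prop
  exact ⟨StackProg.inEXPTIME_of_polyTime _ _ hq _ PVPDA.polyTime_decidePv
      PVPDA.mem_pvPDABisimilarity_iff,
    StackProg.inEXPTIME_of_polyTime _ _ hq _ PVPDA.polyTime_decideV
      PVPDA.mem_vPDABisimilarity_iff⟩
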